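/- Let $k\ge 2$ be an integer and $0<t<1$. For $|z|=1$, $z=e^{i\phi}$, let $B_{\phi,t}(w)=z\left(\frac{w+t}{1+wt}\right)^k$, a map of the unit circle $\mathbb T=\{|w|=1\}$ to itself, and let $B(\phi,\theta)=(\phi,B_{\phi,t}(\theta))$ be the associated skew product of $\mathbb T\times\mathbb T$ (points of $\mathbb T$ are identified with their arguments). Let $\Gamma_n$ be the rooted Cayley tree with branching number $k$ and $n$ levels below the root, with vertex set $V_n$. Its Lee–Yang zeros are the zeros $z$, counted with multiplicity, of the polynomial $$Z_n(z,t)=\sum_{\sigma:V_n\to\{\pm1\}}t^{\#\{\text{edges }\{u,v\}:\ \sigma(u)\ne\sigma(v)\}}\,z^{\#\{v:\ \sigma(v)=-1\}},$$ which is the Ising partition function in the variables $z=e^{-2h/T}$, $t=e^{-2J/T}$, with denominators cleared. Let $\mu_{t,n}=\frac1{|V_n|}\sum\delta_{z_i(t)}$ be the normalized counting measure on these zeros. **Proposition.** The measures $\mu_{t,n}$ converge weakly to a probability measure $\mu_t$ on $\mathbb T$. Let $S_t=\operatorname{Supp}(\mu_t)$, and let $X_t\subset\operatorname{interior}(S_t)$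 be a nondegenerate compact interval, that is, a closed arc which is neither a point nor all of $\mathbb T$; in the case $t=t_c:=\frac{k-1}{k+1}$ suppose also that $\phi=0$ does not belong to $X_t$. Then: There is a unique central foliation $\mathcal F^c$ of $X_t\times\mathbb T$, that is, a unique partition of $X_t\times\mathbb T$ into graphs (leaves) of $C^1$ functions $\theta=g(\phi)$, $\phi\in X_t$, whose slopes $g'(\phi)$ form a continuous function on $X_t\times\mathbb T$, such that the preimage under $B$ of each leaf is a union of leaves. There is a transverse invariant measure $\eta$ for $\mathcal F^c$: a family of Borel measures $\eta_\tau$, one on each $C^1$ curve $\tau$ without self-intersections in $X_t\times\mathbb T$ that is transverse to $\mathcal F^c$, such that $\eta_{\tau'}=\eta_\tau|_{\tau'}$ whenever $\tau'\subseteq\tau$, and such that $\eta_{\tau_2}=(g_{\tau_1,\tau_2})_*\eta_{\tau_1}$ whenever each point of $\tau_1$ lies on the same leaf as exactly one point of $\tau_2$ and vice versa, where $g_{\tau_1,\tau_2}:\tau_1\to\tau_2$ is the resulting holonomy bijection. Moreover: (i) for every $\phi\in X_t$ the vertical fiber $\mathbb T_\phi=\{\phi\}\times\mathbb T$ is a transversal,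 and $\eta$ on $\mathbb T_\phi$ is the measure of maximal entropy of $B_{\phi,t}$, that is, the unique invariant Borel probability measure of largest metric (Kolmogorov–Sinai) entropy; (ii) the diagonal $\Delta_t=\{(\delta,\delta):\delta\in X_t\}$ is a transversal, and $\eta$ on $\Delta_t$, parametrized by $\delta$, is $\frac{k}{k-1}$ times the restriction of $\mu_t$ to $X_t$. -/

import Mathlib

open Set Filter Topology MeasureTheory
open scoped ENNReal BoundedContinuousFunction Polynomial

noncomputable section

/-! ### The unit circle and the skew product -/

/-- The unit circle carries its Borel σ-algebra. -/
instance Circle.instMeasurableSpaceBorel : MeasurableSpace Circle := borel Circle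

instance Circle.instBorelSpaceBorel : BorelSpace Circle := ⟨rfl⟩

namespace LeeYangCayley

/-- The Blaschke product `B_{z,t,k}(w) = z ((w + t) / (1 + w t)) ^ k`. -/
def blaschke (k : ℕ) (t : ℝ) (z w : ℂ) : ℂ :=
  z * ((w + (t : ℂ)) / (1 + w * (t : ℂ))) ^ k

theorem one_add_mul_ne_zero {t : ℝ} (h0 : 0 ≤ t) (h1 : t < 1) (w : Circle) :
    (1 : ℂ) + (w : ℂ) * (t : ℂ) ≠ 0 := by
  intro h
  have h2 : (w : ℂ) * (t : ℂ) = -1 := by linear_combination h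
  have h3 : ‖(w : ℂ) * (t : ℂ)‖ = t := by
    rw [norm_mul, Circle.norm_coe, one_mul, Complex.norm_real, Real.norm_eq_abs, abs_of_nonneg h0]
  rw [h2] at h3
  simp at h3
  linarith

/-- For `0 ≤ t < 1` the Blaschke product preserves the unit circle. -/
theorem norm_blaschke {t : ℝ} (h0 : 0 ≤ t) (h1 : t < 1) (k : ℕ) (z w : Circle) :
    ‖blaschke k t z w‖ = 1 := by
  have hne := one_add_mul_ne_zero h0 h1 w
  have hww : (w : ℂ) * (starRingEnd ℂ) (w : ℂ) = 1 := by
    rw [Complex.mul_conj, Circle.normSq_coe, Complex.ofReal_one]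
  have hnum : ‖(w : ℂ) + (t : ℂ)‖ = ‖(1 : ℂ) + (w : ℂ) * (t : ℂ)‖ := by
    have e : (w : ℂ) + (t : ℂ)
        = (w : ℂ) * (starRingEnd ℂ) ((1 : ℂ) + (w : ℂ) * (t : ℂ)) := by
      rw [map_add, map_mul, map_one, Complex.conj_ofReal]
      linear_combination (-(t : ℂ)) * hww
    rw [e, norm_mul, Circle.norm_coe, one_mul, RCLike.norm_conj]
  unfold blaschke
  rw [norm_mul, norm_pow, norm_div, hnum, div_self (norm_ne_zero_iff.mpr hne),
    one_pow, mul_one, Circle.norm_coe]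

/-- A complex number of modulus one, as a point of the unit circle. -/
def circleMk (u : ℂ) (hu : ‖u‖ = 1) : Circle where
  val := u
  property := mem_sphere_zero_iff_norm.mpr hu

theorem coe_circleMk (u : ℂ) (hu : ‖u‖ = 1) : (circleMk u hu : ℂ) = u := rfl

open Classical in
/-- The circle map `w ↦ B_{z,t,k}(w)` for `z` on the unit circle. The second branch never occurs
for `0 ≤ t < 1`, see `coe_blaschkeCircle`. -/
def blaschkeCircle (k : ℕ) (t : ℝ) (z w : Circle) : Circle :=
  if h : ‖blaschke k t z w‖ = 1 then circleMk (blaschke k t z w) h else 1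

theorem coe_blaschkeCircle {t : ℝ} (h0 : 0 ≤ t) (h1 : t < 1) (k : ℕ) (z w : Circle) :
    ((blaschkeCircle k t z w : Circle) : ℂ) = blaschke k t z w := by
  unfold blaschkeCircle
  rw [dif_pos (norm_blaschke h0 h1 k z w), coe_circleMk]

/-- The skew product `B(φ, θ) = (φ, B_{φ,t}(θ))`. A point of the phase space is written
`(φ, w)`, where `φ` is a real angle and `w = e^{iθ}`. -/
def skewProduct (k : ℕ) (t : ℝ) (x : ℝ × Circle) : ℝ × Circle :=
  (x.1, blaschkeCircle k t (Circle.exp x.1) x.2)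

/-! ### The Ising model on the rooted Cayley tree and its Lee–Yang zeros -/

/-- Vertices of the `n`-th level rooted Cayley tree with branching number `k`: level `0` is a
single root, level `n + 1` is a root (`none`) together with `k` copies of level `n`. -/
def CayleyVertex (k : ℕ) : ℕ → Type
  | 0 => Unit
  | n + 1 => Option (Fin k × CayleyVertex k n)

instance CayleyVertex.instFintype (k : ℕ) : (n : ℕ) → Fintype (CayleyVertex k n)
  | 0 => inferInstanceAs (Fintype Unit)
  | n + 1 =>
    letI := CayleyVertex.instFintype k n
    inferInstanceAs (Fintype (Option (Fin k × CayleyVertex k n)))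

def cayleyRoot (k : ℕ) : (n : ℕ) → CayleyVertex k n
  | 0 => ()
  | _ + 1 => none

/-- `IsParent k n u v`: the vertex `v` is a child of the vertex `u`. The children of the root of
level `n + 1` are the roots of the `k` copies of level `n`. -/
def IsParent (k : ℕ) : (n : ℕ) → CayleyVertex k n → CayleyVertex k n → Prop
  | 0, _, _ => False
  | n + 1, none, some (_, v) => v = cayleyRoot k n
  | n + 1, some (i, u), some (j, v) => i = j ∧ IsParent k n u v
  | _ + 1, _, none => False

/-- The `n`-th level rooted Cayley tree `Γ_n^k`. -/
def cayleyTree (k n : ℕ) : SimpleGraph (CayleyVertex k n) :=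
  SimpleGraph.fromRel (IsParent k n)

open Classical in
/-- The partition function of the Ising model on a finite graph, as a polynomial in the field
variable `z = exp (-2h/T)` for a fixed temperature variable `t = exp (-2J/T)`, after multiplication
by `z ^ (|V| / 2) * t ^ (|E| / 2)`: the configuration `σ` has weight `t ^ m * z ^ l`, with `m` the
number of edges whose two ends have different spins and `l` the number of spins `-1`. -/
def isingPolynomial {V : Type} [Fintype V] (G : SimpleGraph V) (t : ℝ) : ℂ[X] :=
  ∑ σ : V → ℤˣ,
    Polynomial.C ((t : ℂ) ^ (G.edgeFinset.filter fun e => ¬ (e.map σ).IsDiag).card) *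
      Polynomial.X ^ (Finset.univ.filter fun v => σ v = -1).card

/-- `μ_{t,n} = |V_n|⁻¹ ∑ δ_{z_i(t)}`, the sum over the Lee–Yang zeros of the `n`-th level rooted
Cayley tree, counted with multiplicity. -/
def leeYangMeasure (k : ℕ) (t : ℝ) (n : ℕ) : Measure ℂ :=
  (Fintype.card (CayleyVertex k n) : ℝ≥0∞)⁻¹ •
    ((isingPolynomial (cayleyTree k n) t).roots.map fun z => Measure.dirac z).sum

/-- `μ` is the limiting measure of Lee–Yang zeros for the rooted Cayley tree: a probability measure
on the unit circle to which the measures `μ_{t,n}` converge weakly. -/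
def IsLimitingLeeYangMeasure (k : ℕ) (t : ℝ) (μ : Measure Circle) : Prop :=
  IsProbabilityMeasure μ ∧
    ∀ f : ℂ →ᵇ ℝ,
      Tendsto (fun n => ∫ z, f z ∂(leeYangMeasure k t n)) atTop (𝓝 (∫ z : Circle, f (z : ℂ) ∂μ))

/-! ### Metric entropy and the measure of maximal entropy -/

section Entropy

variable {Ω : Type} [MeasurableSpace Ω]

/-- The Shannon entropy of the join `ξ ∨ f⁻¹ξ ∨ ⋯ ∨ f⁻⁽ⁿ⁻¹⁾ξ`, where the finite partition `ξ` is
given by its labelling function. -/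
def blockEntropy (f : Ω → Ω) (ρ : Measure Ω) {m : ℕ} (ξ : Ω → Fin m) (n : ℕ) : ℝ :=
  ∑ s : Fin n → Fin m, Real.negMulLog (ρ.real {x | ∀ i : Fin n, ξ (f^[(i : ℕ)] x) = s i})

/-- The metric (Kolmogorov–Sinai) entropy `h_ρ(f)`. -/
def metricEntropy (f : Ω → Ω) (ρ : Measure Ω) : ℝ≥0∞ :=
  ⨆ (m : ℕ) (ξ : Ω → Fin m) (_ : Measurable ξ),
    limsup (fun n : ℕ => ENNReal.ofReal (blockEntropy f ρ ξ n / n)) atTop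

/-- `η` is the measure of maximal entropy of `f`: the unique invariant probability measure of
largest metric entropy. -/
def IsMME (f : Ω → Ω) (η : Measure Ω) : Prop :=
  IsProbabilityMeasure η ∧ MeasurePreserving f η η ∧
    ∀ ρ : Measure Ω, IsProbabilityMeasure ρ → MeasurePreserving f ρ ρ → ρ ≠ η →
      metricEntropy f ρ < metricEntropy f η

end Entropy

/-! ### Central foliations, transversals, transverse invariant measures

The base interval is `X = {e^{iφ} : a ≤ φ ≤ b}`, and `X × 𝕋` is `strip a b`. -/

def strip (a b : ℝ) : Set (ℝ × Circle) := Icc a b ×ˢ univ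

/-- The curve `θ = g(φ)`, `a ≤ φ ≤ b`, in `X × 𝕋`. -/
def graphCurve (a b : ℝ) (g : ℝ → ℝ) : Set (ℝ × Circle) :=
  (fun φ => (φ, Circle.exp (g φ))) '' Icc a b

/-- `F` (the set of leaves) is a strictly horizontal foliation of `X × 𝕋`: the leaves partition
`X × 𝕋`, they are `C¹` curves, and their tangent lines form a continuous line field transverse to
the vertical direction (with continuous slope `s`; as `X × 𝕋` is compact, `s` is bounded, so the
line field lies in a horizontal cone field). Since the vertical fibres are compact, each leaf of
such a foliation is a graph over the whole of `X`. -/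
def IsHorizontalFoliation (a b : ℝ) (F : Set (Set (ℝ × Circle))) : Prop :=
  (∀ x ∈ strip a b, ∃! L, L ∈ F ∧ x ∈ L) ∧
    ∃ s : ℝ × Circle → ℝ, ContinuousOn s (strip a b) ∧
      ∀ L ∈ F, ∃ g : ℝ → ℝ, ContDiffOn ℝ 1 g (Icc a b) ∧ L = graphCurve a b g ∧
        ∀ φ ∈ Icc a b, derivWithin g (Icc a b) φ = s (φ, Circle.exp (g φ))

/-- A central foliation of the skew product over `X`: a strictly horizontal foliation of `X × 𝕋`
invariant under `B⁻¹`, i.e. the preimage of each leaf is a union of leaves. -/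
def IsCentralFoliation (k : ℕ) (t a b : ℝ) (F : Set (Set (ℝ × Circle))) : Prop :=
  IsHorizontalFoliation a b F ∧
    ∀ L ∈ F, ∀ L' ∈ F, (L' ∩ skewProduct k t ⁻¹' L).Nonempty → L' ⊆ skewProduct k t ⁻¹' L

def SameLeaf (F : Set (Set (ℝ × Circle))) (x y : ℝ × Circle) : Prop :=
  ∃ L ∈ F, x ∈ L ∧ y ∈ L

/-- `τ` is a (local) transversal to `F`: a `C¹` curve `u ↦ (p u, e^{i q u})` in `X × 𝕋` without
self-intersections, parametrized by a nondegenerate interval, whose velocity is at no point tangent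
to the leaf through that point. (For `I = [0, 2π)` this includes the whole vertical fibres.) -/
def IsTransversal (a b : ℝ) (F : Set (Set (ℝ × Circle))) (τ : Set (ℝ × Circle)) : Prop :=
  τ ⊆ strip a b ∧
    ∃ (I : Set ℝ) (p q : ℝ → ℝ), I.OrdConnected ∧ I.Nontrivial ∧
      ContDiffOn ℝ 1 p I ∧ ContDiffOn ℝ 1 q I ∧
      InjOn (fun u => (p u, Circle.exp (q u))) I ∧
      τ = (fun u => (p u, Circle.exp (q u))) '' I ∧
      ∀ u ∈ I, ∀ g : ℝ → ℝ, ContDiffOn ℝ 1 g (Icc a b) → graphCurve a b g ∈ F →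
        Circle.exp (g (p u)) = Circle.exp (q u) →
        derivWithin q I u ≠ derivWithin g (Icc a b) (p u) * derivWithin p I u

/-- `τ₁` and `τ₂` correspond under holonomy along `F`, and `h` restricts on `τ₁` to the holonomy
transformation `τ₁ → τ₂`: `h x` is the unique point of `τ₂` on the leaf of `x ∈ τ₁`, and every
point of `τ₂` arises from exactly one point of `τ₁`. -/
def IsHolonomy (F : Set (Set (ℝ × Circle))) (τ₁ τ₂ : Set (ℝ × Circle))
    (h : ℝ × Circle → ℝ × Circle) : Prop :=
  BijOn h τ₁ τ₂ ∧ ∀ x ∈ τ₁, ∀ y ∈ τ₂, SameLeaf F x y ↔ h x = y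

/-- A transverse invariant measure for `F`: a family of Borel measures `η τ`, one on each
transversal `τ`, compatible with restriction to smaller transversals (in particular `η τ` vanishes
outside `τ`) and invariant under holonomy. Values of `η` at sets that are not transversals play
no role. -/
def IsTransverseInvariantMeasure (a b : ℝ) (F : Set (Set (ℝ × Circle)))
    (η : Set (ℝ × Circle) → Measure (ℝ × Circle)) : Prop :=
  (∀ τ τ', IsTransversal a b F τ → IsTransversal a b F τ' → τ' ⊆ τ →
      η τ' = (η τ).restrict τ') ∧
    ∀ τ₁ τ₂, IsTransversal a b F τ₁ → IsTransversal a b F τ₂ →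
      ∀ h, IsHolonomy F τ₁ τ₂ h → AEMeasurable h (η τ₁) ∧ η τ₂ = (η τ₁).map h

/-- The vertical fibre `𝕋_φ = {φ} × 𝕋`. -/
def verticalFiber (φ : ℝ) : Set (ℝ × Circle) := {φ} ×ˢ univ

/-- The diagonal `Δ = {(δ, δ) : δ ∈ X}`. -/
def diagonal (a b : ℝ) : Set (ℝ × Circle) := graphCurve a b fun δ => δ

end LeeYangCayley

end

open Set Filter Topology MeasureTheory
open scoped ENNReal BoundedContinuousFunction Polynomial

noncomputable section

namespace LeeYangCayley

/-! ### Lifts of the Blaschke products to the real line -/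

/-! Lift the fibre map to the line: F_φ(θ) = φ + k A(θ), where A = `angleLift t` is an increasing
lift of w ↦ (w + t)/(1 + wt). Since A moves points by less than π, the limit Φ_φ(θ) = lim k^(-n)
F_φ^n(θ) exists (`linearization`). It is continuous in (φ, θ), nondecreasing in θ, commutes with
full turns in θ and satisfies Φ_φ ∘ F_φ = k Φ_φ. Everything is read off from Φ: the leaves are its
level sets, η is dΦ/2π along transversals, and μ is a multiple of dΦ along the diagonal.

Zeros. The quotient of the partition functions with root spin -1 and +1 starts at z and evolves
under B_{φ,t}. At z = e^{iφ} it equals exp(i F_φ^n(φ)), so zeros on the circle solve F_φ^n(φ) ≡ π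
mod 2π. This increasing function of φ gains exactly 2π|V_n| over a period. Hence all zeros are
simple and on the circle, and their counting function is F_φ^n(φ)/2π up to a bounded error. In the
limit the distribution function is proportional to Φ_φ(φ), whose increment over a period is
2πk/(k-1); this is the source of the factor in (ii).

Expansion. A non-repelling fixed point e^{iθ}, θ ≠ 0, of a fibre map traps the orbits of (φ, φ) for
all φ between 0 and θ - kA(θ), so Φ_φ(φ) is constant there and the support has a gap
(`linearization_diag_eq_zero`). For θ = 0 with multiplier < 1 a nearby θ does the same; only
multiplier exactly 1, that is t = t_c and φ = 0, escapes. Over X all fixed points on the circle are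
therefore repelling. Then B has a fixed point p in the open disc, obtained from fixed points of rB
as r → 1 (`exists_fixed_point_norm_lt_one`); the harmonic measure seen from p is strictly expanded
(`norm_blaschke_sub_sq_lt`); and by compactness one iterate expands all fibres over X by a factor at
least 2 (`exists_uniform_expansion`).

Foliation. Expansion makes Φ_φ strictly increasing, so its level sets are graphs. They are limits of
pulled back horizontal lines, whose slopes -∑ 1/(F^j)' converge uniformly (`leafFun_sub_leafFun`,
`contDiffOn_leafFun`). For any central foliation the forward images of a leaf have bounded height
variation; dividing by k^n shows that Φ is constant on the leaf (`eq_range_of_isCentralFoliation`).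

Transverse measure. Φ is strictly monotone along every transversal
(`injOn_linearization_of_isTransversal`) and holonomy preserves Φ mod 2π, so Lebesgue measure in the
coordinate Φ is invariant. On a vertical fibre Φ/2π conjugates B to multiplication by k on ℝ/ℤ,
where every base-k word of length n has mass k^(-n); a coding argument shows that every other
invariant measure has smaller entropy (`isMME_of_uniform`). The leaves have negative slope, so the
diagonal is a transversal. -/

/-- The lift `θ ↦ arg ((e^{iθ} + t) / (1 + e^{iθ} t))` to the real line. -/
def angleLift (t θ : ℝ) : ℝ := θ - 2 * Real.arctan (t * Real.sin θ / (1 + t * Real.cos θ))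

theorem one_add_mul_cos_pos {t : ℝ} (ht : |t| < 1) (θ : ℝ) : 0 < 1 + t * Real.cos θ := by
  have h1 : |t * Real.cos θ| < 1 := by
    rw [abs_mul]
    exact (mul_le_of_le_one_right (abs_nonneg t) (Real.abs_cos_le_one θ)).trans_lt ht
  linarith [(abs_lt.mp h1).1]

theorem poisson_denom_pos {t : ℝ} (ht : |t| < 1) (θ : ℝ) : 0 < 1 + t ^ 2 + 2 * t * Real.cos θ := by
  have h := one_add_mul_cos_pos ht θ
  have h2 := Real.sin_sq_add_cos_sq θ
  have h3 : 1 + t ^ 2 + 2 * t * Real.cos θ = (1 + t * Real.cos θ) ^ 2 + (t * Real.sin θ) ^ 2 := by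
    linear_combination (-t ^ 2) * h2
  rw [h3]
  positivity

theorem hasDerivAt_angleLift {t : ℝ} (ht : |t| < 1) (θ : ℝ) :
    HasDerivAt (angleLift t) ((1 - t ^ 2) / (1 + t ^ 2 + 2 * t * Real.cos θ)) θ := by
  have hc := one_add_mul_cos_pos ht θ
  have hd := poisson_denom_pos ht θ
  have hq : HasDerivAt (fun θ => t * Real.sin θ / (1 + t * Real.cos θ))
      ((t * Real.cos θ * (1 + t * Real.cos θ) - t * Real.sin θ * (t * (-Real.sin θ))) /
        (1 + t * Real.cos θ) ^ 2) θ :=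
    ((Real.hasDerivAt_sin θ).const_mul t).div
      (((Real.hasDerivAt_cos θ).const_mul t).const_add 1) hc.ne'
  have h := (hasDerivAt_id θ).sub ((hq.arctan).const_mul 2)
  refine h.congr_deriv ?_
  have h2 := Real.sin_sq_add_cos_sq θ
  have hd' : (1 + t * Real.cos θ) ^ 2 + (t * Real.sin θ) ^ 2 ≠ 0 := by positivity
  have h3 : 1 + t ^ 2 + 2 * t * Real.cos θ = (1 + t * Real.cos θ) ^ 2 + (t * Real.sin θ) ^ 2 := by
    linear_combination (-t ^ 2) * h2
  rw [h3]
  field_simp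
  linear_combination (-t ^ 2 : ℝ) * h2

theorem continuous_angleLift {t : ℝ} (ht : |t| < 1) : Continuous (angleLift t) :=
  continuous_iff_continuousAt.mpr fun θ => (hasDerivAt_angleLift ht θ).continuousAt

theorem strictMono_angleLift {t : ℝ} (ht : |t| < 1) : StrictMono (angleLift t) := by
  refine strictMono_of_hasDerivAt_pos (hasDerivAt_angleLift ht) fun θ => ?_
  have : t ^ 2 < 1 := (sq_lt_one_iff_abs_lt_one t).mpr ht
  exact div_pos (by linarith) (poisson_denom_pos ht θ)

theorem angleLift_add_int_mul_two_pi (t θ : ℝ) (m : ℤ) :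
    angleLift t (θ + m * (2 * Real.pi)) = angleLift t θ + m * (2 * Real.pi) := by
  simp only [angleLift, Real.sin_add_int_mul_two_pi, Real.cos_add_int_mul_two_pi]
  ring

theorem angleLift_neg (t θ : ℝ) : angleLift t (-θ) = -angleLift t θ := by
  simp only [angleLift, Real.sin_neg, Real.cos_neg, mul_neg, neg_div, Real.arctan_neg]
  ring

/-- The arctangent stays in (-π/2, π/2). This uniform displacement bound drives the convergence of
the series for Φ. -/
theorem abs_angleLift_sub_lt (t θ : ℝ) : |angleLift t θ - θ| < Real.pi := by
  have h1 := Real.arctan_lt_pi_div_two (t * Real.sin θ / (1 + t * Real.cos θ))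
  have h2 := Real.neg_pi_div_two_lt_arctan (t * Real.sin θ / (1 + t * Real.cos θ))
  rw [angleLift, abs_lt]
  constructor <;> linarith

/-- On the circle w + t = w · conj(1 + wt), so the quotient is w · exp(-2i arg(1 + wt)); the real
part of 1 + wt is positive, so this argument is an arctangent. -/
theorem coe_exp_angleLift {t : ℝ} (ht : |t| < 1) (θ : ℝ) :
    (Circle.exp (angleLift t θ) : ℂ) =
      ((Circle.exp θ : ℂ) + t) / (1 + (Circle.exp θ : ℂ) * t) := by
  have hc := one_add_mul_cos_pos ht θ
  set c := 1 + t * Real.cos θ with hcdef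
  set s := t * Real.sin θ with hsdef
  have hcC : (c : ℂ) ≠ 0 := by exact_mod_cast hc.ne'
  set a := Real.arctan (s / c) with ha
  have hne : (c : ℂ) + s * Complex.I ≠ 0 := by
    intro h
    have := congrArg Complex.re h
    simp at this
    exact hc.ne' this
  have hr : (0 : ℝ) < √(1 + (s / c) ^ 2) := Real.sqrt_pos.mpr (by positivity)
  have hrC : ((√(1 + (s / c) ^ 2) : ℝ) : ℂ) ≠ 0 := by exact_mod_cast hr.ne'
  have hea : Complex.exp (a * Complex.I) =
      (c + s * Complex.I) / (c * (√(1 + (s / c) ^ 2) : ℝ)) := by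
    rw [Complex.exp_mul_I, ← Complex.ofReal_cos, ← Complex.ofReal_sin, ha, Real.cos_arctan,
      Real.sin_arctan]
    push_cast
    field_simp
  have hea' : Complex.exp (-(a * Complex.I)) =
      (c - s * Complex.I) / (c * (√(1 + (s / c) ^ 2) : ℝ)) := by
    rw [show -((a : ℂ) * Complex.I) = ((-a : ℝ) : ℂ) * Complex.I by push_cast; ring,
      Complex.exp_mul_I, ← Complex.ofReal_cos, ← Complex.ofReal_sin, Real.cos_neg, Real.sin_neg, ha,
      Real.cos_arctan, Real.sin_arctan]
    push_cast
    field_simp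
    ring
  have h2 : Complex.exp (((-(2 * a) : ℝ) : ℂ) * Complex.I) =
      (c - s * Complex.I) / (c + s * Complex.I) := by
    rw [show (((-(2 * a) : ℝ) : ℂ) * Complex.I) = -(a * Complex.I) - a * Complex.I by
      push_cast; ring, Complex.exp_sub, hea, hea']
    exact div_div_div_cancel_right₀ (mul_ne_zero hcC hrC) _ _
  have he : (Circle.exp θ : ℂ) = Real.cos θ + Real.sin θ * Complex.I := by
    rw [Circle.coe_exp, Complex.exp_mul_I, ← Complex.ofReal_cos, ← Complex.ofReal_sin]
  have hden : (1 : ℂ) + (Circle.exp θ : ℂ) * t = c + s * Complex.I := by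
    rw [he, hcdef, hsdef]
    push_cast
    ring
  rw [hden]
  have h3 : angleLift t θ = θ + -(2 * a) := by rw [angleLift, ha]; ring
  rw [h3, Circle.exp_add, Circle.coe_mul, Circle.coe_exp (-(2 * a)), h2, mul_div_assoc']
  congr 1
  rw [he, hcdef, hsdef]
  have hcs : (Real.sin θ : ℂ) ^ 2 + (Real.cos θ : ℂ) ^ 2 = 1 := by
    exact_mod_cast Real.sin_sq_add_cos_sq θ
  push_cast at hcs ⊢
  linear_combination (t : ℂ) * hcs -
    (t : ℂ) * Complex.sin θ ^ 2 * Complex.I_sq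

theorem one_add_coe_mul_ne_zero {t : ℝ} (ht : |t| < 1) (w : Circle) :
    (1 : ℂ) + (w : ℂ) * (t : ℂ) ≠ 0 := by
  intro h
  have h3 : ‖(w : ℂ) * (t : ℂ)‖ = |t| := by
    rw [norm_mul, Circle.norm_coe, one_mul, Complex.norm_real, Real.norm_eq_abs]
  rw [show (w : ℂ) * (t : ℂ) = -1 by linear_combination h] at h3
  simp at h3
  linarith

/-- The Möbius maps with parameters t and -t are inverse to each other, so the two sides differ by a
multiple of 2π. Two displacements of less than π leave only the multiple 0. -/
theorem angleLift_angleLift_neg {t : ℝ} (ht : |t| < 1) (x : ℝ) :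
    angleLift t (angleLift (-t) x) = x := by
  have ht' : |(-t)| < 1 := by rwa [abs_neg]
  have hE : Circle.exp (angleLift t (angleLift (-t) x)) = Circle.exp x := by
    apply Circle.ext
    rw [coe_exp_angleLift ht, coe_exp_angleLift ht']
    have h1 : (1 : ℂ) + (Circle.exp x : ℂ) * ((-t : ℝ) : ℂ) ≠ 0 :=
      one_add_coe_mul_ne_zero ht' _
    have ht2 : (1 : ℂ) - (t : ℂ) ^ 2 ≠ 0 := by
      have : t ^ 2 < 1 := (sq_lt_one_iff_abs_lt_one t).mpr ht
      have h4 : (1 - t ^ 2 : ℝ) ≠ 0 := by linarith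
      exact_mod_cast h4
    generalize (Circle.exp x : ℂ) = e at h1 ⊢
    rw [Complex.ofReal_neg] at h1 ⊢
    have h5 : (1 : ℂ) + (e + -(t : ℂ)) / (1 + e * -(t : ℂ)) * t =
        (1 - (t : ℂ) ^ 2) / (1 + e * -(t : ℂ)) := by
      rw [eq_div_iff h1, add_mul, mul_right_comm, div_mul_cancel₀ _ h1]
      ring
    have h6 : (e + -(t : ℂ)) / (1 + e * -(t : ℂ)) + t =
        e * (1 - (t : ℂ) ^ 2) / (1 + e * -(t : ℂ)) := by
      rw [eq_div_iff h1, add_mul, div_mul_cancel₀ _ h1]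
      ring
    rw [h5, h6, div_div_div_cancel_right₀ h1, mul_div_assoc, div_self ht2, mul_one]
  obtain ⟨m, hm⟩ := Circle.exp_eq_exp.mp hE
  have h1 := abs_lt.mp (abs_angleLift_sub_lt t (angleLift (-t) x))
  have h2 := abs_lt.mp (abs_angleLift_sub_lt (-t) x)
  have hpi := Real.pi_pos
  have hm1 : (m : ℝ) < 1 := by nlinarith
  have hm2 : (-1 : ℝ) < m := by nlinarith
  have hm0 : m = 0 := by
    have : m < 1 := by exact_mod_cast hm1
    have : -1 < m := by exact_mod_cast hm2
    omega
  simpa [hm0] using hm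

/-- The lift of the circle map `w ↦ B_{z,t,k}(w)`, `z = e^{iφ}`. -/
def fiberLift (k : ℕ) (t φ θ : ℝ) : ℝ := φ + k * angleLift t θ

theorem abs_lt_one_of_pos {t : ℝ} (h0 : 0 < t) (h1 : t < 1) : |t| < 1 := by
  rwa [abs_of_pos h0]

theorem blaschkeCircle_exp {t : ℝ} (h0 : 0 < t) (h1 : t < 1) (k : ℕ) (φ θ : ℝ) :
    blaschkeCircle k t (Circle.exp φ) (Circle.exp θ) = Circle.exp (fiberLift k t φ θ) := by
  apply Circle.ext
  rw [coe_blaschkeCircle h0.le h1, blaschke, fiberLift, Circle.exp_add, Circle.coe_mul,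
    ← coe_exp_angleLift (abs_lt_one_of_pos h0 h1), ← nsmul_eq_mul, Circle.exp_nsmul, Circle.coe_pow]

theorem skewProduct_exp {t : ℝ} (h0 : 0 < t) (h1 : t < 1) (k : ℕ) (φ θ : ℝ) :
    skewProduct k t (φ, Circle.exp θ) = (φ, Circle.exp (fiberLift k t φ θ)) := by
  rw [skewProduct, blaschkeCircle_exp h0 h1]

/-- The derivative of the fibre maps on the circle; it does not depend on the fibre. -/
def fiberDeriv (k : ℕ) (t : ℝ) (w : Circle) : ℝ :=
  k * ((1 - t ^ 2) / ‖(1 : ℂ) + (w : ℂ) * t‖ ^ 2)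

theorem norm_sq_one_add_exp_mul (t θ : ℝ) :
    ‖(1 : ℂ) + (Circle.exp θ : ℂ) * t‖ ^ 2 = 1 + t ^ 2 + 2 * t * Real.cos θ := by
  have h : (1 : ℂ) + (Circle.exp θ : ℂ) * t =
      ((1 + t * Real.cos θ : ℝ) : ℂ) + ((t * Real.sin θ : ℝ) : ℂ) * Complex.I := by
    rw [Circle.coe_exp, Complex.exp_mul_I, ← Complex.ofReal_cos, ← Complex.ofReal_sin]
    push_cast
    ring
  rw [h, Complex.sq_norm, Complex.normSq_add_mul_I]
  linear_combination t ^ 2 * Real.sin_sq_add_cos_sq θ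

theorem fiberDeriv_exp (k : ℕ) (t θ : ℝ) :
    fiberDeriv k t (Circle.exp θ) = k * ((1 - t ^ 2) / (1 + t ^ 2 + 2 * t * Real.cos θ)) := by
  rw [fiberDeriv, norm_sq_one_add_exp_mul]

theorem hasDerivAt_fiberLift {t : ℝ} (h0 : 0 < t) (h1 : t < 1) (k : ℕ) (φ θ : ℝ) :
    HasDerivAt (fiberLift k t φ) (fiberDeriv k t (Circle.exp θ)) θ := by
  rw [fiberDeriv_exp]
  exact ((hasDerivAt_angleLift (abs_lt_one_of_pos h0 h1) θ).const_mul (k : ℝ)).const_add φ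

theorem fiberDeriv_pos {k : ℕ} (hk : 2 ≤ k) {t : ℝ} (h0 : 0 < t) (h1 : t < 1) (w : Circle) :
    0 < fiberDeriv k t w := by
  have h := norm_pos_iff.mpr (one_add_mul_ne_zero h0.le h1 w)
  have hk' : (0 : ℝ) < k := by exact_mod_cast (by omega : 0 < k)
  have : t ^ 2 < 1 := by nlinarith
  exact mul_pos hk' (div_pos (by linarith) (by positivity))

theorem continuous_fiberDeriv (k : ℕ) {t : ℝ} (h0 : 0 < t) (h1 : t < 1) :
    Continuous (fiberDeriv k t) := by
  unfold fiberDeriv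
  refine continuous_const.mul (continuous_const.div (by fun_prop) fun w => ?_)
  exact pow_ne_zero 2 (norm_ne_zero_iff.mpr (one_add_mul_ne_zero h0.le h1 w))

theorem strictMono_fiberLift {k : ℕ} (hk : 2 ≤ k) {t : ℝ} (h0 : 0 < t) (h1 : t < 1) (φ : ℝ) :
    StrictMono (fiberLift k t φ) := by
  have hk' : (0 : ℝ) < k := by exact_mod_cast (by omega : 0 < k)
  intro x y hxy
  have := strictMono_angleLift (abs_lt_one_of_pos h0 h1) hxy
  unfold fiberLift
  nlinarith

theorem isInducing_circle_coe : IsInducing fun w : Circle => (w : ℂ) := ⟨rfl⟩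

theorem continuous_blaschkeCircle (k : ℕ) {t : ℝ} (h0 : 0 < t) (h1 : t < 1) :
    Continuous fun x : Circle × Circle => blaschkeCircle k t x.1 x.2 := by
  rw [isInducing_circle_coe.continuous_iff]
  have h : ((fun w : Circle => (w : ℂ)) ∘ fun x : Circle × Circle => blaschkeCircle k t x.1 x.2) =
      fun x => (x.1 : ℂ) * (((x.2 : ℂ) + (t : ℂ)) / (1 + (x.2 : ℂ) * (t : ℂ))) ^ k := by
    ext x
    exact coe_blaschkeCircle h0.le h1 k x.1 x.2
  rw [h]
  have hc : Continuous fun w : Circle => (w : ℂ) := isInducing_circle_coe.continuous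
  have hc1 := hc.comp (continuous_fst (X := Circle) (Y := Circle))
  have hc2 := hc.comp (continuous_snd (X := Circle) (Y := Circle))
  exact hc1.mul (((hc2.add continuous_const).div (continuous_const.add (hc2.mul continuous_const))
    fun x => one_add_mul_ne_zero h0.le h1 x.2).pow k)

theorem continuous_skewProduct (k : ℕ) {t : ℝ} (h0 : 0 < t) (h1 : t < 1) :
    Continuous (skewProduct k t) := by
  unfold skewProduct
  exact continuous_fst.prodMk ((continuous_blaschkeCircle k h0 h1).comp
    ((Circle.exp.continuous.comp continuous_fst).prodMk continuous_snd))

theorem fiberLift_iterate_add_int (k : ℕ) (t φ θ : ℝ) (m : ℤ) (n : ℕ) :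
    (fiberLift k t φ)^[n] (θ + m * (2 * Real.pi)) =
      (fiberLift k t φ)^[n] θ + k ^ n * m * (2 * Real.pi) := by
  induction n with
  | zero => simp
  | succ n ih =>
    rw [Function.iterate_succ_apply', ih, Function.iterate_succ_apply']
    have := angleLift_add_int_mul_two_pi t ((fiberLift k t φ)^[n] θ) (k ^ n * m)
    push_cast at this
    rw [fiberLift, this, fiberLift]
    ring

theorem continuous_fiberLift_iterate (k : ℕ) {t : ℝ} (h0 : 0 < t) (h1 : t < 1) (n : ℕ) :
    Continuous fun x : ℝ × ℝ => (fiberLift k t x.1)^[n] x.2 := by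
  induction n with
  | zero => exact continuous_snd
  | succ n ih =>
    simp only [Function.iterate_succ_apply']
    exact continuous_fst.add (continuous_const.mul
      ((continuous_angleLift (abs_lt_one_of_pos h0 h1)).comp ih))

/-! ### The semiconjugacy of the fibre maps to multiplication by `k` -/

/-- The lift of the monotone semiconjugacy of `B_{φ,t}` to multiplication by `k`, that is, the limit
of `k ^ (-n) * (F_φ)^n θ`, where `F_φ` is the lift of `B_{φ,t}`. -/
def linearization (k : ℕ) (t φ θ : ℝ) : ℝ :=
  θ + φ / (k - 1) +
    ∑' n : ℕ, (angleLift t ((fiberLift k t φ)^[n] θ) - (fiberLift k t φ)^[n] θ) / (k : ℝ) ^ n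

theorem norm_defect_le {k : ℕ} (hk : 2 ≤ k) (t x : ℝ) (n : ℕ) :
    ‖(angleLift t x - x) / (k : ℝ) ^ n‖ ≤ Real.pi * (1 / 2) ^ n := by
  have hk' : (2 : ℝ) ≤ k := by exact_mod_cast hk
  rw [norm_div, Real.norm_eq_abs, norm_pow, Real.norm_of_nonneg (by positivity), one_div, inv_pow,
    ← div_eq_mul_inv]
  have h := (abs_angleLift_sub_lt t x).le
  have := Real.pi_pos
  gcongr

theorem summable_pi_half : Summable fun n : ℕ => Real.pi * (1 / 2 : ℝ) ^ n :=
  summable_geometric_two.mul_left _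

theorem summable_defect {k : ℕ} (hk : 2 ≤ k) (t : ℝ) (x : ℕ → ℝ) :
    Summable fun n : ℕ => (angleLift t (x n) - x n) / (k : ℝ) ^ n :=
  summable_pi_half.of_norm_bounded fun n => norm_defect_le hk t (x n) n

section

variable {k : ℕ} (hk : 2 ≤ k) {t : ℝ} (h0 : 0 < t) (h1 : t < 1)

include hk

/-- The series is dominated by π ∑ 2^(-n) = 2π. Staying at bounded distance from a translation makes
Φ_φ onto, identifies it with lim k^(-n) F_φ^n, and later yields injectivity. -/
theorem abs_linearization_sub_le (φ θ : ℝ) :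
    |linearization k t φ θ - θ - φ / (k - 1)| ≤ 2 * Real.pi := by
  have h := tsum_of_norm_bounded (f := fun n : ℕ =>
    (angleLift t ((fiberLift k t φ)^[n] θ) - (fiberLift k t φ)^[n] θ) / (k : ℝ) ^ n)
    (hasSum_geometric_two.mul_left Real.pi) fun n => norm_defect_le hk t _ n
  rw [linearization, ← Real.norm_eq_abs]
  convert h using 1
  · congr 1
    ring
  · ring

theorem linearization_fiberLift (φ θ : ℝ) :
    linearization k t φ (fiberLift k t φ θ) = k * linearization k t φ θ := by
  have hk' : (2 : ℝ) ≤ k := by exact_mod_cast hk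
  have hk0 : (k : ℝ) ≠ 0 := by positivity
  have hk1 : (k : ℝ) - 1 ≠ 0 := by linarith
  have hs := (summable_defect hk t fun n => (fiberLift k t φ)^[n] θ).tsum_eq_zero_add
  have h2 : ∑' n : ℕ, (angleLift t ((fiberLift k t φ)^[n + 1] θ) - (fiberLift k t φ)^[n + 1] θ) /
      (k : ℝ) ^ (n + 1) = (∑' n : ℕ, (angleLift t ((fiberLift k t φ)^[n] (fiberLift k t φ θ)) -
        (fiberLift k t φ)^[n] (fiberLift k t φ θ)) / (k : ℝ) ^ n) / k := by
    rw [← tsum_div_const]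
    refine tsum_congr fun n => ?_
    rw [Function.iterate_succ_apply, pow_succ]
    field_simp
  rw [h2] at hs
  simp only [Function.iterate_zero, id, pow_zero, div_one] at hs
  rw [linearization, linearization, hs, fiberLift]
  field_simp
  ring

theorem linearization_iterate (φ θ : ℝ) (n : ℕ) :
    linearization k t φ ((fiberLift k t φ)^[n] θ) = k ^ n * linearization k t φ θ := by
  induction n with
  | zero => simp
  | succ n ih =>
    rw [Function.iterate_succ_apply', linearization_fiberLift hk, ih]
    ring

/-- Φ(F^n θ) = k^n Φ(θ) is at bounded distance from F^n θ; divide by k^n. -/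
theorem tendsto_iterate_div_pow (φ θ : ℝ) :
    Tendsto (fun n : ℕ => (fiberLift k t φ)^[n] θ / (k : ℝ) ^ n) atTop
      (𝓝 (linearization k t φ θ)) := by
  have hk' : (1 : ℝ) < k := by exact_mod_cast (by omega : 1 < k)
  have h0' : ∀ n : ℕ, (k : ℝ) ^ n ≠ 0 := fun n => by positivity
  rw [tendsto_iff_norm_sub_tendsto_zero]
  refine squeeze_zero (fun _ => norm_nonneg _)
    (g := fun n : ℕ => (2 * Real.pi + |φ / (k - 1)|) / (k : ℝ) ^ n) (fun n => ?_)
    (tendsto_const_nhds.div_atTop (tendsto_pow_atTop_atTop_of_one_lt hk'))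
  have h := abs_linearization_sub_le hk (t := t) φ ((fiberLift k t φ)^[n] θ)
  rw [linearization_iterate hk] at h
  rw [div_sub' (h0' n), norm_div, norm_pow, Real.norm_of_nonneg (by positivity : (0 : ℝ) ≤ k),
    Real.norm_eq_abs]
  gcongr
  set y := (fiberLift k t φ)^[n] θ
  calc |y - k ^ n * linearization k t φ θ|
      = |(k ^ n * linearization k t φ θ - y - φ / (k - 1)) + φ / (k - 1)| := by
        rw [← abs_neg]
        congr 1
        ring
    _ ≤ _ := (abs_add_le _ _).trans (by gcongr)

omit hk in
theorem linearization_add_int (φ θ : ℝ) (m : ℤ) :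
    linearization k t φ (θ + m * (2 * Real.pi)) = linearization k t φ θ + m * (2 * Real.pi) := by
  have hs : ∀ n : ℕ, angleLift t ((fiberLift k t φ)^[n] (θ + m * (2 * Real.pi))) -
      (fiberLift k t φ)^[n] (θ + m * (2 * Real.pi)) =
      angleLift t ((fiberLift k t φ)^[n] θ) - (fiberLift k t φ)^[n] θ := fun n => by
    rw [fiberLift_iterate_add_int]
    have := angleLift_add_int_mul_two_pi t ((fiberLift k t φ)^[n] θ) (k ^ n * m)
    push_cast at this
    rw [this]
    ring
  simp only [linearization, hs]
  ring

omit hk in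
theorem fiberLift_iterate_add_add (φ θ : ℝ) (n : ℕ) : ∃ j : ℤ,
    (fiberLift k t (φ + 2 * Real.pi))^[n] (θ + 2 * Real.pi) =
      (fiberLift k t φ)^[n] θ + j * (2 * Real.pi) := by
  induction n with
  | zero => exact ⟨1, by simp⟩
  | succ n ih =>
    obtain ⟨j, hj⟩ := ih
    refine ⟨1 + k * j, ?_⟩
    rw [Function.iterate_succ_apply', hj, Function.iterate_succ_apply', fiberLift,
      angleLift_add_int_mul_two_pi, fiberLift]
    push_cast
    ring

/-- The displacements in the series are unchanged, so only θ + φ/(k-1) contributes, by 2π(1 +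
1/(k-1)). This is the total mass of the diagonal distribution over a period. -/
theorem linearization_add_add (φ θ : ℝ) :
    linearization k t (φ + 2 * Real.pi) (θ + 2 * Real.pi) =
      linearization k t φ θ + 2 * Real.pi * (k / (k - 1)) := by
  have hk' : (2 : ℝ) ≤ k := by exact_mod_cast hk
  have hk1 : (k : ℝ) - 1 ≠ 0 := by linarith
  have hs : ∀ n : ℕ,
      angleLift t ((fiberLift k t (φ + 2 * Real.pi))^[n] (θ + 2 * Real.pi)) -
      (fiberLift k t (φ + 2 * Real.pi))^[n] (θ + 2 * Real.pi) =
      angleLift t ((fiberLift k t φ)^[n] θ) - (fiberLift k t φ)^[n] θ := fun n => by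
    obtain ⟨j, hj⟩ := fiberLift_iterate_add_add (k := k) (t := t) φ θ n
    rw [hj, angleLift_add_int_mul_two_pi]
    ring
  simp only [linearization, hs]
  field_simp
  ring

omit hk in
theorem fiberLift_iterate_neg (φ θ : ℝ) (n : ℕ) :
    (fiberLift k t (-φ))^[n] (-θ) = -(fiberLift k t φ)^[n] θ := by
  induction n with
  | zero => rfl
  | succ n ih =>
    rw [Function.iterate_succ_apply', ih, Function.iterate_succ_apply', fiberLift, angleLift_neg,
      fiberLift]
    ring

omit hk in
theorem linearization_neg (φ θ : ℝ) : linearization k t (-φ) (-θ) = -linearization k t φ θ := by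
  simp only [linearization, fiberLift_iterate_neg, angleLift_neg]
  have : ∀ n : ℕ, (-angleLift t ((fiberLift k t φ)^[n] θ) - -(fiberLift k t φ)^[n] θ) / (k : ℝ) ^ n
      = -((angleLift t ((fiberLift k t φ)^[n] θ) - (fiberLift k t φ)^[n] θ) / (k : ℝ) ^ n) :=
    fun n => by ring
  simp only [this, tsum_neg]
  ring

include h0 h1

theorem continuous_linearization : Continuous fun x : ℝ × ℝ => linearization k t x.1 x.2 := by
  unfold linearization
  refine (continuous_snd.add (continuous_fst.div_const _)).add
    (continuous_tsum (fun n => ?_) summable_pi_half fun n x => norm_defect_le hk t _ n)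
  have h := continuous_fiberLift_iterate k h0 h1 n
  exact (((continuous_angleLift (abs_lt_one_of_pos h0 h1)).comp h).sub h).div_const _

theorem monotone_linearization (φ : ℝ) : Monotone (linearization k t φ) := fun x y hxy =>
  le_of_tendsto_of_tendsto' (tendsto_iterate_div_pow hk φ x) (tendsto_iterate_div_pow hk φ y)
    fun n => by
      have := (strictMono_fiberLift hk h0 h1 φ).monotone.iterate n hxy
      gcongr

theorem continuous_linearization_right (φ : ℝ) : Continuous (linearization k t φ) :=
  (continuous_linearization hk h0 h1).comp (continuous_const.prodMk continuous_id)

theorem surjective_linearization (φ : ℝ) : Function.Surjective (linearization k t φ) := by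
  refine (continuous_linearization_right hk h0 h1 φ).surjective ?_ ?_
  · refine tendsto_atTop_mono (f := fun θ => θ + (φ / (k - 1) - 2 * Real.pi)) (fun θ => ?_)
      (tendsto_atTop_add_const_right _ _ tendsto_id)
    have := (abs_le.mp (abs_linearization_sub_le hk (t := t) φ θ)).1
    linarith
  · refine tendsto_atBot_mono (g := linearization k t φ) (f := fun θ => θ + (φ / (k - 1) + 2 * Real.pi)) (fun θ => ?_)
      (tendsto_atBot_add_const_right _ _ tendsto_id)
    have := (abs_le.mp (abs_linearization_sub_le hk (t := t) φ θ)).2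
    linarith

theorem fiberLift_iterate_mono {φ φ' θ θ' : ℝ} (hφ : φ ≤ φ') (hθ : θ ≤ θ') (n : ℕ) :
    (fiberLift k t φ)^[n] θ ≤ (fiberLift k t φ')^[n] θ' := by
  induction n with
  | zero => exact hθ
  | succ n ih =>
    rw [Function.iterate_succ_apply', Function.iterate_succ_apply']
    have := (strictMono_fiberLift hk h0 h1 φ).monotone ih
    refine this.trans ?_
    unfold fiberLift
    linarith

/-- `φ ↦ Φ_φ(φ)` is the (unnormalized) distribution function of the limiting measure of zeros. -/
theorem monotone_linearization_diag : Monotone fun φ => linearization k t φ φ := fun φ φ' h =>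
  le_of_tendsto_of_tendsto' (tendsto_iterate_div_pow hk φ φ) (tendsto_iterate_div_pow hk φ' φ')
    fun n => by
      have := fiberLift_iterate_mono hk h0 h1 h h n
      gcongr

theorem continuous_linearization_diag : Continuous fun φ => linearization k t φ φ :=
  (continuous_linearization hk h0 h1).comp (continuous_id.prodMk continuous_id)

end


/-! ### Attracting fixed points on the circle -/

/-- The derivative of k A increases on [0, π], so being at most 1 at θ it is below 1 on [0, θ);
hence s - kA(s) increases there and is positive at θ. For φ up to this value F_φ maps [0, θ] into
itself, the orbit of φ is bounded, and division by k^n gives 0. Non-repelling fixed points thus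
create gaps in the zeros. -/
theorem linearization_diag_eq_zero {k : ℕ} (hk : 2 ≤ k) {t : ℝ} (h0 : 0 < t) (h1 : t < 1) {θ : ℝ}
    (hθ0 : 0 < θ) (hθ : θ ≤ Real.pi) (hd : fiberDeriv k t (Circle.exp θ) ≤ 1) :
    0 < θ - k * angleLift t θ ∧ θ - k * angleLift t θ ≤ Real.pi ∧
      ∀ φ ∈ Icc 0 (θ - k * angleLift t θ), linearization k t φ φ = 0 := by
  have ht := abs_lt_one_of_pos h0 h1
  have hk' : (0 : ℝ) < k := by exact_mod_cast (by omega : 0 < k)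
  have ha0 : angleLift t 0 = 0 := by simp [angleLift]
  have ha : 0 < angleLift t θ := by
    rw [← ha0]
    exact strictMono_angleLift ht hθ0
  have hka : 0 < k * angleLift t θ := mul_pos hk' ha
  have hy : 0 < θ - k * angleLift t θ := by
    have hm : StrictMonoOn (fun s => s - k * angleLift t s) (Icc 0 θ) := by
      have hder : ∀ s, HasDerivAt (fun s => s - k * angleLift t s)
          (1 - k * ((1 - t ^ 2) / (1 + t ^ 2 + 2 * t * Real.cos s))) s := fun s =>
        (hasDerivAt_id s).sub ((hasDerivAt_angleLift ht s).const_mul (k : ℝ))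
      refine strictMonoOn_of_deriv_pos (convex_Icc 0 θ)
        (fun s _ => (hder s).continuousAt.continuousWithinAt) fun s hs => ?_
      rw [interior_Icc] at hs
      rw [(hder s).deriv]
      rw [fiberDeriv_exp] at hd
      have hcos : Real.cos θ < Real.cos s :=
        Real.cos_lt_cos_of_nonneg_of_le_pi hs.1.le hθ hs.2
      have hlt : (1 - t ^ 2) / (1 + t ^ 2 + 2 * t * Real.cos s) <
          (1 - t ^ 2) / (1 + t ^ 2 + 2 * t * Real.cos θ) :=
        div_lt_div_of_pos_left (by nlinarith) (poisson_denom_pos ht θ) (by nlinarith)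
      nlinarith
    have := hm (left_mem_Icc.mpr hθ0.le) (right_mem_Icc.mpr hθ0.le) hθ0
    simpa [ha0] using this
  refine ⟨hy, by linarith, fun φ hφ => ?_⟩
  have hb : ∀ n : ℕ, 0 ≤ (fiberLift k t φ)^[n] φ ∧ (fiberLift k t φ)^[n] φ ≤ θ := by
    intro n
    induction n with
    | zero => exact ⟨hφ.1, by linarith [hφ.2, Function.iterate_zero_apply (fiberLift k t φ) φ]⟩
    | succ n ih =>
      rw [Function.iterate_succ_apply', fiberLift]
      have i1 := (strictMono_angleLift ht).monotone ih.1
      have i2 := (strictMono_angleLift ht).monotone ih.2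
      rw [ha0] at i1
      have h3 : k * angleLift t ((fiberLift k t φ)^[n] φ) ≤ k * angleLift t θ := by gcongr
      exact ⟨add_nonneg hφ.1 (mul_nonneg hk'.le i1), by linarith [hφ.2]⟩
  refine tendsto_nhds_unique (tendsto_iterate_div_pow hk φ φ) ?_
  have hk1 : (1 : ℝ) < k := by exact_mod_cast (by omega : 1 < k)
  refine squeeze_zero (fun n => div_nonneg (hb n).1 (by positivity))
    (g := fun n : ℕ => θ / (k : ℝ) ^ n) (fun n => ?_)
    (tendsto_const_nhds.div_atTop (tendsto_pow_atTop_atTop_of_one_lt hk1))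
  have := (hb n).2
  gcongr

/-! ### Fixed points in the open disc -/

theorem one_add_mul_ne_zero_of_norm_le {t : ℝ} (h0 : 0 < t) (h1 : t < 1) {p : ℂ} (hp : ‖p‖ ≤ 1) :
    (1 : ℂ) + p * t ≠ 0 := by
  intro h
  have h3 : ‖p * (t : ℂ)‖ = ‖p‖ * t := by
    rw [norm_mul, Complex.norm_real, Real.norm_of_nonneg h0.le]
  rw [show p * (t : ℂ) = -1 by linear_combination h] at h3
  simp at h3
  nlinarith

theorem norm_sq_moebius {t : ℝ} (p : ℂ) :
    ‖(1 : ℂ) + p * t‖ ^ 2 - ‖p + t‖ ^ 2 = (1 - t ^ 2) * (1 - ‖p‖ ^ 2) := by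
  simp only [Complex.sq_norm, Complex.normSq_apply]
  simp
  ring

/-- After division by t^k the fixed point equation of rB is a monic polynomial of degree k + 1 with
constant term -rz. The product of its roots has modulus r < 1, so some root lies in the open disc.
-/
theorem exists_root_norm_lt_one (k : ℕ) {t : ℝ} (h0 : 0 < t) (z : Circle) {r : ℝ} (hr0 : 0 ≤ r)
    (hr1 : r < 1) :
    ∃ p : ℂ, ‖p‖ < 1 ∧ p * (1 + p * t) ^ k = r * z * (p + t) ^ k := by
  have htC : (t : ℂ) ≠ 0 := by exact_mod_cast h0.ne'
  set q₁ : ℂ[X] := Polynomial.X * (Polynomial.X + Polynomial.C (t : ℂ)⁻¹) ^ k with hq₁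
  set q₂ : ℂ[X] := Polynomial.C ((r : ℂ) * z * ((t : ℂ)⁻¹) ^ k) *
    (Polynomial.X + Polynomial.C (t : ℂ)) ^ k with hq₂
  have hm₁ : q₁.Monic := Polynomial.monic_X.mul ((Polynomial.monic_X_add_C _).pow k)
  have hd₁ : q₁.degree = ((k + 1 : ℕ) : WithBot ℕ) := by
    rw [hq₁, Polynomial.degree_mul, Polynomial.degree_pow, Polynomial.degree_X_add_C,
      Polynomial.degree_X]
    push_cast
    simp [add_comm]
  have hd₂ : q₂.degree < q₁.degree := by
    rw [hd₁]
    have h2 := Polynomial.degree_mul_le (Polynomial.C ((r : ℂ) * z * ((t : ℂ)⁻¹) ^ k))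
      ((Polynomial.X + Polynomial.C (t : ℂ)) ^ k)
    rw [Polynomial.degree_pow, Polynomial.degree_X_add_C, nsmul_eq_mul, mul_one] at h2
    have h3 : (Polynomial.C ((r : ℂ) * z * ((t : ℂ)⁻¹) ^ k)).degree + (k : WithBot ℕ) ≤
        0 + (k : WithBot ℕ) := by
      gcongr
      exact Polynomial.degree_C_le
    rw [zero_add] at h3
    refine (h2.trans h3).trans_lt ?_
    exact_mod_cast Nat.lt_succ_self k
  have hm : (q₁ - q₂).Monic := hm₁.sub_of_left hd₂
  have hprod := (IsAlgClosed.splits (q₁ - q₂)).eval_eq_prod_roots_of_monic hm 0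
  have h0' : (q₁ - q₂).eval 0 = -(r * z) := by
    simp only [hq₁, hq₂, Polynomial.eval_sub, Polynomial.eval_mul, Polynomial.eval_pow,
      Polynomial.eval_X, Polynomial.eval_add, Polynomial.eval_C, zero_mul, zero_add, zero_sub]
    rw [mul_assoc, ← mul_pow, inv_mul_cancel₀ htC, one_pow, mul_one]
  have hex : ∃ p ∈ (q₁ - q₂).roots, ‖p‖ < 1 := by
    by_contra! hcon
    have h1 : 1 ≤ ‖((q₁ - q₂).roots.map fun a => 0 - a).prod‖ := by
      rw [← coe_nnnorm]
      rw [show ‖((q₁ - q₂).roots.map fun a => 0 - a).prod‖₊ =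
        (((q₁ - q₂).roots.map fun a => 0 - a).map nnnormHom).prod from
          map_multiset_prod nnnormHom _, Multiset.map_map]
      have : 1 ≤ ((q₁ - q₂).roots.map (nnnormHom ∘ fun a => 0 - a)).prod := by
        refine Multiset.one_le_prod_of_one_le fun x hx => ?_
        obtain ⟨a, ha, rfl⟩ := Multiset.mem_map.mp hx
        have := hcon a ha
        simpa [← NNReal.coe_le_coe] using this
      exact_mod_cast this
    rw [← hprod, h0', norm_neg, norm_mul, Circle.norm_coe, Complex.norm_real,
      Real.norm_of_nonneg hr0] at h1
    linarith
  obtain ⟨p, hp, hp1⟩ := hex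
  refine ⟨p, hp1, ?_⟩
  have he := (Polynomial.mem_roots'.mp hp).2
  simp only [hq₁, hq₂, Polynomial.IsRoot, Polynomial.eval_sub, Polynomial.eval_mul,
    Polynomial.eval_pow, Polynomial.eval_X, Polynomial.eval_add, Polynomial.eval_C] at he
  have h5 : (1 : ℂ) + p * t = (p + (t : ℂ)⁻¹) * t := by
    field_simp
    ring
  have h6 : ((t : ℂ)⁻¹) ^ k * (t : ℂ) ^ k = 1 := by
    rw [← mul_pow, inv_mul_cancel₀ htC, one_pow]
  rw [h5, mul_pow]
  linear_combination (t : ℂ) ^ k * he + r * z * (p + t) ^ k * h6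

theorem one_sub_pow_mul_le_one {x : ℝ} (hx0 : 0 ≤ x) (hx1 : x ≤ 1) (k : ℕ) :
    (1 - x) ^ k * (1 + k * x) ≤ 1 := by
  have h1 : 1 + k * x ≤ (1 + x) ^ k := one_add_mul_le_pow (by linarith) k
  calc (1 - x) ^ k * (1 + k * x) ≤ (1 - x) ^ k * (1 + x) ^ k := by
        have : 0 ≤ 1 - x := by linarith
        gcongr
    _ = (1 - x ^ 2) ^ k := by rw [← mul_pow]; ring
    _ ≤ 1 := pow_le_one₀ (by nlinarith) (by nlinarith)

/-- Unless the circle map has a fixed point which is not repelling, the Blaschke product has a fixed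
point in the open unit disc. -/
theorem exists_fixed_point_norm_lt_one {k : ℕ} {t : ℝ} (h0 : 0 < t)
    (h1 : t < 1) (z : Circle)
    (hz : ∀ w : Circle, blaschkeCircle k t z w = w → 1 < fiberDeriv k t w) :
    ∃ p : ℂ, ‖p‖ < 1 ∧ blaschke k t z p = p := by
  have hr : ∀ n : ℕ, (0 : ℝ) ≤ 1 - 1 / (n + 1) ∧ (1 : ℝ) - 1 / (n + 1) < 1 := fun n => by
    have : (0 : ℝ) < n + 1 := by positivity
    have h2 : (0 : ℝ) < 1 / (n + 1) := by positivity
    have h3 : (1 : ℝ) / (n + 1) ≤ 1 := by rw [div_le_one this]; linarith [n.cast_nonneg (α := ℝ)]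
    constructor <;> linarith
  choose p hp1 hp using fun n : ℕ => exists_root_norm_lt_one k h0 z (hr n).1 (hr n).2
  -- The fixed points for r = 1 - 1/(n+1) accumulate in the closed disc at a fixed point of B
  -- itself. It remains to exclude the boundary.
  obtain ⟨q, hq, σ, hσ, hlim⟩ := (isCompact_closedBall (0 : ℂ) 1).tendsto_subseq
    (x := p) fun n => by simpa using (hp1 n).le
  have hq1 : ‖q‖ ≤ 1 := by simpa using hq
  have hqne := one_add_mul_ne_zero_of_norm_le h0 h1 hq1
  have hfix : q * (1 + q * t) ^ k = z * (q + t) ^ k := by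
    have hl : Tendsto (fun n => p (σ n) * (1 + p (σ n) * t) ^ k) atTop
        (𝓝 (q * (1 + q * t) ^ k)) :=
      hlim.mul (((hlim.mul_const _).const_add 1).pow k)
    have hr1 : Tendsto (fun n => ((1 - 1 / ((σ n : ℝ) + 1) : ℝ) : ℂ)) atTop (𝓝 1) := by
      have h := (tendsto_one_div_add_atTop_nhds_zero_nat (𝕜 := ℝ)).comp hσ.tendsto_atTop
      have h2 := (Complex.continuous_ofReal.tendsto _).comp (h.const_sub 1)
      simpa [Function.comp_def] using h2
    have hr2 : Tendsto (fun n => ((1 - 1 / ((σ n : ℝ) + 1) : ℝ) : ℂ) * z * (p (σ n) + t) ^ k) atTop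
        (𝓝 (1 * z * (q + t) ^ k)) :=
      (hr1.mul_const _).mul ((hlim.add_const _).pow k)
    rw [one_mul] at hr2
    refine tendsto_nhds_unique hl (hr2.congr fun n => (hp (σ n)).symm)
  have hB : blaschke k t z q = q := by
    rw [blaschke, div_pow, ← mul_div_assoc, ← hfix, mul_div_assoc, div_self (pow_ne_zero k hqne),
      mul_one]
  refine ⟨q, lt_of_le_of_ne hq1 fun hqe => ?_, hB⟩
  set w := circleMk q hqe with hw
  have hwq : (w : ℂ) = q := coe_circleMk q hqe
  have hlt := hz w (Circle.ext (by rw [coe_blaschkeCircle h0.le h1, hwq, hB]))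
  have ht2 : t ^ 2 < 1 := by nlinarith
  -- A Schwarz–Pick estimate. With u = 1 - |y|², the image y' = (y + t)/(1 + yt) satisfies |y'|² = 1
  -- - cu, and |y| ≤ |y'|^k gives |y|² ≤ (1 - cu)^k ≤ 1/(1 + kcu), hence kc|y|² ≤ 1. In the limit
  -- the multiplier at a boundary point would be at most 1.
  have hle : ∀ n, k * ((1 - t ^ 2) / ‖(1 : ℂ) + p (σ n) * t‖ ^ 2) * ‖p (σ n)‖ ^ 2 ≤ 1 := by
    intro n
    have hpn := hp (σ n)
    have hpn1 := hp1 (σ n)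
    set y := p (σ n)
    have hne := one_add_mul_ne_zero_of_norm_le h0 h1 hpn1.le
    have hN : 0 < ‖(1 : ℂ) + y * t‖ ^ 2 := by positivity
    set c := (1 - t ^ 2) / ‖(1 : ℂ) + y * t‖ ^ 2 with hc
    set u := 1 - ‖y‖ ^ 2 with hu
    have hu0 : 0 < u := by nlinarith [norm_nonneg y]
    have hc0 : 0 ≤ c := div_nonneg (by linarith) hN.le
    have hA : 1 - c * u = ‖y + t‖ ^ 2 / ‖(1 : ℂ) + y * t‖ ^ 2 := by
      rw [eq_div_iff hN.ne', sub_mul, one_mul, hc, mul_right_comm, div_mul_cancel₀ _ hN.ne', hu,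
        ← norm_sq_moebius]
      ring
    have hx1 : c * u ≤ 1 := by
      have : 0 ≤ 1 - c * u := by rw [hA]; positivity
      linarith
    have hle : ‖y‖ ^ 2 ≤ (1 - c * u) ^ k := by
      rw [hA, div_pow, le_div_iff₀ (by positivity)]
      have h := congrArg norm hpn
      rw [norm_mul, norm_mul, norm_mul, norm_pow, norm_pow, Circle.norm_coe, Complex.norm_real,
        Real.norm_of_nonneg (hr (σ n)).1, mul_one] at h
      have h3 : ‖y‖ * ‖1 + y * (t : ℂ)‖ ^ k ≤ ‖y + t‖ ^ k := by
        rw [h]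
        exact mul_le_of_le_one_left (by positivity) (hr (σ n)).2.le
      calc ‖y‖ ^ 2 * (‖1 + y * (t : ℂ)‖ ^ 2) ^ k = (‖y‖ * ‖1 + y * (t : ℂ)‖ ^ k) ^ 2 := by ring
        _ ≤ (‖y + t‖ ^ k) ^ 2 := by gcongr
        _ = _ := by ring
    have h4 := one_sub_pow_mul_le_one (mul_nonneg hc0 hu0.le) hx1 k
    have h5 : ‖y‖ ^ 2 * (1 + k * (c * u)) ≤ 1 := le_trans (by gcongr) h4
    have h6 : u * (k * c * ‖y‖ ^ 2) ≤ u * 1 := by nlinarith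
    exact le_of_mul_le_mul_left h6 hu0
  have hN : ‖(1 : ℂ) + q * t‖ ^ 2 ≠ 0 := pow_ne_zero 2 (norm_ne_zero_iff.mpr hqne)
  have hlim2 : Tendsto (fun n => k * ((1 - t ^ 2) / ‖(1 : ℂ) + p (σ n) * t‖ ^ 2) *
      ‖p (σ n)‖ ^ 2) atTop (𝓝 (k * ((1 - t ^ 2) / ‖(1 : ℂ) + q * t‖ ^ 2) * ‖q‖ ^ 2)) :=
    ((tendsto_const_nhds.div (((hlim.mul_const _).const_add 1).norm.pow 2) hN).const_mul _).mul
      (hlim.norm.pow 2)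
  have h7 := le_of_tendsto' hlim2 hle
  rw [hqe, one_pow, mul_one] at h7
  rw [fiberDeriv, hwq] at hlt
  linarith

/-! ### Expansion -/

/-- Cauchy–Schwarz against the constant sequence, in the form that a variance is nonnegative.
Equality would make the terms j = 0 and j = 1 equal, forcing s = 1. -/
theorem sq_geom_sum_lt {s : ℝ} (hs : s < 1) {k : ℕ} (hk : 2 ≤ k) :
    (∑ j ∈ Finset.range k, s ^ j) ^ 2 < k * ∑ j ∈ Finset.range k, (s ^ 2) ^ j := by
  have hk0 : (0 : ℝ) < k := by exact_mod_cast (by omega : 0 < k)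
  set S := ∑ j ∈ Finset.range k, s ^ j with hS
  by_contra! hcon
  have hsum : ∑ j ∈ Finset.range k, (k * s ^ j - S) ^ 2 =
      k * (k * ∑ j ∈ Finset.range k, (s ^ 2) ^ j - S ^ 2) := by
    have : ∀ j, (k * s ^ j - S) ^ 2 = k ^ 2 * (s ^ 2) ^ j - 2 * k * S * s ^ j + S ^ 2 := fun j => by
      ring
    simp only [this, Finset.sum_add_distrib, Finset.sum_sub_distrib, ← Finset.mul_sum, ← hS,
      Finset.sum_const, Finset.card_range, nsmul_eq_mul]
    ring
  have hz : ∑ j ∈ Finset.range k, (k * s ^ j - S) ^ 2 = 0 :=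
    le_antisymm (by rw [hsum]; nlinarith) (Finset.sum_nonneg fun _ _ => sq_nonneg _)
  rw [Finset.sum_eq_zero_iff_of_nonneg fun _ _ => sq_nonneg _] at hz
  have e0 := hz 0 (Finset.mem_range.mpr (by omega))
  have e1 := hz 1 (Finset.mem_range.mpr (by omega))
  simp only [pow_zero, pow_one, mul_one, ne_eq, OfNat.ofNat_ne_zero, not_false_eq_true,
    pow_eq_zero_iff] at e0 e1
  nlinarith

/-- Strict expansion of the harmonic measure of a fixed point in the open disc. -/
theorem norm_blaschke_sub_sq_lt {k : ℕ} (hk : 2 ≤ k) {t : ℝ} (h0 : 0 < t) (h1 : t < 1) (z w : Circle)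
    {p : ℂ} (hp : ‖p‖ < 1) (hfix : blaschke k t z p = p) :
    ‖(blaschkeCircle k t z w : ℂ) - p‖ ^ 2 < fiberDeriv k t w * ‖(w : ℂ) - p‖ ^ 2 := by
  have hw := one_add_mul_ne_zero h0.le h1 w
  have hpne := one_add_mul_ne_zero_of_norm_le h0 h1 hp.le
  have ht2 : 0 < 1 - t ^ 2 := by nlinarith
  set u : ℂ := ((w : ℂ) + t) / (1 + (w : ℂ) * t) with hu
  set q : ℂ := (p + t) / (1 + p * t) with hq
  have hNw : 0 < ‖(1 : ℂ) + (w : ℂ) * t‖ := norm_pos_iff.mpr hw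
  have hNp : 0 < ‖(1 : ℂ) + p * t‖ := norm_pos_iff.mpr hpne
  have hu1 : ‖u‖ = 1 := by
    have h := norm_sq_moebius (t := t) (w : ℂ)
    rw [Circle.norm_coe, one_pow, sub_self, mul_zero] at h
    have h2 : ‖(w : ℂ) + t‖ = ‖(1 : ℂ) + (w : ℂ) * t‖ :=
      (pow_left_inj₀ (norm_nonneg _) (norm_nonneg _) two_ne_zero).mp (by linarith)
    rw [hu, norm_div, h2, div_self hNw.ne']
  have hq1 : 1 - ‖q‖ ^ 2 = (1 - t ^ 2) * (1 - ‖p‖ ^ 2) / ‖(1 : ℂ) + p * t‖ ^ 2 := by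
    rw [← norm_sq_moebius, hq, norm_div, div_pow, sub_div, div_self (by positivity)]
  have hqpos : 0 < 1 - ‖q‖ ^ 2 := by
    rw [hq1]
    have : 0 < 1 - ‖p‖ ^ 2 := by nlinarith [norm_nonneg p]
    positivity
  have hqlt : ‖q‖ < 1 := by nlinarith [norm_nonneg q]
  have hzq : (z : ℂ) * q ^ k = p := hfix
  have hqk : ‖q‖ ^ k = ‖p‖ := by
    rw [← norm_pow, ← one_mul ‖q ^ k‖, ← Circle.norm_coe z, ← norm_mul, hzq]
  have hwp : (w : ℂ) - p ≠ 0 := by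
    intro h
    rw [← sub_eq_zero.mp h, Circle.norm_coe] at hp
    exact lt_irrefl _ hp
  have huq : ‖u - q‖ ^ 2 * (‖(1 : ℂ) + (w : ℂ) * t‖ ^ 2 * ‖(1 : ℂ) + p * t‖ ^ 2) =
      (1 - t ^ 2) ^ 2 * ‖(w : ℂ) - p‖ ^ 2 := by
    have h : (u - q) * ((1 + (w : ℂ) * t) * (1 + p * t)) =
        ((1 - t ^ 2 : ℝ) : ℂ) * ((w : ℂ) - p) := by
      rw [hu, hq, sub_mul, ← mul_assoc, div_mul_cancel₀ _ hw, mul_left_comm, div_mul_cancel₀ _ hpne]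
      push_cast
      ring
    have h2 := congrArg (fun x => ‖x‖ ^ 2) h
    simp only [norm_mul, mul_pow] at h2
    rw [Complex.norm_real, Real.norm_of_nonneg ht2.le] at h2
    exact h2
  have huqpos : 0 < ‖u - q‖ ^ 2 := by
    have : 0 < (1 - t ^ 2) ^ 2 * ‖(w : ℂ) - p‖ ^ 2 := by
      have := norm_pos_iff.mpr hwp
      positivity
    rw [← huq] at this
    exact pos_of_mul_pos_left this (by positivity)
  have hB : (blaschkeCircle k t z w : ℂ) - p = z * (u ^ k - q ^ k) := by
    rw [coe_blaschkeCircle h0.le h1, blaschke, mul_sub, hzq]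
  have hgeom : ‖∑ i ∈ Finset.range k, u ^ i * q ^ (k - 1 - i)‖ ≤
      ∑ j ∈ Finset.range k, ‖q‖ ^ j := by
    refine (norm_sum_le _ _).trans ?_
    rw [← Finset.sum_range_reflect (fun j => ‖q‖ ^ j)]
    refine Finset.sum_le_sum fun i _ => ?_
    rw [norm_mul, norm_pow, norm_pow, hu1, one_pow, one_mul]
  -- Factor u^k - q^k by u - q; since |u| = 1 the cofactor is at most ∑ |q|^j. Strict Cauchy–Schwarz
  -- bounds its square by k ∑ |q|^(2j), and (1 - |q|²) ∑ |q|^(2j) = 1 - |q|^(2k) = 1 - |p|² because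
  -- p is fixed.
  have hkey : ‖u ^ k - q ^ k‖ ^ 2 * (1 - ‖q‖ ^ 2) < ‖u - q‖ ^ 2 * (k * (1 - ‖p‖ ^ 2)) := by
    have hs := sq_geom_sum_lt hqlt hk
    have hg2 := geom_sum_mul_neg (‖q‖ ^ 2) k
    rw [← geom_sum₂_mul, norm_mul, mul_pow, mul_comm (_ ^ 2) (‖u - q‖ ^ 2), mul_assoc]
    refine mul_lt_mul_of_pos_left ?_ huqpos
    calc _ ≤ (∑ j ∈ Finset.range k, ‖q‖ ^ j) ^ 2 * (1 - ‖q‖ ^ 2) := by gcongr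
      _ < (k * ∑ j ∈ Finset.range k, (‖q‖ ^ 2) ^ j) * (1 - ‖q‖ ^ 2) := by gcongr
      _ = k * (1 - ‖p‖ ^ 2) := by
        rw [mul_assoc, hg2, ← pow_mul, mul_comm 2 k, pow_mul, hqk]
  rw [hB, norm_mul, Circle.norm_coe, one_mul]
  have hfin : fiberDeriv k t w * ‖(w : ℂ) - p‖ ^ 2 * (1 - ‖q‖ ^ 2) =
      ‖u - q‖ ^ 2 * (k * (1 - ‖p‖ ^ 2)) := by
    have e : ‖u - q‖ ^ 2 = (1 - t ^ 2) ^ 2 * ‖(w : ℂ) - p‖ ^ 2 /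
        (‖(1 : ℂ) + (w : ℂ) * t‖ ^ 2 * ‖(1 : ℂ) + p * t‖ ^ 2) := by
      rw [eq_div_iff (by positivity), huq]
    rw [e, hq1, fiberDeriv]
    field_simp
  rw [← hfin] at hkey
  exact lt_of_mul_lt_mul_right hkey hqpos.le

/-- The derivative of the `n`-th iterate of the skew product along the fibres. -/
def cocycle (k : ℕ) (t : ℝ) (n : ℕ) (x : ℝ × Circle) : ℝ :=
  ∏ i ∈ Finset.range n, fiberDeriv k t ((skewProduct k t)^[i] x).2

theorem cocycle_add (k : ℕ) (t : ℝ) (m n : ℕ) (x : ℝ × Circle) :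
    cocycle k t (m + n) x = cocycle k t m x * cocycle k t n ((skewProduct k t)^[m] x) := by
  rw [cocycle, Finset.prod_range_add]
  congr 1
  refine Finset.prod_congr rfl fun i _ => ?_
  rw [← Function.iterate_add_apply, add_comm]

theorem cocycle_succ (k : ℕ) (t : ℝ) (n : ℕ) (x : ℝ × Circle) :
    cocycle k t (n + 1) x = fiberDeriv k t x.2 * cocycle k t n (skewProduct k t x) := by
  rw [add_comm, cocycle_add]
  simp [cocycle]

theorem fst_skewProduct_iterate (k : ℕ) (t : ℝ) (n : ℕ) (x : ℝ × Circle) :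
    ((skewProduct k t)^[n] x).1 = x.1 := by
  induction n with
  | zero => rfl
  | succ n ih => rw [Function.iterate_succ_apply', skewProduct, ih]

section

variable {k : ℕ} (hk : 2 ≤ k) {t : ℝ} (h0 : 0 < t) (h1 : t < 1)

include hk h0 h1

theorem cocycle_pos (n : ℕ) (x : ℝ × Circle) : 0 < cocycle k t n x :=
  Finset.prod_pos fun _ _ => fiberDeriv_pos hk h0 h1 _

omit hk in
theorem continuous_cocycle (n : ℕ) : Continuous (cocycle k t n) :=
  continuous_finsetProd _ fun i _ => (continuous_fiberDeriv k h0 h1).comp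
    (continuous_snd.comp ((continuous_skewProduct k h0 h1).iterate i))

/-- The derivative measured with the density |w - p|^(-2) has a minimum l > 1 on the compact circle
and multiplies along orbits. This density is comparable with the Euclidean one, so high iterates
expand in the usual sense. -/
theorem exists_two_lt_cocycle_of_fixed_point {φ : ℝ} {p : ℂ} (hp : ‖p‖ < 1)
    (hfix : blaschke k t (Circle.exp φ) p = p) :
    ∃ N, 1 ≤ N ∧ ∀ w, 2 < cocycle k t N (φ, w) := by
  have hne : ∀ w : Circle, 0 < ‖(w : ℂ) - p‖ := fun w => by
    refine norm_pos_iff.mpr fun h => ?_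
    rw [← sub_eq_zero.mp h, Circle.norm_coe] at hp
    exact lt_irrefl _ hp
  have hcoe : Continuous fun w : Circle => (w : ℂ) := isInducing_circle_coe.continuous
  set B := blaschkeCircle k t (Circle.exp φ) with hBdef
  have hBc : Continuous B :=
    (continuous_blaschkeCircle k h0 h1).comp (continuous_const.prodMk continuous_id)
  obtain ⟨w₀, hw₀⟩ : ∃ w₀ : Circle, ∀ w, fiberDeriv k t w₀ * ‖(w₀ : ℂ) - p‖ ^ 2 /
      ‖(B w₀ : ℂ) - p‖ ^ 2 ≤ fiberDeriv k t w * ‖(w : ℂ) - p‖ ^ 2 / ‖(B w : ℂ) - p‖ ^ 2 := by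
    have hc : Continuous fun w : Circle =>
        fiberDeriv k t w * ‖(w : ℂ) - p‖ ^ 2 / ‖(B w : ℂ) - p‖ ^ 2 :=
      ((continuous_fiberDeriv k h0 h1).mul ((hcoe.sub continuous_const).norm.pow 2)).div
        (((hcoe.comp hBc).sub continuous_const).norm.pow 2) fun w => (pow_pos (hne (B w)) 2).ne'
    obtain ⟨w₀, -, hw₀⟩ := isCompact_univ.exists_isMinOn univ_nonempty hc.continuousOn
    exact ⟨w₀, fun w => hw₀ (mem_univ w)⟩
  set l := fiberDeriv k t w₀ * ‖(w₀ : ℂ) - p‖ ^ 2 / ‖(B w₀ : ℂ) - p‖ ^ 2 with hl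
  have hl1 : 1 < l := by
    rw [hl, one_lt_div (pow_pos (hne _) 2)]
    exact norm_blaschke_sub_sq_lt hk h0 h1 _ w₀ hp hfix
  have hstep : ∀ w, l * ‖(B w : ℂ) - p‖ ^ 2 ≤ fiberDeriv k t w * ‖(w : ℂ) - p‖ ^ 2 := fun w => by
    have := hw₀ w
    rwa [le_div_iff₀ (pow_pos (hne _) 2)] at this
  have hiter : ∀ n w, l ^ n * ‖(((skewProduct k t)^[n] (φ, w)).2 : ℂ) - p‖ ^ 2 ≤
      cocycle k t n (φ, w) * ‖(w : ℂ) - p‖ ^ 2 := by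
    intro n
    induction n with
    | zero => intro w; simp [cocycle]
    | succ n ih =>
      intro w
      have e : skewProduct k t (φ, w) = (φ, B w) := rfl
      rw [Function.iterate_succ_apply, cocycle_succ, e]
      have h2 := ih (B w)
      have h3 := hstep w
      have h4 := cocycle_pos hk h0 h1 n (φ, B w)
      calc _ = l * (l ^ n * ‖(((skewProduct k t)^[n] (φ, B w)).2 : ℂ) - p‖ ^ 2) := by ring
        _ ≤ l * (cocycle k t n (φ, B w) * ‖(B w : ℂ) - p‖ ^ 2) := by gcongr
        _ = cocycle k t n (φ, B w) * (l * ‖(B w : ℂ) - p‖ ^ 2) := by ring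
        _ ≤ cocycle k t n (φ, B w) * (fiberDeriv k t w * ‖(w : ℂ) - p‖ ^ 2) := by gcongr
        _ = _ := by ring
  have hδ : 0 < (1 - ‖p‖) ^ 2 := pow_pos (by linarith) 2
  -- The 8 is the desired expansion 2 times the bound 4 for |w - p|²; (1 - |p|)² bounds the same
  -- quantity below at the image point.
  obtain ⟨n, hn⟩ := pow_unbounded_of_one_lt (8 / (1 - ‖p‖) ^ 2) hl1
  refine ⟨n + 1, by omega, fun w => ?_⟩
  have h2 := hiter (n + 1) w
  have h3 : (1 - ‖p‖) ^ 2 ≤ ‖(((skewProduct k t)^[n + 1] (φ, w)).2 : ℂ) - p‖ ^ 2 := by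
    have := norm_sub_norm_le (((skewProduct k t)^[n + 1] (φ, w)).2 : ℂ) p
    rw [Circle.norm_coe] at this
    have h5 : 0 ≤ 1 - ‖p‖ := by linarith
    gcongr
  have h4 : ‖(w : ℂ) - p‖ < 2 := by
    have := norm_sub_le (w : ℂ) p
    rw [Circle.norm_coe] at this
    linarith
  have h5 : ‖(w : ℂ) - p‖ ^ 2 < 4 := by nlinarith [norm_nonneg ((w : ℂ) - p)]
  have h6 : 8 < l ^ (n + 1) * (1 - ‖p‖) ^ 2 := by
    rw [div_lt_iff₀ hδ] at hn
    calc 8 < l ^ n * (1 - ‖p‖) ^ 2 := hn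
      _ ≤ l ^ (n + 1) * (1 - ‖p‖) ^ 2 := by
        have := pow_le_pow_right₀ hl1.le (Nat.le_succ n)
        gcongr
  have h7 : l ^ (n + 1) * (1 - ‖p‖) ^ 2 ≤
      l ^ (n + 1) * ‖(((skewProduct k t)^[n + 1] (φ, w)).2 : ℂ) - p‖ ^ 2 := by gcongr
  have h8 := cocycle_pos hk h0 h1 (n + 1) (φ, w)
  nlinarith

omit hk h0 h1 in
theorem two_pow_le_cocycle {φ : ℝ} {N : ℕ} (hN : ∀ w, 2 ≤ cocycle k t N (φ, w)) (j : ℕ)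
    (w : Circle) : 2 ^ j ≤ cocycle k t (j * N) (φ, w) := by
  induction j with
  | zero => simp [cocycle]
  | succ j ih =>
    have e : (skewProduct k t)^[j * N] (φ, w) =
        (φ, ((skewProduct k t)^[j * N] (φ, w)).2) :=
      Prod.ext (fst_skewProduct_iterate k t _ _) rfl
    rw [add_mul, one_mul, cocycle_add, e, pow_succ]
    exact mul_le_mul ih (hN _) (by norm_num) (le_trans (by positivity) ih)

/-- If no fixed point on the circle of a fibre map over the compact set `X` is attracting or
neutral, then the fibre maps are uniformly expanding over `X`. -/
theorem exists_uniform_expansion {X : Set ℝ} (hX : IsCompact X)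
    (hfix : ∀ φ ∈ X, ∀ w, blaschkeCircle k t (Circle.exp φ) w = w → 1 < fiberDeriv k t w) :
    ∃ N, 1 ≤ N ∧ ∀ φ ∈ X, ∀ w, 2 ≤ cocycle k t N (φ, w) := by
  refine hX.induction_on (p := fun S => ∃ N, 1 ≤ N ∧ ∀ φ ∈ S, ∀ w, 2 ≤ cocycle k t N (φ, w))
    ⟨1, le_rfl, by simp⟩ (fun S T hST ⟨N, hN, h⟩ => ⟨N, hN, fun φ hφ => h φ (hST hφ)⟩) ?_ ?_
  · rintro S T ⟨N, hN, hS⟩ ⟨M, hM, hT⟩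
    -- A common multiple of the two exponents keeps both expansion estimates.
    refine ⟨M * N, by nlinarith, ?_⟩
    rintro φ (hφ | hφ) w
    · refine le_trans ?_ (two_pow_le_cocycle (hS φ hφ) M w)
      simpa using pow_le_pow_right₀ (by norm_num : (1 : ℝ) ≤ 2) hM
    · rw [mul_comm]
      refine le_trans ?_ (two_pow_le_cocycle (hT φ hφ) N w)
      simpa using pow_le_pow_right₀ (by norm_num : (1 : ℝ) ≤ 2) hN
  -- The strict bound 2 holds on a whole compact fibre, so by the tube lemma the same exponent works
  -- for all nearby φ.
  · intro φ hφ
    obtain ⟨p, hp, hpf⟩ := exists_fixed_point_norm_lt_one h0 h1 _ (hfix φ hφ)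
    obtain ⟨N, hN1, hN⟩ := exists_two_lt_cocycle_of_fixed_point hk h0 h1 hp hpf
    have hopen : IsOpen {x : ℝ × Circle | 2 < cocycle k t N x} :=
      isOpen_lt continuous_const (continuous_cocycle h0 h1 N)
    have hev : ∀ᶠ φ' in 𝓝 φ, ∀ w ∈ (univ : Set Circle), 2 < cocycle k t N (φ', w) :=
      isCompact_univ.eventually_forall_of_forall_eventually fun w _ =>
        hopen.mem_nhds (hN w)
    exact ⟨_, mem_nhdsWithin_of_mem_nhds hev, N, hN1, fun φ' hφ' w => (hφ' w (mem_univ w)).le⟩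

end


/-! ### Level sets of the linearization -/

theorem hasDerivAt_fiberLift_iterate {k : ℕ} {t : ℝ} (h0 : 0 < t) (h1 : t < 1) (φ : ℝ) (n : ℕ)
    (θ : ℝ) : HasDerivAt (fiberLift k t φ)^[n] (cocycle k t n (φ, Circle.exp θ)) θ := by
  induction n generalizing θ with
  | zero => simpa [cocycle] using hasDerivAt_id θ
  | succ n ih =>
    rw [Function.iterate_succ, cocycle_succ, skewProduct_exp h0 h1, mul_comm]
    exact (ih _).comp θ (hasDerivAt_fiberLift h0 h1 k φ θ)

/-- The function `φ ↦ Φ_φ⁻¹ c` whose graph is a leaf of the central foliation. -/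
def leafFun (k : ℕ) (t c φ : ℝ) : ℝ := Function.invFun (linearization k t φ) c

/-- The inverse of `fiberLift`. -/
def fiberLiftInv (k : ℕ) (t φ y : ℝ) : ℝ := angleLift (-t) ((y - φ) / k)

/-- The slope of the `n`-th preimage of a horizontal curve. -/
def slopeSum (k : ℕ) (t : ℝ) (n : ℕ) (x : ℝ × Circle) : ℝ :=
  -∑ j ∈ Finset.range n, (cocycle k t (j + 1) x)⁻¹

/-- The slope of the central foliation. -/
def leafSlope (k : ℕ) (t : ℝ) (x : ℝ × Circle) : ℝ := -∑' j : ℕ, (cocycle k t (j + 1) x)⁻¹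

section

variable {k : ℕ} (hk : 2 ≤ k) {t : ℝ} (h0 : 0 < t) (h1 : t < 1)

include hk h0 h1

theorem linearization_leafFun (c φ : ℝ) : linearization k t φ (leafFun k t c φ) = c :=
  Function.invFun_eq (surjective_linearization hk h0 h1 φ c)

theorem fiberLift_fiberLiftInv (φ y : ℝ) : fiberLift k t φ (fiberLiftInv k t φ y) = y := by
  have hk' : (k : ℝ) ≠ 0 := by exact_mod_cast (by omega : k ≠ 0)
  rw [fiberLift, fiberLiftInv, angleLift_angleLift_neg (abs_lt_one_of_pos h0 h1)]
  field_simp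
  ring

/-- This recursion is implicit differentiation: F_φ(g₁(φ)) = g(φ) gives 1 + F' g₁' = g'. -/
theorem slopeSum_succ (n : ℕ) (x : ℝ × Circle) :
    slopeSum k t (n + 1) x = (slopeSum k t n (skewProduct k t x) - 1) / fiberDeriv k t x.2 := by
  have hf := (fiberDeriv_pos hk h0 h1 x.2).ne'
  rw [slopeSum, Finset.sum_range_succ', slopeSum]
  simp only [cocycle_succ, mul_inv, ← Finset.mul_sum]
  simp only [cocycle, Finset.range_zero, Finset.prod_empty]
  field_simp
  ring

theorem hasDerivAt_fiberLiftInv_iterate (y : ℝ) (n : ℕ) (φ : ℝ) :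
    HasDerivAt (fun φ => (fiberLiftInv k t φ)^[n] y)
      (slopeSum k t n (φ, Circle.exp ((fiberLiftInv k t φ)^[n] y))) φ := by
  induction n generalizing φ with
  | zero => simpa [slopeSum] using hasDerivAt_const φ y
  | succ n ih =>
    have hk' : (k : ℝ) ≠ 0 := by exact_mod_cast (by omega : k ≠ 0)
    have ht := abs_lt_one_of_pos h0 h1
    have ht' : |(-t)| < 1 := by rwa [abs_neg]
    simp only [Function.iterate_succ_apply']
    have hb := hasDerivAt_angleLift ht' (((fiberLiftInv k t φ)^[n] y - φ) / k)
    set b' := (1 - (-t) ^ 2) /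
      (1 + (-t) ^ 2 + 2 * (-t) * Real.cos (((fiberLiftInv k t φ)^[n] y - φ) / k))
    have hinv : fiberDeriv k t (Circle.exp (fiberLiftInv k t φ ((fiberLiftInv k t φ)^[n] y))) * b'
        = k := by
      have hc := (hasDerivAt_angleLift ht
        (angleLift (-t) (((fiberLiftInv k t φ)^[n] y - φ) / k))).comp _ hb
      have he : (angleLift t ∘ angleLift (-t)) = id :=
        funext fun x => angleLift_angleLift_neg ht x
      rw [he] at hc
      have := hc.unique (hasDerivAt_id _)
      rw [fiberDeriv_exp, mul_assoc]
      change (k : ℝ) * ((1 - t ^ 2) / (1 + t ^ 2 + 2 * t *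
        Real.cos (angleLift (-t) (((fiberLiftInv k t φ)^[n] y - φ) / k))) * b') = k
      rw [this, mul_one]
    have hd := hb.comp φ (((ih φ).sub (hasDerivAt_id φ)).div_const (k : ℝ))
    refine hd.congr_deriv ?_
    rw [slopeSum_succ hk h0 h1, skewProduct_exp h0 h1, fiberLift_fiberLiftInv hk h0 h1,
      eq_div_iff (fiberDeriv_pos hk h0 h1 _).ne', mul_comm, ← mul_assoc, hinv]
    field_simp

theorem continuous_slopeSum (n : ℕ) : Continuous (slopeSum k t n) :=
  (continuous_finsetSum _ fun j _ => (continuous_cocycle h0 h1 (j + 1)).inv₀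
    fun x => (cocycle_pos hk h0 h1 (j + 1) x).ne').neg

theorem fiberLift_iterate_fiberLiftInv_iterate (φ y : ℝ) (n : ℕ) :
    (fiberLift k t φ)^[n] ((fiberLiftInv k t φ)^[n] y) = y :=
  Function.LeftInverse.iterate (g := fiberLift k t φ) (fiberLift_fiberLiftInv hk h0 h1 φ) n y

end

/-! ### Leaves over an expanding interval: regularity and uniqueness -/

section Expanding

variable {k : ℕ} (hk : 2 ≤ k) {t : ℝ} (h0 : 0 < t) (h1 : t < 1) {a b : ℝ} {N : ℕ} (hN1 : 1 ≤ N)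
  (hN : ∀ φ ∈ Icc a b, ∀ w, 2 ≤ cocycle k t N (φ, w))

include hN

theorem two_pow_mul_sub_le (h0 : 0 < t) (h1 : t < 1) {φ : ℝ} (hφ : φ ∈ Icc a b) (q : ℕ) {x y : ℝ}
    (hxy : x ≤ y) :
    2 ^ q * (y - x) ≤ (fiberLift k t φ)^[q * N] y - (fiberLift k t φ)^[q * N] x := by
  have hd := hasDerivAt_fiberLift_iterate (k := k) h0 h1 φ (q * N)
  exact Convex.mul_sub_le_image_sub_of_le_deriv convex_univ
    (fun θ _ => (hd θ).continuousAt.continuousWithinAt)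
    (fun θ _ => (hd θ).differentiableAt.differentiableWithinAt)
    (fun θ _ => by rw [(hd θ).deriv]; exact two_pow_le_cocycle (hN φ hφ) q _)
    x (mem_univ _) y (mem_univ _) hxy

include hk h0 h1

/-- If Φ(x) = Φ(y), all iterates of x and y stay within 4π of each other, since F^n is within 2π of
a translate of k^n Φ. Expansion separates them at the rate 2^q. -/
theorem strictMono_linearization {φ : ℝ} (hφ : φ ∈ Icc a b) :
    StrictMono (linearization k t φ) := by
  refine (monotone_linearization hk h0 h1 φ).strictMono_of_injective ?_
  intro x y hxy
  wlog hlt : x < y generalizing x y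
  · rcases eq_or_lt_of_le (not_lt.mp hlt) with h | h
    · exact h.symm
    · exact (this hxy.symm h).symm
  exfalso
  obtain ⟨q, hq⟩ := pow_unbounded_of_one_lt (4 * Real.pi / (y - x)) (by norm_num : (1 : ℝ) < 2)
  rw [div_lt_iff₀ (by linarith)] at hq
  have h := two_pow_mul_sub_le hN h0 h1 hφ q hlt.le
  have e1 := linearization_iterate hk (t := t) φ x (q * N)
  have e2 := linearization_iterate hk (t := t) φ y (q * N)
  have b1 := abs_le.mp (abs_linearization_sub_le hk (t := t) φ ((fiberLift k t φ)^[q * N] x))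
  have b2 := abs_le.mp (abs_linearization_sub_le hk (t := t) φ ((fiberLift k t φ)^[q * N] y))
  rw [e1] at b1
  rw [e2, ← hxy] at b2
  linarith [b1.1, b1.2, b2.1, b2.2]

theorem eq_leafFun {φ c θ : ℝ} (hφ : φ ∈ Icc a b) (h : linearization k t φ θ = c) :
    θ = leafFun k t c φ :=
  (strictMono_linearization hk h0 h1 hN hφ).injective
    (h.trans (linearization_leafFun hk h0 h1 c φ).symm)

/-- The n-th image of the leaf of height c stays at bounded distance from the horizontal line of
height k^n c, and the inverse branches contract. Leaves are thus exponential limits of pulled back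
horizontal lines. -/
theorem abs_pullback_sub_leafFun_le {φ : ℝ} (hφ : φ ∈ Icc a b) (c : ℝ) (q : ℕ) :
    |(fiberLiftInv k t φ)^[q * N] (k ^ (q * N) * c) - leafFun k t c φ| ≤
      (2 * Real.pi + |φ / (k - 1)|) * (1 / 2) ^ q := by
  have hF := fiberLift_iterate_fiberLiftInv_iterate hk h0 h1 φ (k ^ (q * N) * c) (q * N)
  have e1 := linearization_iterate hk (t := t) φ (leafFun k t c φ) (q * N)
  rw [linearization_leafFun hk h0 h1] at e1
  have b1 := abs_linearization_sub_le hk (t := t) φ ((fiberLift k t φ)^[q * N] (leafFun k t c φ))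
  rw [e1] at b1
  set g := (fiberLiftInv k t φ)^[q * N] (k ^ (q * N) * c)
  set y := leafFun k t c φ
  set Y := (fiberLift k t φ)^[q * N] y
  have hY : |(k : ℝ) ^ (q * N) * c - Y| ≤ 2 * Real.pi + |φ / (k - 1)| := by
    have := abs_add_le (k ^ (q * N) * c - Y - φ / (k - 1)) (φ / (k - 1))
    rw [sub_add_cancel] at this
    linarith
  have hexp : 2 ^ q * |g - y| ≤ |(k : ℝ) ^ (q * N) * c - Y| := by
    rcases le_total y g with h | h
    · have h2 := two_pow_mul_sub_le hN h0 h1 hφ q h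
      rw [hF] at h2
      rw [abs_of_nonneg (sub_nonneg.mpr h)]
      exact h2.trans (le_abs_self _)
    · have h2 := two_pow_mul_sub_le hN h0 h1 hφ q h
      rw [hF] at h2
      rw [abs_sub_comm, abs_of_nonneg (sub_nonneg.mpr h), abs_sub_comm]
      exact h2.trans (le_abs_self _)
  have h2 : (0 : ℝ) < 2 ^ q := by positivity
  rw [one_div, inv_pow, ← div_eq_mul_inv, le_div_iff₀ h2, mul_comm]
  exact hexp.trans hY

theorem tendsto_pullback {φ : ℝ} (hφ : φ ∈ Icc a b) (c : ℝ) :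
    Tendsto (fun q : ℕ => (fiberLiftInv k t φ)^[q * N] (k ^ (q * N) * c)) atTop
      (𝓝 (leafFun k t c φ)) := by
  rw [tendsto_iff_norm_sub_tendsto_zero]
  refine squeeze_zero (fun _ => norm_nonneg _)
    (fun q => abs_pullback_sub_leafFun_le hk h0 h1 hN hφ c q) ?_
  have := (tendsto_pow_atTop_nhds_zero_of_lt_one (by norm_num : (0 : ℝ) ≤ 1 / 2)
    (by norm_num)).const_mul (2 * Real.pi + |φ / (k - 1)|)
  simpa using this

include hN1

theorem exists_inv_cocycle_le : ∃ C r : ℝ, 0 < r ∧ r < 1 ∧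
    ∀ φ ∈ Icc a b, ∀ w n, (cocycle k t n (φ, w))⁻¹ ≤ C * r ^ n := by
  have hN0 : N ≠ 0 := by omega
  obtain ⟨w₀, -, hw₀⟩ := isCompact_univ.exists_isMinOn (univ_nonempty (α := Circle))
    (continuous_fiberDeriv k h0 h1).continuousOn
  set m := min 1 (fiberDeriv k t w₀) with hm
  have hm0 : 0 < m := lt_min one_pos (fiberDeriv_pos hk h0 h1 w₀)
  have hm1 : m ≤ 1 := min_le_left _ _
  have hmle : ∀ w, m ≤ fiberDeriv k t w := fun w => (min_le_right _ _).trans (hw₀ (mem_univ w))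
  set r : ℝ := (1 / 2 : ℝ) ^ ((N : ℝ)⁻¹) with hr
  have hrN : r ^ N = 1 / 2 := Real.rpow_inv_natCast_pow (by norm_num) hN0
  have hr0 : 0 < r := Real.rpow_pos_of_pos (by norm_num) _
  have hr1 : r < 1 := by
    by_contra! h
    have := one_le_pow₀ h (n := N)
    rw [hrN] at this
    norm_num at this
  -- Split n into full blocks of length N, each expanding by 2, and a remainder of fewer than N
  -- factors, each at least m. As r^N = 1/2, the factor 2 pays for the remainder in r^n.
  refine ⟨2 * (m ^ N)⁻¹, r, hr0, hr1, fun φ hφ w n => ?_⟩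
  have hdm := Nat.div_add_mod n N
  have hlow : 2 ^ (n / N) * m ^ (n % N) ≤ cocycle k t n (φ, w) := by
    have e : cocycle k t n (φ, w) = cocycle k t (n / N * N) (φ, w) *
        cocycle k t (n % N) ((skewProduct k t)^[n / N * N] (φ, w)) := by
      rw [← cocycle_add, mul_comm, hdm]
    rw [e]
    refine mul_le_mul (two_pow_le_cocycle (hN φ hφ) _ w) ?_ (by positivity)
      (cocycle_pos hk h0 h1 _ _).le
    rw [cocycle]
    calc m ^ (n % N) = ∏ i ∈ Finset.range (n % N), m := by simp
      _ ≤ _ := Finset.prod_le_prod (fun _ _ => hm0.le) fun _ _ => hmle _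
  have hmm : m ^ N ≤ m ^ (n % N) :=
    pow_le_pow_of_le_one hm0.le hm1 (Nat.mod_lt n (by omega)).le
  have hrr : 1 / 2 ≤ r ^ (n % N) := by
    rw [← hrN]
    exact pow_le_pow_of_le_one hr0.le hr1.le (Nat.mod_lt n (by omega)).le
  have hrn : r ^ n = (1 / 2) ^ (n / N) * r ^ (n % N) := by
    rw [← hrN, ← pow_mul, ← pow_add, hdm]
  rw [hrn]
  calc (cocycle k t n (φ, w))⁻¹ ≤ (2 ^ (n / N) * m ^ (n % N))⁻¹ := by gcongr
    _ = (1 / 2) ^ (n / N) * (m ^ (n % N))⁻¹ := by rw [mul_inv, one_div, inv_pow]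
    _ ≤ (1 / 2) ^ (n / N) * (m ^ N)⁻¹ := by gcongr
    _ = 2 * (m ^ N)⁻¹ * ((1 / 2) ^ (n / N) * (1 / 2)) := by ring
    _ ≤ _ := by gcongr

theorem exists_slope_bounds : ∃ K : ℝ,
    (∀ x ∈ strip a b, Summable fun j : ℕ => (cocycle k t (j + 1) x)⁻¹) ∧
    ContinuousOn (leafSlope k t) (strip a b) ∧
    TendstoUniformlyOn (slopeSum k t) (leafSlope k t) atTop (strip a b) ∧
    ∀ n, ∀ x ∈ strip a b, |slopeSum k t n x| ≤ K := by
  obtain ⟨C, r, hr0, hr1, hC⟩ := exists_inv_cocycle_le hk h0 h1 hN1 hN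
  have hb : ∀ j : ℕ, ∀ x ∈ strip a b, ‖(cocycle k t (j + 1) x)⁻¹‖ ≤ C * r ^ (j + 1) :=
    fun j x hx => by
      rw [Real.norm_of_nonneg (inv_nonneg.mpr (cocycle_pos hk h0 h1 _ _).le)]
      exact hC x.1 hx.1 x.2 (j + 1)
  have hs : Summable fun j : ℕ => C * r ^ (j + 1) :=
    ((summable_nat_add_iff 1).mpr (summable_geometric_of_lt_one hr0.le hr1)).mul_left C
  have hsx : ∀ x ∈ strip a b, Summable fun j : ℕ => (cocycle k t (j + 1) x)⁻¹ := fun x hx =>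
    hs.of_norm_bounded fun j => hb j x hx
  refine ⟨∑' j : ℕ, C * r ^ (j + 1), hsx, ?_, ?_, fun n x hx => ?_⟩
  · exact (continuousOn_tsum (fun j => ((continuous_cocycle h0 h1 (j + 1)).inv₀
      fun x => (cocycle_pos hk h0 h1 (j + 1) x).ne').continuousOn) hs hb).neg
  · exact (tendstoUniformlyOn_tsum_nat hs hb).neg
  · rw [slopeSum, abs_neg, ← Real.norm_eq_abs]
    refine (norm_sum_le _ _).trans ((Finset.sum_le_sum fun j _ => hb j x hx).trans ?_)
    exact hs.sum_le_tsum _ fun j _ => (norm_nonneg _).trans (hb j x hx)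

theorem leafSlope_neg {x : ℝ × Circle} (hx : x ∈ strip a b) : leafSlope k t x < 0 := by
  obtain ⟨K, hs, -⟩ := exists_slope_bounds hk h0 h1 hN1 hN
  rw [leafSlope, neg_lt_zero]
  exact (hs x hx).tsum_pos (fun j => inv_nonneg.mpr (cocycle_pos hk h0 h1 _ _).le) 0
    (inv_pos.mpr (cocycle_pos hk h0 h1 _ _))

/-- The fundamental theorem of calculus holds for the smooth pullbacks of horizontal lines;
dominated convergence passes it to the limit, with only pointwise convergence of the curves. -/
theorem leafFun_sub_leafFun (c : ℝ) {x y : ℝ} (hx : x ∈ Icc a b) (hy : y ∈ Icc a b) :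
    leafFun k t c y - leafFun k t c x =
      ∫ φ in x..y, leafSlope k t (φ, Circle.exp (leafFun k t c φ)) := by
  obtain ⟨K, hs, hcont, hunif, hK⟩ := exists_slope_bounds hk h0 h1 hN1 hN
  set g : ℕ → ℝ → ℝ := fun q φ => (fiberLiftInv k t φ)^[q * N] (k ^ (q * N) * c) with hg
  have hgd : ∀ q φ, HasDerivAt (g q) (slopeSum k t (q * N) (φ, Circle.exp (g q φ))) φ :=
    fun q φ => hasDerivAt_fiberLiftInv_iterate hk h0 h1 _ _ φ
  have hgc : ∀ q, Continuous (g q) := fun q =>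
    continuous_iff_continuousAt.mpr fun φ => (hgd q φ).continuousAt
  have hsc : ∀ q, Continuous fun φ => slopeSum k t (q * N) (φ, Circle.exp (g q φ)) := fun q =>
    (continuous_slopeSum hk h0 h1 _).comp
      (continuous_id.prodMk (Circle.exp.continuous.comp (hgc q)))
  have hsub : uIoc x y ⊆ Icc a b := by
    rw [uIoc]
    exact Ioc_subset_Icc_self.trans (Icc_subset_Icc (le_min hx.1 hy.1) (max_le hx.2 hy.2))
  have hmulN : Tendsto (fun q : ℕ => q * N) atTop atTop :=
    tendsto_id.atTop_mul_const' (by omega)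
  have hlim := intervalIntegral.tendsto_integral_filter_of_dominated_convergence
    (μ := volume) (a := x) (b := y) (l := atTop)
    (F := fun q φ => slopeSum k t (q * N) (φ, Circle.exp (g q φ)))
    (f := fun φ => leafSlope k t (φ, Circle.exp (leafFun k t c φ))) (fun _ => K)
    (Eventually.of_forall fun q => (hsc q).aestronglyMeasurable)
    (Eventually.of_forall fun q => ae_of_all _ fun φ hφ => hK _ _ ⟨hsub hφ, mem_univ _⟩)
    intervalIntegrable_const
    (ae_of_all _ fun φ hφ => by
      have hmem : ∀ w : Circle, ((φ, w) : ℝ × Circle) ∈ strip a b := fun w =>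
        ⟨hsub hφ, mem_univ _⟩
      have hl : Tendsto (fun q => ((φ, Circle.exp (g q φ)) : ℝ × Circle)) atTop
          (𝓝[strip a b] (φ, Circle.exp (leafFun k t c φ))) := by
        refine tendsto_nhdsWithin_iff.mpr ⟨?_, Eventually.of_forall fun q => hmem _⟩
        exact tendsto_const_nhds.prodMk_nhds ((Circle.exp.continuous.tendsto _).comp
          (tendsto_pullback hk h0 h1 hN (hsub hφ) c))
      have h1' := (hcont _ (hmem _)).tendsto.comp hl
      -- The point at which the slopes are compared moves with q, so uniform convergence of the
      -- slopes on the strip is used here and continuity of the limit slope in `h1'`.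
      have h2 : Tendsto (fun q => slopeSum k t (q * N) (φ, Circle.exp (g q φ)) -
          leafSlope k t (φ, Circle.exp (g q φ))) atTop (𝓝 0) := by
        rw [Metric.tendstoUniformlyOn_iff] at hunif
        rw [Metric.tendsto_atTop]
        intro ε hε
        obtain ⟨M, hM⟩ := eventually_atTop.mp (hmulN.eventually (hunif ε hε))
        refine ⟨M, fun q hq => ?_⟩
        have := hM q hq _ (hmem (Circle.exp (g q φ)))
        rw [dist_comm, Real.dist_eq] at this
        simpa [Real.dist_eq] using this
      simpa using h2.add h1')
  have hint : ∀ q, ∫ φ in x..y, slopeSum k t (q * N) (φ, Circle.exp (g q φ)) = g q y - g q x :=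
    fun q => intervalIntegral.integral_eq_sub_of_hasDerivAt (fun φ _ => hgd q φ)
      ((hsc q).intervalIntegrable _ _)
  simp only [hint] at hlim
  exact tendsto_nhds_unique ((tendsto_pullback hk h0 h1 hN hy c).sub
    (tendsto_pullback hk h0 h1 hN hx c)) hlim

theorem continuousOn_leafFun (c : ℝ) : ContinuousOn (leafFun k t c) (Icc a b) := by
  obtain ⟨K, hs, hcont, hunif, hK⟩ := exists_slope_bounds hk h0 h1 hN1 hN
  have hK' : ∀ x ∈ strip a b, |leafSlope k t x| ≤ K := fun x hx =>
    le_of_tendsto' ((hunif.tendsto_at hx).abs) fun n => hK n x hx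
  refine (LipschitzOnWith.of_dist_le_mul (K := K.toNNReal) fun x hx y hy => ?_).continuousOn
  rw [Real.dist_eq, leafFun_sub_leafFun hk h0 h1 hN1 hN c hy hx, Real.dist_eq]
  have hsub : uIoc y x ⊆ Icc a b := by
    rw [uIoc]
    exact Ioc_subset_Icc_self.trans (Icc_subset_Icc (le_min hy.1 hx.1) (max_le hy.2 hx.2))
  refine (intervalIntegral.norm_integral_le_of_norm_le_const (C := K)
    (f := fun φ => leafSlope k t (φ, Circle.exp (leafFun k t c φ))) fun φ hφ =>
    hK' _ ⟨hsub hφ, mem_univ _⟩).trans ?_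
  gcongr
  exact Real.le_coe_toNNReal K

/-- A bootstrap: bounded slope makes the leaf Lipschitz, so the integrand in `leafFun_sub_leafFun`
is continuous along it, and then the integral is C¹. -/
theorem contDiffOn_leafFun (hab : a < b) (c : ℝ) :
    ContDiffOn ℝ 1 (leafFun k t c) (Icc a b) ∧ ∀ φ ∈ Icc a b,
      HasDerivWithinAt (leafFun k t c) (leafSlope k t (φ, Circle.exp (leafFun k t c φ))) (Icc a b) φ := by
  obtain ⟨K, hs, hcont, hunif, hK⟩ := exists_slope_bounds hk h0 h1 hN1 hN
  -- The slope is extended by constants beyond the endpoints, so that the integral is differentiable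
  -- on all of ℝ.
  set σ : ℝ → ℝ := IccExtend hab.le
    ((Icc a b).domRestrict fun φ => leafSlope k t (φ, Circle.exp (leafFun k t c φ))) with hσ
  have hσc : Continuous σ := by
    refine Continuous.Icc_extend' (ContinuousOn.domRestrict ?_)
    exact hcont.comp (continuousOn_id.prodMk
      (Circle.exp.continuous.comp_continuousOn (continuousOn_leafFun hk h0 h1 hN1 hN c)))
      fun φ hφ => ⟨hφ, mem_univ _⟩
  have hσe : ∀ φ ∈ Icc a b, σ φ = leafSlope k t (φ, Circle.exp (leafFun k t c φ)) := fun φ hφ => by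
    rw [hσ, IccExtend_of_mem _ _ hφ]
    rfl
  set G : ℝ → ℝ := fun φ => leafFun k t c a + ∫ s in a..φ, σ s with hG
  have hGd : ∀ φ, HasDerivAt G (σ φ) φ := fun φ =>
    (hσc.integral_hasStrictDerivAt a φ).hasDerivAt.const_add _
  have hGe : ∀ φ ∈ Icc a b, leafFun k t c φ = G φ := fun φ hφ => by
    have h := leafFun_sub_leafFun hk h0 h1 hN1 hN c (left_mem_Icc.mpr hab.le) hφ
    have he : ∫ s in a..φ, σ s = ∫ s in a..φ, leafSlope k t (s, Circle.exp (leafFun k t c s)) :=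
      intervalIntegral.integral_congr fun s hs => by
        rw [uIcc_of_le hφ.1] at hs
        exact hσe s ⟨hs.1, hs.2.trans hφ.2⟩
    rw [← he] at h
    simp only [hG]
    linarith
  constructor
  · have hC : ContDiff ℝ 1 G := by
      rw [contDiff_one_iff_deriv]
      refine ⟨fun φ => (hGd φ).differentiableAt, ?_⟩
      rw [show deriv G = σ from funext fun φ => (hGd φ).deriv]
      exact hσc
    exact hC.contDiffOn.congr hGe
  · intro φ hφ
    rw [← hσe φ hφ]
    exact (hGd φ).hasDerivWithinAt.congr hGe (hGe φ hφ)

omit hN1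

theorem mem_graphCurve_leafFun {c φ θ : ℝ} :
    ((φ, Circle.exp θ) : ℝ × Circle) ∈ graphCurve a b (leafFun k t c) ↔
      φ ∈ Icc a b ∧ Circle.exp (linearization k t φ θ) = Circle.exp c := by
  simp only [graphCurve, mem_image, Prod.mk.injEq]
  constructor
  · rintro ⟨φ', hφ, rfl, h⟩
    obtain ⟨m, hm⟩ := Circle.exp_eq_exp.mp h.symm
    refine ⟨hφ, Circle.exp_eq_exp.mpr ⟨m, ?_⟩⟩
    rw [hm, linearization_add_int, linearization_leafFun hk h0 h1]
  · rintro ⟨hφ, h⟩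
    obtain ⟨m, hm⟩ := Circle.exp_eq_exp.mp h.symm
    refine ⟨φ, hφ, rfl, Circle.exp_eq_exp.mpr ⟨m, ?_⟩⟩
    rw [eq_leafFun hk h0 h1 hN hφ (c := c) (θ := θ + m * (2 * Real.pi))]
    rw [linearization_add_int, hm]

theorem graphCurve_leafFun_eq_of_exp_eq {c c' : ℝ} (h : Circle.exp c = Circle.exp c') :
    graphCurve a b (leafFun k t c) = graphCurve a b (leafFun k t c') := by
  ext ⟨φ, w⟩
  obtain ⟨θ, rfl⟩ := Circle.exp_surjective w
  rw [mem_graphCurve_leafFun hk h0 h1 hN, mem_graphCurve_leafFun hk h0 h1 hN, h]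

include hN1

/-- Invariance is Φ ∘ F = kΦ: points with the same e^{iΦ} have images with the same e^{iΦ}. The
slope field is the same function on all leaves because it depends only on the derivatives along the
orbit of the point. -/
theorem isCentralFoliation_range (hab : a < b) :
    IsCentralFoliation k t a b (range fun c => graphCurve a b (leafFun k t c)) := by
  obtain ⟨K, hs, hcont, hunif, hK⟩ := exists_slope_bounds hk h0 h1 hN1 hN
  refine ⟨⟨?_, leafSlope k t, hcont, ?_⟩, ?_⟩
  · rintro ⟨φ, w⟩ ⟨hφ, -⟩
    obtain ⟨θ, rfl⟩ := Circle.exp_surjective w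
    refine ⟨graphCurve a b (leafFun k t (linearization k t φ θ)), ⟨⟨_, rfl⟩,
      (mem_graphCurve_leafFun hk h0 h1 hN).mpr ⟨hφ, rfl⟩⟩, ?_⟩
    rintro _ ⟨⟨c, rfl⟩, hc⟩
    exact graphCurve_leafFun_eq_of_exp_eq hk h0 h1 hN
      ((mem_graphCurve_leafFun hk h0 h1 hN).mp hc).2.symm
  · rintro _ ⟨c, rfl⟩
    obtain ⟨h2, h3⟩ := contDiffOn_leafFun hk h0 h1 hN1 hN hab c
    exact ⟨leafFun k t c, h2, rfl, fun φ hφ =>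
      (h3 φ hφ).derivWithin (uniqueDiffOn_Icc hab φ hφ)⟩
  · rintro _ ⟨c, rfl⟩ _ ⟨c', rfl⟩ ⟨⟨φ, w⟩, hx, hx'⟩ ⟨φ', w'⟩ hy
    obtain ⟨θ, rfl⟩ := Circle.exp_surjective w
    obtain ⟨θ', rfl⟩ := Circle.exp_surjective w'
    rw [mem_preimage, skewProduct_exp h0 h1] at hx' ⊢
    rw [mem_graphCurve_leafFun hk h0 h1 hN] at hx hx' hy ⊢
    refine ⟨hy.1, ?_⟩
    rw [← hx'.2, linearization_fiberLift hk, linearization_fiberLift hk, ← nsmul_eq_mul,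
      ← nsmul_eq_mul, Circle.exp_nsmul, Circle.exp_nsmul, hx.2, hy.2]

omit hk h0 h1 hN hN1 in
theorem eq_of_continuousOn_of_int {d : ℝ → ℝ} (hd : ContinuousOn d (Icc a b))
    (hZ : ∀ x ∈ Icc a b, ∃ m : ℤ, d x = m) {x y : ℝ} (hx : x ∈ Icc a b) (hy : y ∈ Icc a b) :
    d x = d y := by
  have hT : IsDiscrete (range ((↑) : ℤ → ℝ)) := by
    rw [← image_univ]
    exact IsDiscrete.univ.image Int.isClosedEmbedding_coe_real.isInducing
  exact isPreconnected_Icc.constant_of_mapsTo hT hd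
    (fun z hz => by obtain ⟨m, hm⟩ := hZ z hz; exact ⟨m, hm.symm⟩) hx hy

/-- All forward images of a leaf lie in leaves, whose height varies by at most M(b - a), where M
bounds the slope. Hence F_φ^n(g φ) - F_a^n(g a) is bounded in n, and division by k^n gives Φ_φ(g φ)
= Φ_a(g a). -/
theorem eq_range_of_isCentralFoliation (hab : a < b) {F : Set (Set (ℝ × Circle))}
    (hF : IsCentralFoliation k t a b F) :
    F = range fun c => graphCurve a b (leafFun k t c) := by
  obtain ⟨⟨hpart, s, hscont, hleaf⟩, hinv⟩ := hF
  obtain ⟨M, hM⟩ : ∃ M, ∀ x ∈ strip a b, ‖s x‖ ≤ M :=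
    (isCompact_Icc.prod isCompact_univ).exists_bound_of_continuousOn hscont
  have hamem : a ∈ Icc a b := left_mem_Icc.mpr hab.le
  have hvar : ∀ g : ℝ → ℝ, ContDiffOn ℝ 1 g (Icc a b) →
      (∀ φ ∈ Icc a b, derivWithin g (Icc a b) φ = s (φ, Circle.exp (g φ))) →
      ∀ φ ∈ Icc a b, |g φ - g a| ≤ M * (b - a) := by
    intro g hg hg' φ hφ
    have h := (convex_Icc a b).norm_image_sub_le_of_norm_derivWithin_le
      (hg.differentiableOn one_ne_zero) (C := M)
      (fun x hx => by rw [hg' x hx]; exact hM _ ⟨hx, mem_univ _⟩) hamem hφ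
    refine h.trans ?_
    have hM0 : 0 ≤ M := (norm_nonneg _).trans (hM (a, 1) ⟨hamem, mem_univ _⟩)
    rw [Real.norm_of_nonneg (by linarith [hφ.1])]
    have := hφ.2
    gcongr
  have hsub : F ⊆ range fun c => graphCurve a b (leafFun k t c) := by
    intro L hL
    obtain ⟨g, hg, rfl, hgs⟩ := hleaf L hL
    have hiter : ∀ n : ℕ, ∃ h : ℝ → ℝ, ContDiffOn ℝ 1 h (Icc a b) ∧ graphCurve a b h ∈ F ∧
        (∀ φ ∈ Icc a b, derivWithin h (Icc a b) φ = s (φ, Circle.exp (h φ))) ∧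
        ∀ φ ∈ Icc a b, Circle.exp (h φ) = Circle.exp ((fiberLift k t φ)^[n] (g φ)) := by
      intro n
      induction n with
      | zero => exact ⟨g, hg, hL, hgs, fun φ _ => rfl⟩
      | succ n ih =>
        obtain ⟨h, hh, hhF, hhs, hhe⟩ := ih
        obtain ⟨L', ⟨hL', hx⟩, -⟩ := hpart (skewProduct k t (a, Circle.exp (h a)))
          ⟨hamem, mem_univ _⟩
        obtain ⟨h', hh', rfl, hhs'⟩ := hleaf L' hL'
        have hsub := hinv _ hL' _ hhF ⟨(a, Circle.exp (h a)), ⟨a, hamem, rfl⟩, hx⟩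
        refine ⟨h', hh', hL', hhs', fun φ hφ => ?_⟩
        obtain ⟨φ', -, he⟩ := hsub ⟨φ, hφ, rfl⟩
        dsimp only at he
        rw [hhe φ hφ, skewProduct_exp h0 h1, Prod.mk.injEq] at he
        obtain ⟨rfl, he⟩ := he
        rw [he, Function.iterate_succ_apply']
    refine ⟨linearization k t a (g a), ?_⟩
    have hconst : ∀ φ ∈ Icc a b, linearization k t φ (g φ) = linearization k t a (g a) := by
      intro φ hφ
      have hbound : ∀ n : ℕ, |(fiberLift k t φ)^[n] (g φ) - (fiberLift k t a)^[n] (g a)| ≤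
          M * (b - a) := by
        intro n
        obtain ⟨h, hh, hhF, hhs, hhe⟩ := hiter n
        -- The leaf function and the iterated curve agree modulo 2π; by continuity their difference
        -- is constant, so both have the same variation.
        have hc : ContinuousOn (fun φ => (h φ - (fiberLift k t φ)^[n] (g φ)) / (2 * Real.pi))
            (Icc a b) :=
          (hh.continuousOn.sub ((continuous_fiberLift_iterate k h0 h1 n).comp_continuousOn
            (continuousOn_id.prodMk hg.continuousOn))).div_const _
        have h2 := eq_of_continuousOn_of_int hc (fun x hx => by
          obtain ⟨m, hm⟩ := Circle.exp_eq_exp.mp (hhe x hx)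
          refine ⟨m, ?_⟩
          rw [hm]
          field_simp
          ring) hφ hamem
        rw [div_left_inj' (by positivity)] at h2
        have h3 : (fiberLift k t φ)^[n] (g φ) - (fiberLift k t a)^[n] (g a) = h φ - h a := by
          linarith
        rw [h3]
        exact hvar h hh hhs φ hφ
      have hlim := (tendsto_iterate_div_pow hk (t := t) φ (g φ)).sub
        (tendsto_iterate_div_pow hk (t := t) a (g a))
      have hk1 : (1 : ℝ) < k := by exact_mod_cast (by omega : 1 < k)
      have hzero : Tendsto (fun n : ℕ => (fiberLift k t φ)^[n] (g φ) / (k : ℝ) ^ n -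
          (fiberLift k t a)^[n] (g a) / (k : ℝ) ^ n) atTop (𝓝 0) := by
        rw [tendsto_zero_iff_norm_tendsto_zero]
        refine squeeze_zero (fun _ => norm_nonneg _)
          (g := fun n : ℕ => M * (b - a) / (k : ℝ) ^ n) (fun n => ?_)
          (tendsto_const_nhds.div_atTop (tendsto_pow_atTop_atTop_of_one_lt hk1))
        have hkn : (0 : ℝ) < (k : ℝ) ^ n := by positivity
        rw [← sub_div, norm_div, Real.norm_of_nonneg hkn.le]
        exact div_le_div_of_nonneg_right (hbound n) hkn.le
      exact sub_eq_zero.mp (tendsto_nhds_unique hlim hzero)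
    refine image_congr fun φ hφ => ?_
    rw [eq_leafFun hk h0 h1 hN hφ (hconst φ hφ)]
  -- Conversely, the leaf of the given foliation through a point of a level set is itself a level
  -- set, hence the same one.
  refine Subset.antisymm hsub ?_
  rintro _ ⟨c, rfl⟩
  have hx : ((a, Circle.exp (leafFun k t c a)) : ℝ × Circle) ∈ graphCurve a b (leafFun k t c) :=
    ⟨a, hamem, rfl⟩
  obtain ⟨L, ⟨hL, hxL⟩, -⟩ := hpart (a, Circle.exp (leafFun k t c a)) ⟨hamem, mem_univ _⟩
  have huniq := ((isCentralFoliation_range hk h0 h1 hN1 hN hab).1.1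
    (a, Circle.exp (leafFun k t c a)) ⟨hamem, mem_univ _⟩).unique
    ⟨⟨c, rfl⟩, hx⟩ ⟨hsub hL, hxL⟩
  rwa [huniq]

end Expanding

/-! ### Measures on transversals -/

/-- `γ`, restricted to `J`, is a measurable injective parametrization of `τ` by the values of an
angle-valued function `χ`. -/
def IsAdapted (χ : ℝ × Circle → Circle) (J : Set ℝ) (γ : ℝ → ℝ × Circle)
    (τ : Set (ℝ × Circle)) : Prop :=
  MeasurableSet J ∧ Measurable γ ∧ InjOn γ J ∧ γ '' J = τ ∧ ∀ c ∈ J, χ (γ c) = Circle.exp c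

/-- The two parameters of a point differ by a multiple of 2π. Cut the parameter set into countably
many pieces on which this multiple is constant and use translation invariance of Lebesgue measure.
-/
theorem IsAdapted.map_eq {χ : ℝ × Circle → Circle} {J₁ J₂ : Set ℝ} {γ₁ γ₂ : ℝ → ℝ × Circle}
    {τ : Set (ℝ × Circle)} (h₁ : IsAdapted χ J₁ γ₁ τ) (h₂ : IsAdapted χ J₂ γ₂ τ) :
    (volume.restrict J₁).map γ₁ = (volume.restrict J₂).map γ₂ := by
  obtain ⟨hJ₁, hγ₁, hi₁, hτ₁, hχ₁⟩ := h₁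
  obtain ⟨hJ₂, hγ₂, hi₂, hτ₂, hχ₂⟩ := h₂
  have hpi := Real.pi_pos
  ext E hE
  rw [Measure.map_apply hγ₁ hE, Measure.map_apply hγ₂ hE, Measure.restrict_apply (hγ₁ hE),
    Measure.restrict_apply (hγ₂ hE)]
  set A : ℤ → Set ℝ := fun m => {c | c ∈ γ₁ ⁻¹' E ∩ J₁ ∧
    c + m * (2 * Real.pi) ∈ J₂ ∧ γ₂ (c + m * (2 * Real.pi)) = γ₁ c} with hA
  have hAm : ∀ m, MeasurableSet (A m) := fun m => by
    have hadd : Measurable fun c : ℝ => c + m * (2 * Real.pi) := measurable_id.add_const _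
    exact ((hγ₁ hE).inter hJ₁).inter ((hadd hJ₂).inter
      (measurableSet_eq_fun (hγ₂.comp hadd) hγ₁))
  have hcancel : ∀ {m m' : ℤ} {c : ℝ},
      c + m * (2 * Real.pi) = c + m' * (2 * Real.pi) → m = m' := fun {m m' c} h => by
    have h2 : (m : ℝ) * (2 * Real.pi) = m' * (2 * Real.pi) := by linarith
    exact_mod_cast mul_right_cancel₀ (by positivity) h2
  have hU₁ : γ₁ ⁻¹' E ∩ J₁ = ⋃ m, A m := by
    ext c
    rw [mem_iUnion]
    refine ⟨fun hc => ?_, fun ⟨m, hm⟩ => hm.1⟩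
    obtain ⟨c', hc', he⟩ : γ₁ c ∈ γ₂ '' J₂ := hτ₂ ▸ hτ₁ ▸ mem_image_of_mem γ₁ hc.2
    obtain ⟨m, hm⟩ := Circle.exp_eq_exp.mp ((hχ₂ c' hc').symm.trans (he ▸ hχ₁ c hc.2))
    exact ⟨m, hc, hm ▸ hc', hm ▸ he⟩
  have hU₂ : γ₂ ⁻¹' E ∩ J₂ = ⋃ m : ℤ, (fun c => c + -(m * (2 * Real.pi))) ⁻¹' A m := by
    ext c
    rw [mem_iUnion]
    constructor
    · intro hc
      obtain ⟨c', hc', he⟩ : γ₂ c ∈ γ₁ '' J₁ := hτ₁ ▸ hτ₂ ▸ mem_image_of_mem γ₂ hc.2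
      obtain ⟨m, hm⟩ := Circle.exp_eq_exp.mp ((hχ₂ c hc.2).symm.trans (he ▸ hχ₁ c' hc'))
      have hm' : c + -(m * (2 * Real.pi)) = c' := by rw [hm]; ring
      refine ⟨m, ?_⟩
      rw [mem_preimage, hm']
      exact ⟨⟨by rw [mem_preimage, he]; exact hc.1, hc'⟩, hm ▸ hc.2, by rw [← hm, he]⟩
    · rintro ⟨m, ⟨hm1, hm2, hm3⟩⟩
      rw [neg_add_cancel_right] at hm2 hm3
      exact ⟨by rw [mem_preimage, hm3]; exact hm1.1, hm2⟩
  have hadd : ∀ m : ℤ, Measurable fun c : ℝ => c + -((m : ℝ) * (2 * Real.pi)) := fun m =>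
    measurable_id.add_const _
  rw [hU₁, hU₂, measure_iUnion _ hAm, measure_iUnion _ fun m => hadd m (hAm m)]
  · refine tsum_congr fun m => ?_
    rw [measure_preimage_add_right]
  · intro m m' hne
    refine Set.disjoint_left.mpr fun c hc hc' => hne ?_
    have h1 := hi₁ hc.1.2 hc'.1.2 (by
      rw [← hc.2.2, ← hc'.2.2, neg_add_cancel_right, neg_add_cancel_right])
    exact hcancel (c := -c) (by linarith)
  · intro m m' hne
    refine Set.disjoint_left.mpr fun c hc hc' => hne ?_
    exact hcancel (hi₂ hc.2.1 hc'.2.1 (hc.2.2.trans hc'.2.2.symm))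

open Classical in
/-- The normalized Lebesgue measure in the coordinate `χ`, transported to `τ`. -/
def transverseMeasure (χ : ℝ × Circle → Circle) (τ : Set (ℝ × Circle)) : Measure (ℝ × Circle) :=
  if h : ∃ x : Set ℝ × (ℝ → ℝ × Circle), IsAdapted χ x.1 x.2 τ then
    ENNReal.ofReal (1 / (2 * Real.pi)) • (volume.restrict h.choose.1).map h.choose.2 else 0

theorem IsAdapted.transverseMeasure_eq {χ : ℝ × Circle → Circle} {J : Set ℝ} {γ : ℝ → ℝ × Circle}
    {τ : Set (ℝ × Circle)} (h : IsAdapted χ J γ τ) :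
    transverseMeasure χ τ =
      ENNReal.ofReal (1 / (2 * Real.pi)) • (volume.restrict J).map γ := by
  have hex : ∃ x : Set ℝ × (ℝ → ℝ × Circle), IsAdapted χ x.1 x.2 τ := ⟨(J, γ), h⟩
  rw [transverseMeasure, dif_pos hex, hex.choose_spec.map_eq h]

theorem IsAdapted.measurableSet {χ : ℝ × Circle → Circle} {J : Set ℝ} {γ : ℝ → ℝ × Circle}
    {τ : Set (ℝ × Circle)} (h : IsAdapted χ J γ τ) : MeasurableSet τ :=
  h.2.2.2.1 ▸ h.1.image_of_measurable_injOn h.2.1 h.2.2.1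

theorem transverseMeasure_restrict {χ : ℝ × Circle → Circle} {J J' : Set ℝ}
    {γ γ' : ℝ → ℝ × Circle} {τ τ' : Set (ℝ × Circle)} (h : IsAdapted χ J γ τ)
    (h' : IsAdapted χ J' γ' τ') (hsub : τ' ⊆ τ) :
    transverseMeasure χ τ' = (transverseMeasure χ τ).restrict τ' := by
  have hm := h'.measurableSet
  have h2 : IsAdapted χ (γ ⁻¹' τ' ∩ J) γ τ' := by
    obtain ⟨hJ, hγ, hi, hτ, hχ⟩ := h
    refine ⟨(hγ hm).inter hJ, hγ, hi.mono inter_subset_right, ?_, fun c hc => hχ c hc.2⟩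
    rw [inter_comm, image_inter_preimage, hτ, inter_eq_right.mpr hsub]
  rw [h2.transverseMeasure_eq, h.transverseMeasure_eq, Measure.restrict_smul,
    Measure.restrict_map h.2.1 hm, Measure.restrict_restrict (h.2.1 hm)]

/-- Holonomy preserves χ, so it carries an adapted parametrization of τ₁ to one of τ₂, and the
measure does not depend on the parametrization. -/
theorem transverseMeasure_holonomy {χ : ℝ × Circle → Circle} {J₁ J₂ : Set ℝ}
    {γ₁ γ₂ : ℝ → ℝ × Circle} {τ₁ τ₂ : Set (ℝ × Circle)} (h₁ : IsAdapted χ J₁ γ₁ τ₁)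
    (h₂ : IsAdapted χ J₂ γ₂ τ₂) {h : ℝ × Circle → ℝ × Circle} (hb : BijOn h τ₁ τ₂)
    (hh : ∀ x ∈ τ₁, ∀ y ∈ τ₂, χ x = χ y ↔ h x = y) :
    AEMeasurable h (transverseMeasure χ τ₁) ∧
      transverseMeasure χ τ₂ = (transverseMeasure χ τ₁).map h := by
  classical
  have hτm := h₁.measurableSet
  obtain ⟨hJ₁, hγ₁, hi₁, hτ₁, hχ₁⟩ := id h₁
  obtain ⟨hJ₂, hγ₂, hi₂, hτ₂, hχ₂⟩ := id h₂
  have hmem₁ : ∀ c ∈ J₁, γ₁ c ∈ τ₁ := fun c hc => hτ₁ ▸ mem_image_of_mem γ₁ hc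
  have hmem₂ : ∀ c ∈ J₂, γ₂ c ∈ τ₂ := fun c hc => hτ₂ ▸ mem_image_of_mem γ₂ hc
  have hχh : ∀ x ∈ τ₁, χ (h x) = χ x := fun x hx => ((hh x hx _ (hb.mapsTo hx)).mpr rfl).symm
  -- Measurability of the holonomy is not assumed. Its preimages are injective measurable images of
  -- Borel parameter sets, hence Borel by Lusin–Souslin.
  have hpre : ∀ E, MeasurableSet E → MeasurableSet (h ⁻¹' E ∩ τ₁) := by
    intro E hE
    have hm : MeasurableSet (⋃ m : ℤ, {c | c ∈ J₁ ∧ c + m * (2 * Real.pi) ∈ J₂ ∧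
        γ₂ (c + m * (2 * Real.pi)) ∈ E}) := by
      refine MeasurableSet.iUnion fun m => ?_
      have hadd : Measurable fun c : ℝ => c + m * (2 * Real.pi) := measurable_id.add_const _
      exact hJ₁.inter ((hadd hJ₂).inter ((hγ₂.comp hadd) hE))
    have heq : h ⁻¹' E ∩ τ₁ = γ₁ '' (⋃ m : ℤ, {c | c ∈ J₁ ∧ c + m * (2 * Real.pi) ∈ J₂ ∧
        γ₂ (c + m * (2 * Real.pi)) ∈ E}) := by
      ext x
      simp only [mem_inter_iff, mem_preimage, mem_image, mem_iUnion, mem_ofPred_eq]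
      constructor
      · rintro ⟨hxE, hx⟩
        obtain ⟨c, hc, rfl⟩ : x ∈ γ₁ '' J₁ := hτ₁ ▸ hx
        obtain ⟨c', hc', he⟩ : h (γ₁ c) ∈ γ₂ '' J₂ := hτ₂ ▸ hb.mapsTo hx
        obtain ⟨m, rfl⟩ := Circle.exp_eq_exp.mp
          ((hχ₂ c' hc').symm.trans ((congrArg χ he).trans ((hχh _ hx).trans (hχ₁ c hc))))
        exact ⟨c, ⟨m, hc, hc', he ▸ hxE⟩, rfl⟩
      · rintro ⟨c, ⟨m, hc, hc', hE'⟩, rfl⟩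
        have he : h (γ₁ c) = γ₂ (c + m * (2 * Real.pi)) := by
          refine (hh _ (hmem₁ c hc) _ (hmem₂ _ hc')).mp ?_
          rw [hχ₁ c hc, hχ₂ _ hc']
          exact (Circle.exp_eq_exp.mpr ⟨m, rfl⟩).symm
        exact ⟨he ▸ hE', hmem₁ c hc⟩
    rw [heq]
    refine hm.image_of_measurable_injOn hγ₁ (hi₁.mono ?_)
    exact iUnion_subset fun m c hc => hc.1
  -- A globally measurable version of h; the value off τ₁ is irrelevant because the measure lives on
  -- τ₁.
  set h' : ℝ × Circle → ℝ × Circle := fun x => if x ∈ τ₁ then h x else (0, 1) with hh'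
  have hh'm : Measurable h' := by
    intro E hE
    have : h' ⁻¹' E = (h ⁻¹' E ∩ τ₁) ∪ (τ₁ᶜ ∩ {_x | ((0, 1) : ℝ × Circle) ∈ E}) := by
      ext x
      by_cases hx : x ∈ τ₁ <;> simp [hh', hx]
    rw [this]
    exact (hpre E hE).union (hτm.compl.inter (MeasurableSet.const _))
  have hae : h =ᵐ[transverseMeasure χ τ₁] h' := by
    have : ∀ᵐ x ∂(transverseMeasure χ τ₁), x ∈ τ₁ := by
      rw [h₁.transverseMeasure_eq]
      refine Measure.ae_smul_measure ?_ _
      exact (ae_map_iff hγ₁.aemeasurable hτm).mpr ((ae_restrict_mem hJ₁).mono hmem₁)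
    filter_upwards [this] with x hx
    simp [hh', hx]
  have hh'e : ∀ x ∈ τ₁, h' x = h x := fun x hx => by simp [hh', hx]
  refine ⟨⟨h', hh'm, hae⟩, ?_⟩
  have hA : IsAdapted χ J₁ (h' ∘ γ₁) τ₂ := by
    refine ⟨hJ₁, hh'm.comp hγ₁, fun x hx y hy hxy => ?_, ?_, fun c hc => ?_⟩
    · simp only [Function.comp, hh'e _ (hmem₁ x hx), hh'e _ (hmem₁ y hy)] at hxy
      exact hi₁ hx hy (hb.injOn (hmem₁ x hx) (hmem₁ y hy) hxy)
    · rw [image_comp, hτ₁, image_congr hh'e, hb.image_eq]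
    · rw [Function.comp, hh'e _ (hmem₁ c hc), hχh _ (hmem₁ c hc), hχ₁ c hc]
  rw [hA.transverseMeasure_eq, Measure.map_congr hae, h₁.transverseMeasure_eq, Measure.map_smul,
    Measure.map_map hh'm hγ₁]

/-- The parametrization is κ ∘ Ψ⁻¹ on Ψ(I), with an arbitrary constant value elsewhere; it is Borel
because injective continuous images of Borel sets are Borel. -/
theorem exists_isAdapted {χ : ℝ × Circle → Circle} {I : Set ℝ} (hI : MeasurableSet I)
    {κ : ℝ → ℝ × Circle} (hκ : ContinuousOn κ I) (hκi : InjOn κ I) {Ψ : ℝ → ℝ}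
    (hΨ : ContinuousOn Ψ I) (hΨi : InjOn Ψ I) (hχ : ∀ u ∈ I, χ (κ u) = Circle.exp (Ψ u)) :
    ∃ γ, IsAdapted χ (Ψ '' I) γ (κ '' I) ∧ ∀ u ∈ I, γ (Ψ u) = κ u := by
  classical
  have hJ : MeasurableSet (Ψ '' I) := hI.image_of_continuousOn_injOn hΨ hΨi
  set γ : ℝ → ℝ × Circle := fun c =>
    if c ∈ Ψ '' I then κ (Function.invFunOn Ψ I c) else (0, 1) with hγ
  have hγe : ∀ u ∈ I, γ (Ψ u) = κ u := fun u hu => by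
    rw [hγ]
    simp only [mem_image_of_mem Ψ hu, if_true]
    rw [hΨi.leftInvOn_invFunOn hu]
  refine ⟨γ, ⟨hJ, ?_, ?_, ?_, ?_⟩, hγe⟩
  · intro E hE
    have hpre : MeasurableSet (I ∩ κ ⁻¹' E) := by
      have := MeasurableSet.subtype_image hI (hκ.domRestrict.measurable hE)
      convert this using 1
      ext u
      simp [and_comm]
    have : γ ⁻¹' E = Ψ '' (I ∩ κ ⁻¹' E) ∪ ((Ψ '' I)ᶜ ∩ {_x | ((0, 1) : ℝ × Circle) ∈ E}) := by
      ext c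
      by_cases hc : c ∈ Ψ '' I
      · obtain ⟨u, hu, rfl⟩ := hc
        simp only [mem_preimage, hγe u hu, mem_union, mem_inter_iff, mem_compl_iff,
          mem_image_of_mem Ψ hu, not_true_eq_false, false_and, or_false]
        constructor
        · exact fun h => ⟨u, ⟨hu, h⟩, rfl⟩
        · rintro ⟨v, ⟨hv, h⟩, he⟩
          rwa [hΨi hv hu he] at h
      · have h1 : c ∉ Ψ '' (I ∩ κ ⁻¹' E) := fun h => hc (image_mono inter_subset_left h)
        simp only [mem_preimage, hγ, hc, if_false, mem_union, h1, false_or, mem_inter_iff,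
          mem_compl_iff, not_false_eq_true, true_and, mem_ofPred_eq]
    rw [this]
    exact ((hpre.image_of_continuousOn_injOn (hΨ.mono inter_subset_left)
      (hΨi.mono inter_subset_left))).union (hJ.compl.inter (MeasurableSet.const _))
  · rintro _ ⟨u, hu, rfl⟩ _ ⟨v, hv, rfl⟩ h
    rw [hγe u hu, hγe v hv] at h
    rw [hκi hu hv h]
  · rw [image_image]
    exact image_congr hγe
  · rintro _ ⟨u, hu, rfl⟩
    rw [hγe u hu, hχ u hu]


/-- A maximum over [u, v] cannot occur before v, because a larger value would follow it. -/
theorem strictMonoOn_of_exists_gt {f : ℝ → ℝ} {I : Set ℝ} (hI : I.OrdConnected)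
    (hf : ContinuousOn f I)
    (h : ∀ u ∈ I, ∀ v ∈ I, u < v → ∃ w ∈ Ioc u v, f u < f w) : StrictMonoOn f I := by
  intro u hu v hv huv
  have hsub : Icc u v ⊆ I := hI.out hu hv
  obtain ⟨x, hx, hmax⟩ := isCompact_Icc.exists_isMaxOn (nonempty_Icc.mpr huv.le) (hf.mono hsub)
  have hxv : x = v := by
    by_contra hne
    obtain ⟨w, hw, hlt⟩ := h x (hsub hx) v hv (lt_of_le_of_ne hx.2 hne)
    exact (hmax ⟨hx.1.trans hw.1.le, hw.2⟩).not_gt hlt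
  obtain ⟨w, hw, hlt⟩ := h u hu v hv huv
  exact hlt.trans_le (hxv ▸ hmax ⟨hw.1.le, hw.2⟩)

theorem exists_gt_of_hasDerivWithinAt_pos {d : ℝ → ℝ} {d' : ℝ} {I : Set ℝ} (hI : I.OrdConnected)
    {u v : ℝ} (hu : u ∈ I) (hv : v ∈ I) (huv : u < v) (hd : HasDerivWithinAt d d' I u)
    (hd' : 0 < d') : ∃ w ∈ Ioc u v, d u < d w := by
  have hsub : Ioc u v ⊆ I := Ioc_subset_Icc_self.trans (hI.out hu hv)
  have ht := (hasDerivWithinAt_iff_tendsto_slope' (by simp)).mp (hd.mono hsub)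
  have hne : (𝓝[Ioc u v] u).NeBot := by
    rw [nhdsWithin_Ioc_eq_nhdsGT huv]
    infer_instance
  obtain ⟨w, hw, hw2⟩ := ((ht.eventually (lt_mem_nhds hd')).and self_mem_nhdsWithin).exists
  refine ⟨w, hw2, ?_⟩
  rw [slope_def_field, div_pos_iff_of_pos_right (by linarith [hw2.1])] at hw
  linarith

theorem exists_mem_Ico_exp_eq (w : Circle) : ∃ θ ∈ Ico 0 (2 * Real.pi), Circle.exp θ = w := by
  have hpi : 0 < 2 * Real.pi := by positivity
  obtain ⟨θ, rfl⟩ := Circle.exp_surjective w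
  have h := toIcoMod_mem_Ico hpi 0 θ
  rw [zero_add] at h
  refine ⟨_, h, ?_⟩
  rw [toIcoMod, zsmul_eq_mul]
  exact Circle.exp_eq_exp.mpr ⟨-toIcoDiv hpi 0 θ, by push_cast; ring⟩

/-- The angle-valued function whose level sets are the leaves of the central foliation. -/
def straighten (k : ℕ) (t : ℝ) (x : ℝ × Circle) : Circle :=
  Circle.exp (linearization k t x.1 (Complex.arg x.2))

theorem straighten_exp (k : ℕ) (t φ θ : ℝ) :
    straighten k t (φ, Circle.exp θ) = Circle.exp (linearization k t φ θ) := by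
  obtain ⟨m, hm⟩ := Circle.exp_eq_exp.mp (Circle.exp_arg (Circle.exp θ))
  rw [straighten]
  dsimp only
  rw [hm, linearization_add_int]
  exact Circle.exp_eq_exp.mpr ⟨m, rfl⟩

theorem uniqueDiffOn_of_ordConnected {I : Set ℝ} (hI : I.OrdConnected) (hn : I.Nontrivial) :
    UniqueDiffOn ℝ I := by
  refine uniqueDiffOn_convex hI.convex ?_
  obtain ⟨x, hx, y, hy, hxy⟩ := hn.exists_lt
  exact (nonempty_Ioo.mpr hxy).mono
    (interior_maximal (Ioo_subset_Icc_self.trans (hI.out hx hy)) isOpen_Ioo)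

/-! ### Monotonicity of Φ along transversals and the invariant measure -/

section Transversals

variable {k : ℕ} (hk : 2 ≤ k) {t : ℝ} (h0 : 0 < t) (h1 : t < 1) {a b : ℝ} {N : ℕ} (hN1 : 1 ≤ N)
  (hN : ∀ φ ∈ Icc a b, ∀ w, 2 ≤ cocycle k t N (φ, w))

include hk h0 h1 hN

theorem sameLeaf_iff {x y : ℝ × Circle} (hx : x ∈ strip a b) (hy : y ∈ strip a b) :
    SameLeaf (range fun c => graphCurve a b (leafFun k t c)) x y ↔
      straighten k t x = straighten k t y := by
  obtain ⟨φ, w⟩ := x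
  obtain ⟨φ', w'⟩ := y
  obtain ⟨θ, rfl⟩ := Circle.exp_surjective w
  obtain ⟨θ', rfl⟩ := Circle.exp_surjective w'
  rw [straighten_exp, straighten_exp]
  constructor
  · rintro ⟨_, ⟨c, rfl⟩, h2, h3⟩
    rw [mem_graphCurve_leafFun hk h0 h1 hN] at h2 h3
    rw [h2.2, h3.2]
  · intro h
    refine ⟨_, ⟨linearization k t φ θ, rfl⟩, ?_, ?_⟩ <;>
      rw [mem_graphCurve_leafFun hk h0 h1 hN]
    · exact ⟨hx.1, rfl⟩
    · exact ⟨hy.1, h.symm⟩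

include hN1

/-- No derivative of Φ is available, so the curve is compared with the C¹ leaf through each of its
points. The height above that leaf vanishes there with derivative D ≠ 0, and D has constant sign by
continuity on an interval. Monotonicity of Φ_φ turns this into strict monotonicity of Φ along the
curve. -/
theorem injOn_linearization_of_isTransversal (hab : a < b) {I : Set ℝ} {p q : ℝ → ℝ}
    (hI : I.OrdConnected) (hIn : I.Nontrivial) (hp : ContDiffOn ℝ 1 p I) (hq : ContDiffOn ℝ 1 q I)
    (hpX : ∀ u ∈ I, p u ∈ Icc a b)
    (htr : ∀ u ∈ I, derivWithin q I u ≠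
      leafSlope k t (p u, Circle.exp (q u)) * derivWithin p I u) :
    InjOn (fun u => linearization k t (p u) (q u)) I := by
  obtain ⟨K, -, hscont, -⟩ := exists_slope_bounds hk h0 h1 hN1 hN
  have hud := uniqueDiffOn_of_ordConnected hI hIn
  set D : ℝ → ℝ := fun u => derivWithin q I u -
    leafSlope k t (p u, Circle.exp (q u)) * derivWithin p I u with hD
  have hDc : ContinuousOn D I :=
    (hq.continuousOn_derivWithin hud le_rfl).sub ((hscont.comp (hp.continuousOn.prodMk
      (Circle.exp.continuous.comp_continuousOn hq.continuousOn))
      fun u hu => ⟨hpX u hu, mem_univ _⟩).mul (hp.continuousOn_derivWithin hud le_rfl))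
  have hΨc : ContinuousOn (fun u => linearization k t (p u) (q u)) I :=
    (continuous_linearization hk h0 h1).comp_continuousOn (hp.continuousOn.prodMk hq.continuousOn)
  have hder : ∀ u ∈ I, HasDerivWithinAt (fun w => q w -
      leafFun k t (linearization k t (p u) (q u)) (p w)) (D u) I u := by
    intro u hu
    have hqe : leafFun k t (linearization k t (p u) (q u)) (p u) = q u :=
      (eq_leafFun hk h0 h1 hN (hpX u hu) rfl).symm
    have hl := (contDiffOn_leafFun hk h0 h1 hN1 hN hab (linearization k t (p u) (q u))).2
      (p u) (hpX u hu)
    rw [hqe] at hl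
    have hp' := (hp.differentiableOn one_ne_zero u hu).hasDerivWithinAt
    have hq' := (hq.differentiableOn one_ne_zero u hu).hasDerivWithinAt
    exact hq'.sub (hl.comp u hp' hpX)
  have hcmp : ∀ u ∈ I, ∀ w ∈ I, ∀ c, (0 < q w - leafFun k t c (p w) →
      c < linearization k t (p w) (q w)) ∧ (0 < -(q w - leafFun k t c (p w)) →
      linearization k t (p w) (q w) < c) := by
    intro u hu w hw c
    have hm := strictMono_linearization hk h0 h1 hN (hpX w hw)
    have he := linearization_leafFun hk h0 h1 c (p w)
    refine ⟨fun h => ?_, fun h => ?_⟩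
    · calc c = _ := he.symm
        _ < _ := hm (by linarith)
    · calc _ < _ := hm (by linarith)
        _ = c := he
  have hzero : ∀ u ∈ I, q u - leafFun k t (linearization k t (p u) (q u)) (p u) = 0 :=
    fun u hu => sub_eq_zero.mpr (eq_leafFun hk h0 h1 hN (hpX u hu) rfl)
  have hsign : (∀ u ∈ I, 0 < D u) ∨ ∀ u ∈ I, D u < 0 := by
    by_contra! hcon
    obtain ⟨⟨u, hu, hu'⟩, v, hv, hv'⟩ := hcon
    have hoc := (hI.isPreconnected.image D hDc).ordConnected
    obtain ⟨w, hw, hw0⟩ := hoc.out (mem_image_of_mem D hu) (mem_image_of_mem D hv) ⟨hu', hv'⟩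
    exact htr w hw (sub_eq_zero.mp hw0)
  rcases hsign with hpos | hneg
  · refine (strictMonoOn_of_exists_gt hI hΨc fun u hu v hv huv => ?_).injOn
    obtain ⟨w, hw, hlt⟩ := exists_gt_of_hasDerivWithinAt_pos hI hu hv huv (hder u hu) (hpos u hu)
    rw [hzero u hu] at hlt
    exact ⟨w, hw, (hcmp u hu w (hI.out hu hv ⟨hw.1.le, hw.2⟩) _).1 hlt⟩
  · have hm := strictMonoOn_of_exists_gt hI hΨc.neg fun u hu v hv huv => ?_
    · intro x hx y hy hxy
      exact hm.injOn hx hy (congrArg Neg.neg hxy)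
    obtain ⟨w, hw, hlt⟩ := exists_gt_of_hasDerivWithinAt_pos hI hu hv huv (hder u hu).neg
      (neg_pos.mpr (hneg u hu))
    simp only [Pi.neg_apply] at hlt ⊢
    rw [hzero u hu, neg_zero] at hlt
    exact ⟨w, hw, neg_lt_neg ((hcmp u hu w (hI.out hu hv ⟨hw.1.le, hw.2⟩) _).2 hlt)⟩

theorem exists_isAdapted_of_isTransversal (hab : a < b) {τ : Set (ℝ × Circle)}
    (hτ : IsTransversal a b (range fun c => graphCurve a b (leafFun k t c)) τ) :
    ∃ J γ, IsAdapted (straighten k t) J γ τ := by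
  obtain ⟨hsub, I, p, q, hI, hIn, hp, hq, hinj, rfl, htr⟩ := hτ
  have hpX : ∀ u ∈ I, p u ∈ Icc a b := fun u hu => (hsub (mem_image_of_mem _ hu)).1
  have hΨi := injOn_linearization_of_isTransversal hk h0 h1 hN1 hN hab hI hIn hp hq hpX
    fun u hu => by
      have hl := contDiffOn_leafFun hk h0 h1 hN1 hN hab (linearization k t (p u) (q u))
      have hqe := (eq_leafFun hk h0 h1 hN (hpX u hu) (θ := q u) rfl).symm
      have := htr u hu _ hl.1 ⟨_, rfl⟩ (by rw [hqe])
      rwa [(hl.2 _ (hpX u hu)).derivWithin (uniqueDiffOn_Icc hab _ (hpX u hu)), hqe] at this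
  obtain ⟨γ, hγ, -⟩ := exists_isAdapted (χ := straighten k t) hI.measurableSet
    (hp.continuousOn.prodMk (Circle.exp.continuous.comp_continuousOn hq.continuousOn)) hinj
    ((continuous_linearization hk h0 h1).comp_continuousOn (hp.continuousOn.prodMk hq.continuousOn))
    hΨi fun u _ => straighten_exp k t (p u) (q u)
  exact ⟨_, γ, hγ⟩

theorem isTransverseInvariantMeasure_transverseMeasure (hab : a < b) :
    IsTransverseInvariantMeasure a b (range fun c => graphCurve a b (leafFun k t c))
      (transverseMeasure (straighten k t)) := by
  refine ⟨fun τ τ' hτ hτ' hsub => ?_, fun τ₁ τ₂ hτ₁ hτ₂ h hh => ?_⟩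
  · obtain ⟨J, γ, hJ⟩ := exists_isAdapted_of_isTransversal hk h0 h1 hN1 hN hab hτ
    obtain ⟨J', γ', hJ'⟩ := exists_isAdapted_of_isTransversal hk h0 h1 hN1 hN hab hτ'
    exact transverseMeasure_restrict hJ hJ' hsub
  · obtain ⟨J₁, γ₁, hJ₁⟩ := exists_isAdapted_of_isTransversal hk h0 h1 hN1 hN hab hτ₁
    obtain ⟨J₂, γ₂, hJ₂⟩ := exists_isAdapted_of_isTransversal hk h0 h1 hN1 hN hab hτ₂
    refine transverseMeasure_holonomy hJ₁ hJ₂ hh.1 fun x hx y hy => ?_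
    rw [← hh.2 x hx y hy, sameLeaf_iff hk h0 h1 hN (hτ₁.1 hx) (hτ₂.1 hy)]

/-- The function g representing a leaf is unique only up to a constant multiple of 2π, which does
not affect slopes. This handles the arbitrary g in `IsTransversal`. -/
theorem derivWithin_eq_leafSlope (hab : a < b) {g : ℝ → ℝ} (hg : ContDiffOn ℝ 1 g (Icc a b))
    (hgF : graphCurve a b g ∈ range fun c => graphCurve a b (leafFun k t c)) {φ : ℝ}
    (hφ : φ ∈ Icc a b) :
    derivWithin g (Icc a b) φ = leafSlope k t (φ, Circle.exp (g φ)) := by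
  obtain ⟨c, hc⟩ := hgF
  obtain ⟨hl, hl'⟩ := contDiffOn_leafFun hk h0 h1 hN1 hN hab c
  have he : ∀ x ∈ Icc a b, Circle.exp (g x) = Circle.exp (leafFun k t c x) := fun x hx => by
    have : ((x, Circle.exp (g x)) : ℝ × Circle) ∈ graphCurve a b (leafFun k t c) :=
      (show graphCurve a b (leafFun k t c) = graphCurve a b g from hc).symm ▸ ⟨x, hx, rfl⟩
    obtain ⟨y, -, hy⟩ := this
    simp only [Prod.mk.injEq] at hy
    rw [← hy.2, hy.1]
  have hconst : ∀ x ∈ Icc a b, g x = leafFun k t c x + (g φ - leafFun k t c φ) := fun x hx => by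
    have := eq_of_continuousOn_of_int
      (d := fun x => (g x - leafFun k t c x) / (2 * Real.pi))
      ((hg.continuousOn.sub hl.continuousOn).div_const _) (fun x hx => by
        obtain ⟨m, hm⟩ := Circle.exp_eq_exp.mp (he x hx)
        refine ⟨m, ?_⟩
        rw [hm]
        field_simp
        ring) hx hφ
    rw [div_left_inj' (by positivity)] at this
    linarith
  rw [he φ hφ]
  exact (((hl' φ hφ).add_const _).congr hconst (hconst φ hφ)).derivWithin
    (uniqueDiffOn_Icc hab φ hφ)

omit hk h0 h1 hN1 hN in
theorem isTransversal_verticalFiber {φ : ℝ} (hφ : φ ∈ Icc a b) :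
    IsTransversal a b (range fun c => graphCurve a b (leafFun k t c)) (verticalFiber φ) := by
  have hpi := Real.pi_pos
  have hu : ∀ u ∈ Ico (0 : ℝ) (2 * Real.pi), UniqueDiffWithinAt ℝ (Ico (0 : ℝ) (2 * Real.pi)) u :=
    uniqueDiffOn_Ico 0 (2 * Real.pi)
  refine ⟨?_, Ico 0 (2 * Real.pi), fun _ => φ, id, ordConnected_Ico, ?_, contDiffOn_const,
    contDiffOn_id, ?_, ?_, fun u hu' g _ _ _ => ?_⟩
  · rintro ⟨x, w⟩ ⟨hx, -⟩
    exact ⟨(mem_singleton_iff.mp hx) ▸ hφ, mem_univ _⟩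
  · exact ⟨0, ⟨le_rfl, by positivity⟩, Real.pi, ⟨hpi.le, by linarith⟩, hpi.ne⟩
  · intro x hx y hy hxy
    exact Circle.exp_injOn_Ico (by linarith) hx hy (Prod.mk.inj hxy).2
  · ext ⟨x, w⟩
    simp only [verticalFiber, mem_prod, mem_singleton_iff, mem_univ, and_true, mem_image,
      Prod.mk.injEq, id]
    constructor
    · rintro rfl
      obtain ⟨θ, hθ, rfl⟩ := exists_mem_Ico_exp_eq w
      exact ⟨θ, hθ, rfl, rfl⟩
    · rintro ⟨u, -, rfl, -⟩
      rfl
  · rw [derivWithin_id _ _ (hu u hu'), derivWithin_fun_const]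
    simp

/-- Leaves have negative slope, the diagonal has slope 1. -/
theorem isTransversal_diagonal (hab : a < b) :
    IsTransversal a b (range fun c => graphCurve a b (leafFun k t c)) (diagonal a b) := by
  refine ⟨?_, Icc a b, id, id, ordConnected_Icc, ?_, contDiffOn_id, contDiffOn_id, ?_, rfl,
    fun u hu g hg hgF _ => ?_⟩
  · rintro _ ⟨x, hx, rfl⟩
    exact ⟨hx, mem_univ _⟩
  · exact ⟨a, left_mem_Icc.mpr hab.le, b, right_mem_Icc.mpr hab.le, hab.ne⟩
  · intro x hx y hy hxy
    exact (Prod.mk.inj hxy).1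
  · rw [id, derivWithin_eq_leafSlope hk h0 h1 hN1 hN hab hg hgF hu,
      derivWithin_id _ _ (uniqueDiffOn_Icc hab u hu), mul_one]
    have := leafSlope_neg hk h0 h1 hN1 hN (x := (u, Circle.exp (g u))) ⟨hu, mem_univ _⟩
    linarith

theorem injOn_linearization_diag (hab : a < b) :
    InjOn (fun φ => linearization k t φ φ) (Icc a b) := by
  refine injOn_linearization_of_isTransversal hk h0 h1 hN1 hN hab (p := id) (q := id)
    ordConnected_Icc ⟨a, left_mem_Icc.mpr hab.le, b, right_mem_Icc.mpr hab.le, hab.ne⟩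
    contDiffOn_id contDiffOn_id (fun u hu => hu) fun u hu => ?_
  rw [derivWithin_id _ _ (uniqueDiffOn_Icc hab u hu), mul_one]
  have := leafSlope_neg hk h0 h1 hN1 hN (x := (u, Circle.exp u)) ⟨hu, mem_univ _⟩
  exact (by linarith : leafSlope k t (u, Circle.exp u) < 1).ne'

end Transversals

/-! ### A criterion for measures of maximal entropy -/

section GibbsInequality

variable {S : Type*} [Fintype S]

/-- Gibbs' inequality, from log x ≤ x - 1; a subprobability q suffices, which is convenient for
coding. -/
theorem sum_negMulLog_le {P q : S → ℝ} (hP : ∀ s, 0 ≤ P s) (hP1 : ∑ s, P s = 1)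
    (hq : ∀ s, 0 < q s) (hq1 : ∑ s, q s ≤ 1) :
    ∑ s, Real.negMulLog (P s) ≤ ∑ s, P s * -Real.log (q s) := by
  have h : ∀ s, Real.negMulLog (P s) ≤ P s * -Real.log (q s) + (q s - P s) := fun s => by
    rcases (hP s).eq_or_lt with h0 | h0
    · rw [← h0]
      simpa using (hq s).le
    · have hl := Real.log_le_sub_one_of_pos (div_pos (hq s) h0)
      rw [Real.log_div (hq s).ne' h0.ne'] at hl
      have h2 := mul_le_mul_of_nonneg_left hl h0.le
      have h3 : P s * (q s / P s - 1) = q s - P s := by field_simp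
      rw [h3] at h2
      rw [Real.negMulLog]
      linarith
  calc _ ≤ ∑ s, (P s * -Real.log (q s) + (q s - P s)) := Finset.sum_le_sum fun s _ => h s
    _ ≤ _ := by
      rw [Finset.sum_add_distrib, Finset.sum_sub_distrib, hP1]
      linarith

theorem negMulLog_sum_le {P : S → ℝ} (hP : ∀ s, 0 ≤ P s) :
    Real.negMulLog (∑ s, P s) ≤ ∑ s, Real.negMulLog (P s) := by
  rw [Real.negMulLog, ← neg_mul_eq_neg_mul, Finset.sum_mul, ← Finset.sum_neg_distrib]
  refine Finset.sum_le_sum fun s _ => ?_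
  rw [Real.negMulLog, neg_mul]
  rcases (hP s).eq_or_lt with h0 | h0
  · simp [← h0]
  · have : Real.log (P s) ≤ Real.log (∑ s, P s) :=
      Real.log_le_log h0 (Finset.single_le_sum (fun s _ => hP s) (Finset.mem_univ s))
    have := mul_le_mul_of_nonneg_left this h0.le
    linarith

/-- The cross entropy with respect to the mean of `P` and the uniform distribution is smaller than
the maximal entropy, unless `P` is uniform. -/
theorem sum_mul_neg_log_lt {P : S → ℝ} {u : ℝ} (hu : 0 < u) (hP : ∀ s, 0 ≤ P s)
    (hP1 : ∑ s, P s = 1) (hu1 : ∑ _s : S, u = 1) {s₀ : S} (hs₀ : P s₀ ≠ u) :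
    ∑ s, P s * -Real.log ((P s + u) / 2) < -Real.log u := by
  -- This is log x ≥ 1 - 1/x at x = (P + u)/(2u). The linear terms sum to zero and the squares
  -- supply strictness.
  have key : ∀ s, (P s - u) / 2 + (P s - u) ^ 2 / (2 * (P s + u)) ≤
      P s * (Real.log ((P s + u) / 2) - Real.log u) := fun s => by
    have hPu : 0 < P s + u := add_pos_of_nonneg_of_pos (hP s) hu
    have hl := Real.one_sub_inv_le_log_of_pos (x := (P s + u) / 2 / u) (by positivity)
    rw [Real.log_div (by positivity) hu.ne'] at hl
    have h2 := mul_le_mul_of_nonneg_left hl (hP s)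
    refine le_trans (le_of_eq ?_) h2
    field_simp
    ring
  have hlt : ∑ s, (P s - u) / 2 < ∑ s, P s * (Real.log ((P s + u) / 2) - Real.log u) := by
    have hnn : ∀ s, 0 ≤ (P s - u) ^ 2 / (2 * (P s + u)) := fun s => by
      have := hP s
      positivity
    refine Finset.sum_lt_sum (fun s _ => (le_add_of_nonneg_right (hnn s)).trans (key s))
      ⟨s₀, Finset.mem_univ _, lt_of_lt_of_le ?_ (key s₀)⟩
    have h1 : 0 < (P s₀ - u) ^ 2 := by
      have := sub_ne_zero.mpr hs₀
      positivity
    have h2 : 0 < P s₀ + u := add_pos_of_nonneg_of_pos (hP s₀) hu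
    have : 0 < (P s₀ - u) ^ 2 / (2 * (P s₀ + u)) := by positivity
    linarith
  have h0 : ∑ s, (P s - u) / 2 = 0 := by
    rw [← Finset.sum_div, Finset.sum_sub_distrib, hP1, hu1]
    norm_num
  rw [h0] at hlt
  simp only [mul_sub, Finset.sum_sub_distrib, ← Finset.sum_mul, hP1, one_mul] at hlt
  simp only [mul_neg, Finset.sum_neg_distrib]
  linarith

end GibbsInequality

/-! ### Entropy bounds by coding -/

section MaximalEntropy

variable {Ω : Type} [MeasurableSpace Ω]

/-- The first `n` labels of the orbit of a point. -/
def word {m : ℕ} (f : Ω → Ω) (ξ : Ω → Fin m) (n : ℕ) (x : Ω) : Fin n → Fin m :=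
  fun i => ξ (f^[(i : ℕ)] x)

theorem measurable_word {m : ℕ} {f : Ω → Ω} {ξ : Ω → Fin m} (hf : Measurable f)
    (hξ : Measurable ξ) (n : ℕ) : Measurable (word f ξ n) :=
  measurable_pi_iff.mpr fun i => hξ.comp (hf.iterate i)

theorem blockEntropy_eq {m : ℕ} (f : Ω → Ω) (ρ : Measure Ω) (ξ : Ω → Fin m) (n : ℕ) :
    blockEntropy f ρ ξ n = ∑ s, Real.negMulLog (ρ.real (word f ξ n ⁻¹' {s})) := by
  refine Finset.sum_congr rfl fun s _ => ?_
  congr 2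
  ext x
  simp [word, funext_iff]

theorem sum_measureReal_preimage_singleton {S : Type} [Fintype S] [MeasurableSpace S]
    [MeasurableSingletonClass S] {ρ : Measure Ω} [IsProbabilityMeasure ρ] {Y : Ω → S}
    (hY : Measurable Y) (A : Set Ω) (hA : MeasurableSet A) :
    ∑ s, ρ.real (A ∩ Y ⁻¹' {s}) = ρ.real A := by
  classical
  rw [← measureReal_biUnion_finset (s := Finset.univ) (f := fun s => A ∩ Y ⁻¹' {s})]
  · congr 1
    ext x
    simp
  · intro s _ s' _ hne
    refine Set.disjoint_left.mpr fun x hx hx' => hne ?_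
    exact (mem_singleton_iff.mp hx.2).symm.trans hx'.2
  · exact fun s _ => hA.inter (hY (measurableSet_singleton s))

theorem integral_comp_eq_sum {S : Type} [Fintype S] [MeasurableSpace S]
    [MeasurableSingletonClass S] {ρ : Measure Ω} [IsProbabilityMeasure ρ] {Y : Ω → S}
    (hY : Measurable Y) (g : S → ℝ) :
    ∫ x, g (Y x) ∂ρ = ∑ s, ρ.real (Y ⁻¹' {s}) * g s := by
  have : IsProbabilityMeasure (ρ.map Y) := Measure.isProbabilityMeasure_map hY.aemeasurable
  have hg : Measurable g := measurable_of_finite g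
  rw [← integral_map (f := g) hY.aemeasurable hg.aestronglyMeasurable,
    integral_fintype .of_finite]
  refine Finset.sum_congr rfl fun s _ => ?_
  rw [smul_eq_mul, map_measureReal_apply hY (measurableSet_singleton s)]

theorem sum_prod_pi {ι R : Type*} [Fintype ι] [DecidableEq ι] [CommSemiring R] {α : Type*}
    [Fintype α] (g : ι → α → R) : ∑ s : ι → α, ∏ i, g i (s i) = ∏ i, ∑ a, g i a := by
  rw [Finset.prod_univ_sum, Fintype.piFinset_univ]

/-- An upper bound for the entropy of `n`-blocks by coding the labels `ξ` through the labels `ζ`. -/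
theorem blockEntropy_le {k m M N n : ℕ} (hM : 0 < M) {f : Ω → Ω} {ρ : Measure Ω}
    [IsProbabilityMeasure ρ] (hρ : MeasurePreserving f ρ ρ) {ζ : Ω → Fin k} (hζ : Measurable ζ)
    {ξ : Ω → Fin m} (hξ : Measurable ξ) {r : (Fin M → Fin k) → ℝ} (hr : ∀ s, 0 < r s)
    (hr1 : ∑ s, r s ≤ 1) {κ : (Fin N → Fin k) → Fin m → ℝ} (hκ : ∀ z x, 0 < κ z x)
    (hκ1 : ∀ z, ∑ x, κ z x ≤ 1) {R : ℕ} (hR : n + N ≤ M * R) :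
    blockEntropy f ρ ξ n ≤ R * ∫ x, -Real.log (r (word f ζ M x)) ∂ρ +
      n * ∫ x, -Real.log (κ (word f ζ N x) (ξ x)) ∂ρ := by
  have hf := hρ.measurable
  set Y : Ω → (Fin n → Fin m) × (Fin R → Fin M → Fin k) := fun x =>
    (word f ξ n x, fun j => word f ζ M (f^[M * j] x)) with hY
  have hYm : Measurable Y := (measurable_word hf hξ n).prodMk
    (measurable_pi_iff.mpr fun j => (measurable_word hf hζ M).comp (hf.iterate _))
  have hlt : ∀ (i : Fin n) (l : Fin N), (i + l : ℕ) / M < R := fun i l => by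
    rw [Nat.div_lt_iff_lt_mul hM, mul_comm]
    omega
  -- The window of N labels starting at time i is read off the R consecutive blocks: time i + l is
  -- position (i + l) mod M of block (i + l)/M.
  set win : (Fin R → Fin M → Fin k) → Fin n → Fin N → Fin k := fun z i l =>
    z ⟨(i + l : ℕ) / M, hlt i l⟩ ⟨(i + l : ℕ) % M, Nat.mod_lt _ hM⟩ with hwin
  have hwinY : ∀ x i, win (Y x).2 i = word f ζ N (f^[(i : ℕ)] x) := fun x i => by
    ext l
    simp only [hwin, hY, word]
    rw [← Function.iterate_add_apply, ← Function.iterate_add_apply, add_comm, Nat.div_add_mod,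
      add_comm]
  -- The code treats the blocks as independent with weights r and guesses each label ξ from its
  -- window with conditional weights κ, so -log q is a sum of stationary terms.
  set q : (Fin n → Fin m) × (Fin R → Fin M → Fin k) → ℝ := fun s =>
    (∏ j, r (s.2 j)) * ∏ i, κ (win s.2 i) (s.1 i) with hq
  have hq0 : ∀ s, 0 < q s := fun s =>
    mul_pos (Finset.prod_pos fun j _ => hr _) (Finset.prod_pos fun i _ => hκ _ _)
  have hq1 : ∑ s, q s ≤ 1 := by
    rw [Fintype.sum_prod_type_right]
    have h1 : ∀ z : Fin R → Fin M → Fin k, ∑ x, q (x, z) ≤ ∏ j, r (z j) := fun z => by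
      simp only [hq]
      rw [← Finset.mul_sum, sum_prod_pi fun i x => κ (win z i) x]
      refine mul_le_of_le_one_right (Finset.prod_nonneg fun j _ => (hr _).le) ?_
      exact Finset.prod_le_one (fun i _ => Finset.sum_nonneg fun x _ => (hκ _ _).le)
        fun i _ => hκ1 _
    refine (Finset.sum_le_sum fun z _ => h1 z).trans ?_
    rw [sum_prod_pi fun _ z => r z]
    exact Finset.prod_le_one (fun i _ => Finset.sum_nonneg fun x _ => (hr _).le) fun i _ => hr1
  have hP1 : ∑ s, ρ.real (Y ⁻¹' {s}) = 1 := by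
    have := sum_measureReal_preimage_singleton (ρ := ρ) hYm univ MeasurableSet.univ
    simpa using this
  have hG := sum_negMulLog_le (fun s => measureReal_nonneg) hP1 hq0 hq1
  rw [← integral_comp_eq_sum hYm fun s => -Real.log (q s)] at hG
  have hmarg : blockEntropy f ρ ξ n ≤ ∑ s, Real.negMulLog (ρ.real (Y ⁻¹' {s})) := by
    rw [blockEntropy_eq, Fintype.sum_prod_type]
    refine Finset.sum_le_sum fun s _ => ?_
    have h2 := sum_measureReal_preimage_singleton (ρ := ρ) (measurable_snd.comp hYm)
      (word f ξ n ⁻¹' {s}) (measurable_word hf hξ n (measurableSet_singleton s))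
    rw [← h2]
    refine (negMulLog_sum_le fun _ => measureReal_nonneg).trans (le_of_eq ?_)
    refine Finset.sum_congr rfl fun z _ => ?_
    congr 2
    ext x
    simp [hY, Prod.ext_iff]
  refine (hmarg.trans hG).trans (le_of_eq ?_)
  have hlog : ∀ x, -Real.log (q (Y x)) = ∑ j : Fin R, -Real.log (r (word f ζ M (f^[M * j] x))) +
      ∑ i : Fin n, -Real.log (κ (word f ζ N (f^[(i : ℕ)] x)) (ξ (f^[(i : ℕ)] x))) := fun x => by
    simp only [hq, hwinY]
    rw [Real.log_mul (Finset.prod_ne_zero_iff.mpr fun j _ => (hr _).ne')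
      (Finset.prod_ne_zero_iff.mpr fun j _ => (hκ _ _).ne'), Real.log_prod fun j _ => (hr _).ne',
      Real.log_prod fun j _ => (hκ _ _).ne', neg_add, Finset.sum_neg_distrib,
      Finset.sum_neg_distrib]
    rfl
  have hstat : ∀ {S : Type} [Fintype S] [MeasurableSpace S] [MeasurableSingletonClass S]
      {W : Ω → S} (_ : Measurable W) (g : S → ℝ) (l : ℕ),
      Integrable (fun x => g (W (f^[l] x))) ρ ∧
        ∫ x, g (W (f^[l] x)) ∂ρ = ∫ x, g (W x) ∂ρ := by
    intro S _ _ _ W hW g l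
    have hg : Measurable g := measurable_of_finite g
    have hl := hρ.iterate l
    constructor
    · have : IsProbabilityMeasure (ρ.map (W ∘ f^[l])) :=
        Measure.isProbabilityMeasure_map (hW.comp hl.measurable).aemeasurable
      have hi : Integrable g (ρ.map (W ∘ f^[l])) := .of_finite
      exact hi.comp_measurable (hW.comp hl.measurable)
    · conv_rhs => rw [← hl.map_eq]
      exact (integral_map (f := fun x => g (W x)) hl.measurable.aemeasurable
        (hg.comp hW).aestronglyMeasurable).symm
  have hW2 : Measurable fun x => (word f ζ N x, ξ x) := (measurable_word hf hζ N).prodMk hξ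
  have s1 := fun l => hstat (measurable_word hf hζ M) (fun s => -Real.log (r s)) l
  have s2 := fun l => hstat hW2 (fun s => -Real.log (κ s.1 s.2)) l
  simp only [hlog]
  rw [integral_add (integrable_finsetSum _ fun j _ => (s1 _).1)
    (integrable_finsetSum _ fun i _ => (s2 _).1), integral_finsetSum _ fun j _ => (s1 _).1,
    integral_finsetSum _ fun i _ => (s2 _).1]
  simp only [(s1 _).2, (s2 _).2, Finset.sum_const, Finset.card_univ, Fintype.card_fin,
    nsmul_eq_mul]

/-- The sets determined by finitely many labels. -/
def cylinderSets {k : ℕ} (f : Ω → Ω) (ζ : Ω → Fin k) : Set (Set Ω) :=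
  {E | ∃ (N : ℕ) (S : Set (Fin N → Fin k)), E = word f ζ N ⁻¹' S}

omit [MeasurableSpace Ω] in
theorem exists_common_length {k : ℕ} (f : Ω → Ω) (ζ : Ω → Fin k) {N N' : ℕ} (h : N ≤ N')
    (S : Set (Fin N → Fin k)) :
    ∃ S' : Set (Fin N' → Fin k), word f ζ N ⁻¹' S = word f ζ N' ⁻¹' S' :=
  ⟨{z | (fun i => z (Fin.castLE h i)) ∈ S}, rfl⟩

omit [MeasurableSpace Ω] in
theorem isSetAlgebra_cylinderSets {k : ℕ} (f : Ω → Ω) (ζ : Ω → Fin k) :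
    IsSetAlgebra (cylinderSets f ζ) where
  empty_mem := ⟨0, ∅, by simp⟩
  compl_mem := by
    rintro _ ⟨N, S, rfl⟩
    exact ⟨N, Sᶜ, rfl⟩
  union_mem := by
    rintro _ _ ⟨N, S, rfl⟩ ⟨N', S', rfl⟩
    obtain ⟨T, hT⟩ := exists_common_length f ζ (le_max_left N N') S
    obtain ⟨T', hT'⟩ := exists_common_length f ζ (le_max_right N N') S'
    exact ⟨max N N', T ∪ T', by rw [hT, hT', preimage_union]⟩

omit [MeasurableSpace Ω] in
theorem isPiSystem_cylinderSets {k : ℕ} (f : Ω → Ω) (ζ : Ω → Fin k) :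
    IsPiSystem (cylinderSets f ζ) := by
  rintro _ ⟨N, S, rfl⟩ _ ⟨N', S', rfl⟩ -
  obtain ⟨T, hT⟩ := exists_common_length f ζ (le_max_left N N') S
  obtain ⟨T', hT'⟩ := exists_common_length f ζ (le_max_right N N') S'
  exact ⟨max N N', T ∩ T', by rw [hT, hT', preimage_inter]⟩

/-- Approximate each set {ξ = a} by a cylinder up to ε/m. Outside the symmetric differences exactly
one cylinder contains the point, and it names the label; elsewhere a default label is returned. -/
theorem exists_approx_label {k m : ℕ} {f : Ω → Ω} {ζ : Ω → Fin k}
    (hgen : ‹MeasurableSpace Ω› = MeasurableSpace.generateFrom (cylinderSets f ζ))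
    (ρ : Measure Ω) [IsProbabilityMeasure ρ] {ξ : Ω → Fin m} (hξ : Measurable ξ) {ε : ℝ}
    (hε : 0 < ε) : ∃ (N : ℕ) (ψ : (Fin N → Fin k) → Fin m),
      ρ.real {x | ξ x ≠ ψ (word f ζ N x)} ≤ ε := by
  classical
  have hne : Nonempty Ω := nonempty_of_isProbabilityMeasure ρ
  obtain ⟨x₀⟩ := hne
  have hm : 0 < m := (ξ x₀).pos
  have hm' : (0 : ℝ) < m := by exact_mod_cast hm
  have hd := Measure.MeasureDense.of_generateFrom_isSetAlgebra_finite ρ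
    (isSetAlgebra_cylinderSets f ζ) hgen
  have happ : ∀ a : Fin m, ∃ (N : ℕ) (S : Set (Fin N → Fin k)),
      ρ (symmDiff (ξ ⁻¹' {a}) (word f ζ N ⁻¹' S)) < ENNReal.ofReal (ε / m) := fun a => by
    obtain ⟨_, ⟨N, S, rfl⟩, h⟩ := hd.approx (ξ ⁻¹' {a}) (hξ (measurableSet_singleton a))
      (measure_ne_top _ _) (ε / m) (by positivity)
    exact ⟨N, S, h⟩
  choose N S hS using happ
  have hN : ∀ a, N a ≤ Finset.univ.sup N := fun a => Finset.le_sup (Finset.mem_univ a)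
  choose T hT using fun a => exists_common_length f ζ (hN a) (S a)
  refine ⟨Finset.univ.sup N, fun z => if h : ∃ a, z ∈ T a then h.choose else ⟨0, hm⟩, ?_⟩
  have hsub : {x | ξ x ≠ (fun z => if h : ∃ a, z ∈ T a then h.choose else (⟨0, hm⟩ : Fin m))
      (word f ζ (Finset.univ.sup N) x)} ⊆ ⋃ a, symmDiff (ξ ⁻¹' {a}) (word f ζ (N a) ⁻¹' S a) := by
    intro x hx
    by_contra hcon
    simp only [mem_iUnion, not_exists] at hcon
    have hiff : ∀ a, ξ x = a ↔ word f ζ (Finset.univ.sup N) x ∈ T a := fun a => by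
      have h := hcon a
      rw [hT a, mem_symmDiff] at h
      simp only [mem_preimage, mem_singleton_iff] at h
      tauto
    apply hx
    have hex : ∃ a, word f ζ (Finset.univ.sup N) x ∈ T a := ⟨ξ x, (hiff _).mp rfl⟩
    simp only [dif_pos hex]
    exact (hiff _).mpr hex.choose_spec
  refine ENNReal.toReal_le_of_le_ofReal hε.le ((measure_mono hsub).trans
    ((measure_iUnion_le _).trans ?_))
  rw [tsum_fintype]
  refine (Finset.sum_le_sum fun a _ => (hS a).le).trans (le_of_eq ?_)
  rw [Finset.sum_const, Finset.card_univ, Fintype.card_fin, nsmul_eq_mul,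
    ← ENNReal.ofReal_natCast, ← ENNReal.ofReal_mul hm'.le, mul_div_cancel₀ _ hm'.ne']

/-- The entropy of a process is bounded by any rate at which the generator can be coded. -/
theorem metricEntropy_le {k M : ℕ} (hM : 0 < M) {f : Ω → Ω} {ρ : Measure Ω}
    [IsProbabilityMeasure ρ] (hρ : MeasurePreserving f ρ ρ) {ζ : Ω → Fin k} (hζ : Measurable ζ)
    (hgen : ‹MeasurableSpace Ω› = MeasurableSpace.generateFrom (cylinderSets f ζ))
    {r : (Fin M → Fin k) → ℝ} (hr : ∀ s, 0 < r s) (hr1 : ∑ s, r s ≤ 1) {δ : ℝ} (hδ : 0 < δ) :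
    metricEntropy f ρ ≤
      ENNReal.ofReal ((∫ x, -Real.log (r (word f ζ M x)) ∂ρ) / M + δ) := by
  have hf := hρ.measurable
  set c := ∫ x, -Real.log (r (word f ζ M x)) ∂ρ with hc
  have hc0 : 0 ≤ c := integral_nonneg fun x => by
    have : r (word f ζ M x) ≤ 1 :=
      (Finset.single_le_sum (fun s _ => (hr s).le) (Finset.mem_univ _)).trans hr1
    exact neg_nonneg.mpr (Real.log_nonpos (hr _).le this)
  have hM' : (0 : ℝ) < M := by exact_mod_cast hM
  refine iSup_le fun m => iSup_le fun ξ => iSup_le fun hξ => ?_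
  obtain ⟨x₀⟩ : Nonempty Ω := nonempty_of_isProbabilityMeasure ρ
  have hm1 : (1 : ℝ) ≤ m := by exact_mod_cast (ξ x₀).pos
  -- A correct guess costs -log(1 - ε) = δ/2. A wrong one costs A, but wrong guesses have
  -- probability at most (δ/2)/(A + 1), so the mean cost is at most δ.
  set ε := 1 - Real.exp (-(δ / 2)) with hε
  have hε0 : 0 < ε := by
    rw [hε, sub_pos, Real.exp_lt_one_iff]
    linarith
  have hε1 : ε < 1 := by
    have := Real.exp_pos (-(δ / 2))
    linarith
  have hlogε : -Real.log (1 - ε) = δ / 2 := by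
    rw [hε, sub_sub_cancel, Real.log_exp, neg_neg]
  set A := -Real.log (ε / m) with hA
  have hA0 : 0 ≤ A := by
    rw [hA, neg_nonneg]
    exact Real.log_nonpos (by positivity) ((div_le_one (by linarith)).mpr (by linarith))
  obtain ⟨N, ψ, hψ⟩ := exists_approx_label hgen ρ hξ (ε := δ / 2 / (A + 1)) (by positivity)
  set κ : (Fin N → Fin k) → Fin m → ℝ := fun z x => if x = ψ z then 1 - ε else ε / m with hκ
  have hκ0 : ∀ z x, 0 < κ z x := fun z x => by
    simp only [hκ]
    split_ifs
    · linarith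
    · positivity
  have hκ1 : ∀ z, ∑ x, κ z x ≤ 1 := fun z => by
    have h : ∀ x, κ z x ≤ (if x = ψ z then 1 - ε else 0) + ε / m := fun x => by
      simp only [hκ]
      have : 0 ≤ ε / m := by positivity
      split_ifs <;> linarith
    refine (Finset.sum_le_sum fun x _ => h x).trans (le_of_eq ?_)
    rw [Finset.sum_add_distrib, Finset.sum_ite_eq' Finset.univ (ψ z) fun _ => 1 - ε]
    simp only [Finset.mem_univ, if_true, Finset.sum_const, Finset.card_univ, Fintype.card_fin,
      nsmul_eq_mul]
    field_simp
    ring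
  have hbad : MeasurableSet {x | ξ x ≠ ψ (word f ζ N x)} :=
    (measurableSet_eq_fun hξ ((measurable_of_finite ψ).comp (measurable_word hf hζ N))).compl
  have hL : ∫ x, -Real.log (κ (word f ζ N x) (ξ x)) ∂ρ ≤ δ := by
    have hle : ∀ x, -Real.log (κ (word f ζ N x) (ξ x)) ≤
        δ / 2 + ({x | ξ x ≠ ψ (word f ζ N x)}.indicator (fun _ => A)) x := fun x => by
      by_cases hx : ξ x = ψ (word f ζ N x)
      · simp [hκ, hx, hlogε]
      · simp only [hκ, if_neg hx]
        rw [indicator_of_mem (show x ∈ {x | ξ x ≠ ψ (word f ζ N x)} from hx)]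
        linarith
    have hi : Integrable ({x | ξ x ≠ ψ (word f ζ N x)}.indicator (fun _ => A)) ρ :=
      (integrable_const A).indicator hbad
    refine (integral_mono_of_nonneg (ae_of_all _ fun x => ?_)
      ((integrable_const (δ / 2)).add hi) (ae_of_all _ hle)).trans ?_
    · refine neg_nonneg.mpr (Real.log_nonpos (hκ0 _ _).le ?_)
      exact (Finset.single_le_sum (fun s _ => (hκ0 (word f ζ N x) s).le)
        (Finset.mem_univ _)).trans (hκ1 _)
    · rw [integral_add' (integrable_const _) hi, integral_indicator_const _ hbad, integral_const,
        smul_eq_mul, smul_eq_mul, probReal_univ, one_mul]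
      have h2 : δ / 2 / (A + 1) * A ≤ δ / 2 := by
        rw [div_mul_eq_mul_div, div_le_iff₀ (by linarith)]
        nlinarith
      have h3 := mul_le_mul_of_nonneg_right hψ hA0
      linarith
  have hblock : ∀ n : ℕ, 0 < n → blockEntropy f ρ ξ n / n ≤
      c / M + δ + c * (N / M + 1) / n := fun n hn => by
    have hn' : (0 : ℝ) < n := by exact_mod_cast hn
    -- The number of blocks exceeds n/M by at most N/M + 1, an overhead that vanishes after division
    -- by n.
    have hR : n + N ≤ M * ((n + N) / M + 1) := (Nat.lt_mul_div_succ _ hM).le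
    have h := blockEntropy_le hM hρ hζ hξ hr hr1 hκ0 hκ1 hR
    have hRle : (((n + N) / M + 1 : ℕ) : ℝ) ≤ (n + N) / M + 1 := by
      push_cast
      have := Nat.cast_div_le (α := ℝ) (m := n + N) (n := M)
      push_cast at this
      linarith
    have h2 : blockEntropy f ρ ξ n ≤ ((n + N) / M + 1) * c + n * δ := by
      refine h.trans ?_
      gcongr
    rw [div_le_iff₀ hn']
    refine h2.trans (le_of_eq ?_)
    field_simp
    ring
  have hlim : Tendsto (fun n : ℕ => ENNReal.ofReal (c / M + δ + c * (N / M + 1) / n)) atTop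
      (𝓝 (ENNReal.ofReal (c / M + δ))) := by
    have h := (tendsto_const_div_atTop_nhds_zero_nat (c * (N / M + 1))).const_add (c / M + δ)
    rw [add_zero] at h
    exact (ENNReal.continuous_ofReal.tendsto _).comp h
  rw [← hlim.limsup_eq]
  refine limsup_le_limsup ?_
  filter_upwards [eventually_gt_atTop 0] with n hn
  exact ENNReal.ofReal_le_ofReal (hblock n hn)

theorem ext_of_words {k : ℕ} {f : Ω → Ω} {ζ : Ω → Fin k}
    (hgen : ‹MeasurableSpace Ω› = MeasurableSpace.generateFrom (cylinderSets f ζ))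
    (hf : Measurable f) (hζ : Measurable ζ) {ρ η : Measure Ω} [IsProbabilityMeasure ρ]
    [IsProbabilityMeasure η]
    (h : ∀ n (s : Fin n → Fin k), ρ.real (word f ζ n ⁻¹' {s}) = η.real (word f ζ n ⁻¹' {s})) :
    ρ = η := by
  refine ext_of_generate_finite _ hgen (isPiSystem_cylinderSets f ζ) ?_ (by simp)
  rintro _ ⟨n, S, rfl⟩
  have hw := measurable_word hf hζ n
  have hmap : ρ.map (word f ζ n) = η.map (word f ζ n) := by
    have h1 : IsProbabilityMeasure (ρ.map (word f ζ n)) :=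
      Measure.isProbabilityMeasure_map hw.aemeasurable
    have h2 : IsProbabilityMeasure (η.map (word f ζ n)) :=
      Measure.isProbabilityMeasure_map hw.aemeasurable
    refine ext_iff_measureReal_singleton.mpr fun s => ?_
    rw [map_measureReal_apply hw (measurableSet_singleton s),
      map_measureReal_apply hw (measurableSet_singleton s), h]
  rw [← Measure.map_apply hw (Set.toFinite S).measurableSet, hmap,
    Measure.map_apply hw (Set.toFinite S).measurableSet]

/-- A measure for which all words of length `n` of a generator with `k` labels have probability
`k ^ (-n)` is the measure of maximal entropy. -/
theorem isMME_of_uniform {k : ℕ} (hk : 0 < k) {f : Ω → Ω} {η : Measure Ω}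
    [IsProbabilityMeasure η] (hη : MeasurePreserving f η η) {ζ : Ω → Fin k} (hζ : Measurable ζ)
    (hgen : ‹MeasurableSpace Ω› = MeasurableSpace.generateFrom (cylinderSets f ζ))
    (hu : ∀ n (s : Fin n → Fin k), η.real (word f ζ n ⁻¹' {s}) = ((k : ℝ) ^ n)⁻¹) :
    IsMME f η := by
  have hf := hη.measurable
  have hk' : (0 : ℝ) < k := by exact_mod_cast hk
  refine ⟨inferInstance, hη, fun ρ hρp hρ hne => ?_⟩
  -- The generator itself has block entropy exactly n log k under η.
  have hlow : ENNReal.ofReal (Real.log k) ≤ metricEntropy f η := by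
    refine le_trans ?_ (le_iSup_of_le k (le_iSup_of_le ζ (le_iSup_of_le hζ le_rfl)))
    have hb : ∀ n : ℕ, blockEntropy f η ζ n = n * Real.log k := fun n => by
      rw [blockEntropy_eq]
      simp only [hu, Real.negMulLog, Finset.sum_const, Finset.card_univ, Fintype.card_fun,
        Fintype.card_fin, nsmul_eq_mul, Real.log_inv, Real.log_pow]
      push_cast
      field_simp
    have hlim : Tendsto (fun n : ℕ => ENNReal.ofReal (blockEntropy f η ζ n / n)) atTop
        (𝓝 (ENNReal.ofReal (Real.log k))) := by
      refine tendsto_const_nhds.congr' ?_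
      filter_upwards [eventually_gt_atTop 0] with n hn
      have : (n : ℝ) ≠ 0 := by exact_mod_cast hn.ne'
      rw [hb, mul_div_cancel_left₀ _ this]
    rw [hlim.limsup_eq]
  obtain ⟨M, s₀, hs₀⟩ : ∃ M, ∃ s : Fin M → Fin k,
      ρ.real (word f ζ M ⁻¹' {s}) ≠ ((k : ℝ) ^ M)⁻¹ := by
    by_contra! hcon
    exact hne (ext_of_words hgen hf hζ fun n s => by rw [hcon, hu])
  have hM : 0 < M := by
    rcases Nat.eq_zero_or_pos M with rfl | h
    · exfalso
      apply hs₀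
      have : word f ζ 0 ⁻¹' {s₀} = univ := by
        ext x
        simp [eq_iff_true_of_subsingleton]
      rw [this]
      simp
    · exact h
  have hM' : (0 : ℝ) < M := by exact_mod_cast hM
  set P : (Fin M → Fin k) → ℝ := fun s => ρ.real (word f ζ M ⁻¹' {s}) with hP
  have hw := measurable_word hf hζ M
  have hP1 : ∑ s, P s = 1 := by
    have := sum_measureReal_preimage_singleton (ρ := ρ) hw univ MeasurableSet.univ
    simpa using this
  have hu1 : ∑ _s : Fin M → Fin k, ((k : ℝ) ^ M)⁻¹ = 1 := by
    simp only [Finset.sum_const, Finset.card_univ, Fintype.card_fun, Fintype.card_fin,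
      nsmul_eq_mul]
    push_cast
    field_simp
  have hu0 : 0 < ((k : ℝ) ^ M)⁻¹ := by positivity
  have hlt := sum_mul_neg_log_lt hu0 (fun s => measureReal_nonneg) hP1 hu1 hs₀
  rw [← integral_comp_eq_sum hw fun s => -Real.log ((P s + ((k : ℝ) ^ M)⁻¹) / 2), Real.log_inv,
    neg_neg, Real.log_pow] at hlt
  set c := ∫ x, -Real.log ((P (word f ζ M x) + ((k : ℝ) ^ M)⁻¹) / 2) ∂ρ with hc
  have hcM : c / M < Real.log k := by
    rw [div_lt_iff₀ hM']
    linarith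
  have hr : ∀ s, 0 < (P s + ((k : ℝ) ^ M)⁻¹) / 2 := fun s => by
    have : 0 ≤ P s := measureReal_nonneg
    positivity
  have hr1 : ∑ s, (P s + ((k : ℝ) ^ M)⁻¹) / 2 ≤ 1 := by
    rw [← Finset.sum_div, Finset.sum_add_distrib, hP1, hu1]
    norm_num
  -- Blocks of length M are coded by the average of their ρ-law and the uniform law. As the two
  -- differ, this costs strictly less than M log k, and δ is half of the resulting gap in the rate.
  have hup := metricEntropy_le hM hρ hζ hgen hr hr1 (δ := (Real.log k - c / M) / 2) (by linarith)
  rw [← hc] at hup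
  refine hup.trans_lt (lt_of_lt_of_le ?_ hlow)
  have hc0 : 0 ≤ c := integral_nonneg fun x => by
    have : (P (word f ζ M x) + ((k : ℝ) ^ M)⁻¹) / 2 ≤ 1 :=
      (Finset.single_le_sum (fun s _ => (hr s).le) (Finset.mem_univ _)).trans hr1
    exact neg_nonneg.mpr (Real.log_nonpos (hr _).le this)
  have : 0 ≤ c / M := by positivity
  exact (ENNReal.ofReal_lt_ofReal_iff (by linarith)).mpr (by linarith)

end MaximalEntropy

/-! ### The vertical fibres -/

section Digits

variable {Ω : Type} [MeasurableSpace Ω] {k : ℕ} {f : Ω → Ω} {X : Ω → ℝ}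

omit [MeasurableSpace Ω] in
theorem apply_iterate_eq_fract (hX : ∀ w, X w ∈ Ico (0 : ℝ) 1)
    (hXf : ∀ w, X (f w) = Int.fract (k * X w)) (n : ℕ) (w : Ω) :
    X (f^[n] w) = Int.fract (k ^ n * X w) := by
  induction n with
  | zero => simp [Int.fract_eq_self.mpr (hX w)]
  | succ n ih =>
    rw [Function.iterate_succ_apply', hXf, ih, Int.fract_eq_fract]
    refine ⟨-(k * ⌊(k : ℝ) ^ n * X w⌋), ?_⟩
    rw [Int.fract]
    push_cast
    ring

/-- The first digit in base `k` of the coordinate `X`. -/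
def firstDigit (hX : ∀ w, X w ∈ Ico (0 : ℝ) 1) (hk : 0 < k) (w : Ω) : Fin k :=
  ⟨⌊k * X w⌋₊, by
    have hk' : (0 : ℝ) < k := by exact_mod_cast hk
    have := (hX w).2
    refine (Nat.floor_lt (mul_nonneg hk'.le (hX w).1)).mpr ?_
    nlinarith⟩

omit [MeasurableSpace Ω] in
theorem firstDigit_eq_iff (hX : ∀ w, X w ∈ Ico (0 : ℝ) 1) (hk : 0 < k) (w : Ω) (d : Fin k) :
    firstDigit hX hk w = d ↔ (d : ℝ) ≤ k * X w ∧ k * X w < d + 1 := by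
  rw [firstDigit, Fin.ext_iff]
  exact Nat.floor_eq_iff (mul_nonneg (Nat.cast_nonneg k) (hX w).1)

theorem measurable_firstDigit (hX : ∀ w, X w ∈ Ico (0 : ℝ) 1) (hk : 0 < k) (hXm : Measurable X) :
    Measurable (firstDigit hX hk) := by
  refine measurable_to_countable' fun d => ?_
  have : firstDigit hX hk ⁻¹' {d} = {w | (d : ℝ) ≤ k * X w} ∩ {w | k * X w < d + 1} := by
    ext w
    exact firstDigit_eq_iff hX hk w d
  rw [this]
  exact (measurableSet_le measurable_const (hXm.const_mul _)).inter
    (measurableSet_lt (hXm.const_mul _) measurable_const)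

omit [MeasurableSpace Ω] in
-- The word is the base-k expansion of j = ⌊k^n X⌋; appending a digit d replaces j by kj + d.
theorem exists_word_eq_iff (hX : ∀ w, X w ∈ Ico (0 : ℝ) 1) (hk : 0 < k)
    (hXf : ∀ w, X (f w) = Int.fract (k * X w)) (n : ℕ) (s : Fin n → Fin k) :
    ∃ j : ℕ, j < k ^ n ∧ ∀ w, word f (firstDigit hX hk) n w = s ↔
      (j : ℝ) ≤ k ^ n * X w ∧ k ^ n * X w < j + 1 := by
  induction n with
  | zero =>
    refine ⟨0, by simp, fun w => ?_⟩
    simp only [pow_zero, one_mul, Nat.cast_zero, zero_add, (hX w).1, (hX w).2, and_self, iff_true]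
    exact Subsingleton.elim _ _
  | succ n ih =>
    obtain ⟨j, hj, h⟩ := ih (fun i => s i.castSucc)
    have hd := (s (Fin.last n)).isLt
    refine ⟨k * j + s (Fin.last n), ?_, fun w => ?_⟩
    · rw [pow_succ']
      calc k * j + (s (Fin.last n) : ℕ) < k * j + k := by omega
        _ = k * (j + 1) := by ring
        _ ≤ k * k ^ n := Nat.mul_le_mul_left _ hj
    · have hsplit : word f (firstDigit hX hk) (n + 1) w = s ↔
          word f (firstDigit hX hk) n w = (fun i => s i.castSucc) ∧
            firstDigit hX hk (f^[n] w) = s (Fin.last n) := by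
        constructor
        · rintro rfl
          exact ⟨rfl, rfl⟩
        · rintro ⟨h1, h2⟩
          funext i
          refine Fin.lastCases ?_ (fun i => ?_) i
          · exact h2
          · exact congr_fun h1 i
      rw [hsplit, h, firstDigit_eq_iff, apply_iterate_eq_fract hX hXf]
      have hk' : (0 : ℝ) < k := by exact_mod_cast hk
      have hd' : ((s (Fin.last n) : ℕ) : ℝ) + 1 ≤ k := by exact_mod_cast hd
      have hd0 : (0 : ℝ) ≤ ((s (Fin.last n) : ℕ) : ℝ) := Nat.cast_nonneg _
      set y := (k : ℝ) ^ n * X w with hy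
      have hy' : (k : ℝ) ^ (n + 1) * X w = k * y := by rw [hy]; ring
      rw [hy']
      push_cast
      set d := ((s (Fin.last n) : ℕ) : ℝ)
      constructor
      · rintro ⟨⟨h1, h2⟩, h3, h4⟩
        have hfl : ⌊y⌋ = j := Int.floor_eq_iff.mpr ⟨by exact_mod_cast h1, by exact_mod_cast h2⟩
        rw [Int.fract, hfl] at h3 h4
        push_cast at h3 h4
        constructor <;> linarith
      · rintro ⟨h1, h2⟩
        have h3 : (j : ℝ) ≤ y := by
          by_contra hc
          nlinarith [not_le.mp hc]
        have h4 : y < j + 1 := by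
          by_contra hc
          nlinarith [not_lt.mp hc]
        have hfl : ⌊y⌋ = j := Int.floor_eq_iff.mpr ⟨by exact_mod_cast h3, by exact_mod_cast h4⟩
        refine ⟨⟨h3, h4⟩, ?_⟩
        rw [Int.fract, hfl]
        push_cast
        constructor <;> linarith

/-- Words of length n confine X to intervals of length k^(-n), so each {X < r} is a countable union
of cylinders. The measurable left inverse E of X transfers this to all measurable sets. -/
theorem generateFrom_cylinderSets_firstDigit (hk : 2 ≤ k) (hX : ∀ w, X w ∈ Ico (0 : ℝ) 1)
    (hXf : ∀ w, X (f w) = Int.fract (k * X w)) (hf : Measurable f) (hXm : Measurable X)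
    {E : ℝ → Ω} (hE : Measurable E) (hEX : ∀ w, E (X w) = w) :
    ‹MeasurableSpace Ω› =
      MeasurableSpace.generateFrom (cylinderSets f (firstDigit hX (by omega : 0 < k))) := by
  have hk0 : 0 < k := by omega
  have hk' : (1 : ℝ) < k := by exact_mod_cast hk
  apply le_antisymm
  · have hXg : Measurable[MeasurableSpace.generateFrom (cylinderSets f (firstDigit hX hk0))] X := by
      refine @measurable_of_Iio ℝ Ω _ _ _ (_) _ _ _ X fun r => ?_
      have : X ⁻¹' Iio r = ⋃ n : ℕ, ⋃ s : {s : Fin n → Fin k //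
          word f (firstDigit hX hk0) n ⁻¹' {s} ⊆ X ⁻¹' Iio r},
            word f (firstDigit hX hk0) n ⁻¹' {s.1} := by
        apply Subset.antisymm
        · intro w hw
          have hw' : 0 < r - X w := sub_pos.mpr hw
          obtain ⟨n, hn⟩ := exists_pow_lt_of_lt_one hw' (inv_lt_one_of_one_lt₀ hk')
          refine mem_iUnion.mpr ⟨n, mem_iUnion.mpr ⟨⟨word f (firstDigit hX hk0) n w, ?_⟩, rfl⟩⟩
          obtain ⟨j, -, hj⟩ := exists_word_eq_iff hX hk0 hXf n (word f (firstDigit hX hk0) n w)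
          intro w' hw'
          have h1 := (hj w').mp hw'
          have h2 := (hj w).mp rfl
          have hkn : 0 < (k : ℝ) ^ n := by positivity
          have h3 : (k : ℝ) ^ n * (X w' - X w) < 1 := by linarith
          have h4 : X w' - X w < (k : ℝ)⁻¹ ^ n := by
            rw [inv_pow, ← one_div, lt_div_iff₀ hkn]
            linarith
          change X w' < r
          linarith
        · exact iUnion_subset fun n => iUnion_subset fun s => s.2
      rw [this]
      exact MeasurableSet.iUnion fun n => MeasurableSet.iUnion fun s =>
        MeasurableSpace.measurableSet_generateFrom ⟨n, {s.1}, rfl⟩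
    intro S hS
    have : S = X ⁻¹' (E ⁻¹' S) := by
      ext w
      simp [hEX]
    rw [this]
    exact hXg (hE hS)
  · refine MeasurableSpace.generateFrom_le ?_
    rintro _ ⟨n, S, rfl⟩
    exact measurable_word hf (measurable_firstDigit hX hk0 hXm) n (Set.toFinite S).measurableSet

/-- A map which is conjugate to multiplication by `k` on `ℝ / ℤ` has Lebesgue measure as its
measure of maximal entropy. -/
theorem isMME_of_semiconj (hk : 2 ≤ k) (hX : ∀ w, X w ∈ Ico (0 : ℝ) 1)
    (hXf : ∀ w, X (f w) = Int.fract (k * X w)) (hf : Measurable f) (hXm : Measurable X)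
    {E : ℝ → Ω} (hE : Measurable E) (hEX : ∀ w, E (X w) = w) {η : Measure Ω}
    (hη : η.map X = volume.restrict (Ico 0 1)) : IsMME f η := by
  have hk0 : 0 < k := by omega
  have hk' : (0 : ℝ) < k := by exact_mod_cast hk0
  have hprob : IsProbabilityMeasure η := by
    constructor
    rw [← preimage_univ (f := X), ← Measure.map_apply hXm MeasurableSet.univ, hη]
    simp
  have hζ := measurable_firstDigit hX hk0 hXm
  have hgen := generateFrom_cylinderSets_firstDigit hk hX hXf hf hXm hE hEX
  have hu : ∀ n (s : Fin n → Fin k),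
      η.real (word f (firstDigit hX hk0) n ⁻¹' {s}) = ((k : ℝ) ^ n)⁻¹ := by
    intro n s
    obtain ⟨j, hj, h⟩ := exists_word_eq_iff hX hk0 hXf n s
    have hkn : 0 < (k : ℝ) ^ n := by positivity
    have hpre : word f (firstDigit hX hk0) n ⁻¹' {s} =
        X ⁻¹' Ico (j / (k : ℝ) ^ n) ((j + 1) / (k : ℝ) ^ n) := by
      ext w
      rw [mem_preimage, mem_singleton_iff, h, mem_preimage, mem_Ico, div_le_iff₀ hkn,
        lt_div_iff₀ hkn, mul_comm]
    have hsub : Ico (j / (k : ℝ) ^ n) ((j + 1) / (k : ℝ) ^ n) ⊆ Ico 0 1 := by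
      refine Ico_subset_Ico (by positivity) ((div_le_one hkn).mpr ?_)
      exact_mod_cast hj
    rw [hpre, ← map_measureReal_apply hXm measurableSet_Ico, hη,
      measureReal_restrict_apply measurableSet_Ico, inter_eq_self_of_subset_left hsub,
      Real.volume_real_Ico_of_le (by gcongr; linarith)]
    field_simp
    ring
  refine isMME_of_uniform hk0 ⟨hf, ?_⟩ hζ hgen hu
  have : IsProbabilityMeasure (η.map f) := Measure.isProbabilityMeasure_map hf.aemeasurable
  refine ext_of_words hgen hf hζ fun n s => ?_
  have hw := measurable_word hf hζ n (measurableSet_singleton s)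
  rw [map_measureReal_apply hf hw, hu, ← sum_measureReal_preimage_singleton hζ _ (hf hw)]
  -- The preimage of the word s splits by first digit into the k words (d, s), of total mass k ·
  -- k^(-(n+1)). This proves invariance.
  have hcons : ∀ d, f ⁻¹' (word f (firstDigit hX hk0) n ⁻¹' {s}) ∩ firstDigit hX hk0 ⁻¹' {d} =
      word f (firstDigit hX hk0) (n + 1) ⁻¹' {Fin.cons d s} := fun d => by
    ext w
    simp only [mem_inter_iff, mem_preimage, mem_singleton_iff]
    constructor
    · rintro ⟨rfl, rfl⟩
      funext i
      refine Fin.cases ?_ (fun i => ?_) i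
      · rfl
      · simp [word]
    · intro h
      refine ⟨?_, congr_fun h 0⟩
      funext i
      have := congr_fun h i.succ
      simpa [word] using this
  simp only [hcons, hu, Finset.sum_const, Finset.card_univ, Fintype.card_fin, nsmul_eq_mul]
  rw [pow_succ]
  field_simp

end Digits

section

variable {k : ℕ} {t : ℝ} (hk : 2 ≤ k) (h0 : 0 < t) (h1 : t < 1) {a b : ℝ} {N : ℕ}
  (hN : ∀ φ ∈ Icc a b, ∀ w, 2 ≤ cocycle k t N (φ, w))

include hk h0 h1 hN

theorem monotone_leafFun_left {φ : ℝ} (hφ : φ ∈ Icc a b) :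
    Monotone fun c => leafFun k t c φ := fun c c' h => by
  rw [← (strictMono_linearization hk h0 h1 hN hφ).le_iff_le, linearization_leafFun hk h0 h1,
    linearization_leafFun hk h0 h1]
  exact h

theorem isAdapted_verticalFiber {φ : ℝ} (hφ : φ ∈ Icc a b) :
    IsAdapted (straighten k t) (Ico 0 (2 * Real.pi))
      (fun c => (φ, Circle.exp (leafFun k t c φ))) (verticalFiber φ) := by
  have hm := (monotone_leafFun_left hk h0 h1 hN hφ).measurable
  have hχ : ∀ c, straighten k t (φ, Circle.exp (leafFun k t c φ)) = Circle.exp c := fun c => by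
    rw [straighten_exp, linearization_leafFun hk h0 h1]
  refine ⟨measurableSet_Ico, measurable_const.prodMk (Circle.exp.continuous.measurable.comp hm),
    fun c hc c' hc' h => ?_, ?_, fun c _ => hχ c⟩
  · have h2 : Circle.exp c = Circle.exp c' := by
      rw [← hχ c, ← hχ c']
      exact congr_arg _ h
    exact Circle.exp_injOn_Ico (by simp) hc hc' h2
  · ext ⟨φ', w⟩
    simp only [verticalFiber, mem_image, Prod.mk.injEq, mem_prod, mem_singleton_iff, mem_univ,
      and_true]
    constructor
    · rintro ⟨_, _, rfl, _⟩
      rfl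
    · rintro rfl
      obtain ⟨θ, rfl⟩ := Circle.exp_surjective w
      obtain ⟨c, hc, he⟩ := exists_mem_Ico_exp_eq (Circle.exp (linearization k t φ' θ))
      refine ⟨c, hc, rfl, ?_⟩
      obtain ⟨m, hm⟩ := Circle.exp_eq_exp.mp he
      refine Circle.exp_eq_exp.mpr ⟨m, (eq_leafFun hk h0 h1 hN hφ ?_).symm⟩
      rw [linearization_add_int, hm]

/-- The coordinate X = Φ_φ/2π mod 1 conjugates the fibre map to multiplication by k, is invertible
by `leafFun`, and sends the transverse measure to Lebesgue measure on [0, 1). -/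
theorem isMME_transverseMeasure {φ : ℝ} (hφ : φ ∈ Icc a b) :
    IsMME (blaschkeCircle k t (Circle.exp φ))
      ((transverseMeasure (straighten k t) (verticalFiber φ)).map Prod.snd) := by
  have hpi : 0 < 2 * Real.pi := by positivity
  have hm : Measurable fun c => leafFun k t c φ := (monotone_leafFun_left hk h0 h1 hN hφ).measurable
  set X : Circle → ℝ := fun w => Int.fract (linearization k t φ (Complex.arg w) / (2 * Real.pi))
    with hX
  have hXe : ∀ θ, X (Circle.exp θ) = Int.fract (linearization k t φ θ / (2 * Real.pi)) := by
    intro θ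
    obtain ⟨m, hm⟩ := Circle.exp_eq_exp.mp (Circle.exp_arg (Circle.exp θ))
    simp only [hX]
    rw [hm, linearization_add_int, add_div, mul_div_cancel_right₀ _ hpi.ne', Int.fract_add_intCast]
  have hXm : Measurable X := by
    have h2 : Measurable fun w : Circle => Complex.arg w :=
      Complex.measurable_arg.comp isInducing_circle_coe.continuous.measurable
    exact measurable_fract.comp
      (((continuous_linearization_right hk h0 h1 φ).measurable.comp h2).div_const _)
  refine isMME_of_semiconj hk (X := X) (E := fun u => Circle.exp (leafFun k t (2 * Real.pi * u) φ))
    (fun w => ⟨Int.fract_nonneg _, Int.fract_lt_one _⟩) (fun w => ?_) ?_ hXm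
    (Circle.exp.continuous.measurable.comp (hm.comp (measurable_id.const_mul _))) (fun w => ?_) ?_
  · obtain ⟨θ, rfl⟩ := Circle.exp_surjective w
    rw [blaschkeCircle_exp h0 h1, hXe, hXe, linearization_fiberLift hk, Int.fract_eq_fract]
    refine ⟨k * ⌊linearization k t φ θ / (2 * Real.pi)⌋, ?_⟩
    rw [Int.fract]
    push_cast
    ring
  · exact ((continuous_blaschkeCircle k h0 h1).comp (by fun_prop :
      Continuous fun w : Circle => (Circle.exp φ, w))).measurable
  · obtain ⟨θ, rfl⟩ := Circle.exp_surjective w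
    rw [hXe]
    refine Circle.exp_eq_exp.mpr ⟨-⌊linearization k t φ θ / (2 * Real.pi)⌋, ?_⟩
    refine (eq_leafFun hk h0 h1 hN hφ ?_).symm
    rw [linearization_add_int, Int.fract]
    push_cast
    field_simp
    ring
  · have hA := isAdapted_verticalFiber hk h0 h1 hN hφ
    have hc : ∀ c ∈ Ico 0 (2 * Real.pi),
        X (Prod.snd ((φ, Circle.exp (leafFun k t c φ)) : ℝ × Circle)) = (2 * Real.pi)⁻¹ * c := by
      intro c hc
      dsimp only
      rw [hXe, linearization_leafFun hk h0 h1, Int.fract_eq_self.mpr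
        ⟨div_nonneg hc.1 hpi.le, (div_lt_one hpi).mpr hc.2⟩]
      ring
    rw [Measure.map_map hXm measurable_snd, hA.transverseMeasure_eq, Measure.map_smul,
      Measure.map_map (hXm.comp measurable_snd) hA.2.1]
    have hcongr : (volume.restrict (Ico 0 (2 * Real.pi))).map
        ((X ∘ Prod.snd) ∘ fun c => ((φ, Circle.exp (leafFun k t c φ)) : ℝ × Circle)) =
        (volume.restrict (Ico 0 (2 * Real.pi))).map fun c => (2 * Real.pi)⁻¹ * c :=
      Measure.map_congr ((ae_restrict_iff' measurableSet_Ico).mpr (ae_of_all _ hc))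
    have hpre : Ico 0 (2 * Real.pi) = (fun c => (2 * Real.pi)⁻¹ * c) ⁻¹' Ico 0 1 := by
      ext c
      rw [mem_preimage, mem_Ico, mem_Ico, mul_nonneg_iff_of_pos_left (inv_pos.mpr hpi),
        inv_mul_lt_iff₀ hpi, mul_one]
    rw [hcongr, hpre, ← Measure.restrict_map (measurable_const_mul _) measurableSet_Ico,
      ← Measure.restrict_smul]
    congr 1
    have := Real.smul_map_volume_mul_left (a := (2 * Real.pi)⁻¹) (inv_pos.mpr hpi).ne'
    rw [abs_of_pos (inv_pos.mpr hpi)] at this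
    rw [one_div]
    exact this

end

/-! ### The Lee–Yang zeros of the Cayley tree -/

section Recursion

variable {k : ℕ}

theorem isParent_asymm : ∀ {n : ℕ} {u v : CayleyVertex k n}, IsParent k n u v → ¬ IsParent k n v u
  | 0, _, _, h => h.elim
  | _ + 1, none, some _, _ => fun h => h
  | _ + 1, some (_, _), some (_, _), h => fun h' => isParent_asymm h.2 h'.2
  | _ + 1, none, none, h => h.elim
  | _ + 1, some _, none, h => h.elim

open Classical in
/-- The number of edges of the Cayley tree whose ends have different spins. -/
def disagreements (k n : ℕ) (σ : CayleyVertex k n → ℤˣ) : ℕ :=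
  ∑ u, ∑ v, if IsParent k n u v ∧ σ u ≠ σ v then 1 else 0

open Classical in
-- The parent relation is asymmetric, so every edge comes from exactly one ordered pair.
theorem card_filter_edgeFinset (n : ℕ) (σ : CayleyVertex k n → ℤˣ) :
    ((cayleyTree k n).edgeFinset.filter fun e => ¬ (e.map σ).IsDiag).card =
      disagreements k n σ := by
  rw [disagreements, ← Fintype.sum_prod_type' (f := fun u v =>
    if IsParent k n u v ∧ σ u ≠ σ v then 1 else 0), ← Finset.card_filter]
  symm
  refine Finset.card_bij (fun p _ => s(p.1, p.2)) ?_ ?_ ?_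
  · rintro ⟨u, v⟩ h
    obtain ⟨-, h1, h2⟩ := Finset.mem_filter.mp h
    rw [Finset.mem_filter, SimpleGraph.mem_edgeFinset, SimpleGraph.mem_edgeSet]
    refine ⟨?_, h2⟩
    rw [cayleyTree, SimpleGraph.fromRel_adj]
    exact ⟨fun e => h2 (congr_arg σ e), Or.inl h1⟩
  · rintro ⟨u, v⟩ h ⟨u', v'⟩ h' e
    rcases Sym2.eq_iff.mp e with ⟨rfl, rfl⟩ | ⟨rfl, rfl⟩
    · rfl
    · exact (isParent_asymm (Finset.mem_filter.mp h).2.1 (Finset.mem_filter.mp h').2.1).elim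
  · intro e h
    induction e using Sym2.ind with
    | _ u v =>
      rw [Finset.mem_filter, SimpleGraph.mem_edgeFinset, SimpleGraph.mem_edgeSet, cayleyTree,
        SimpleGraph.fromRel_adj] at h
      obtain ⟨⟨-, h1⟩, h2⟩ := h
      have h2' : σ u ≠ σ v := h2
      rcases h1 with h1 | h1
      · exact ⟨(u, v), Finset.mem_filter.mpr ⟨Finset.mem_univ _, h1, h2'⟩, rfl⟩
      · exact ⟨(v, u), Finset.mem_filter.mpr ⟨Finset.mem_univ _, h1, h2'.symm⟩, Sym2.eq_swap⟩

theorem sum_cayleyVertex_succ {M : Type*} [AddCommMonoid M] (n : ℕ)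
    (f : CayleyVertex k (n + 1) → M) :
    ∑ v, f v = f (none : Option (Fin k × CayleyVertex k n)) +
      ∑ i, ∑ v, f (some (i, v) : Option (Fin k × CayleyVertex k n)) :=
  (Fintype.sum_option (α := Fin k × CayleyVertex k n) f).trans
    (congr_arg _ (Fintype.sum_prod_type _))

/-- A configuration on level `n + 1` consists of the spin at the root and `k` configurations on
level `n`. -/
def glueSpins (n : ℕ) : ℤˣ × (Fin k → CayleyVertex k n → ℤˣ) ≃ (CayleyVertex k (n + 1) → ℤˣ) where
  toFun p v := (v : Option (Fin k × CayleyVertex k n)).elim p.1 fun x => p.2 x.1 x.2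
  invFun σ := (σ (none : Option (Fin k × CayleyVertex k n)),
    fun i v => σ (some (i, v) : Option (Fin k × CayleyVertex k n)))
  left_inv _ := rfl
  right_inv σ := by
    funext v
    rcases v with _ | ⟨i, v⟩ <;> rfl

theorem disagreements_glueSpins (n : ℕ) (s : ℤˣ) (τ : Fin k → CayleyVertex k n → ℤˣ) :
    disagreements k (n + 1) (glueSpins n (s, τ)) =
      ∑ i, ((if s ≠ τ i (cayleyRoot k n) then 1 else 0) + disagreements k n (τ i)) := by
  classical
  rw [disagreements, sum_cayleyVertex_succ]
  simp only [sum_cayleyVertex_succ]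
  have h00 : (IsParent k (n + 1) (none : Option (Fin k × CayleyVertex k n))
    (none : Option (Fin k × CayleyVertex k n))) = False := rfl
  have h10 : ∀ i v, (IsParent k (n + 1) (some (i, v) : Option (Fin k × CayleyVertex k n))
    (none : Option (Fin k × CayleyVertex k n))) = False := fun _ _ => rfl
  have h01 : ∀ i v, (IsParent k (n + 1) (none : Option (Fin k × CayleyVertex k n))
    (some (i, v) : Option (Fin k × CayleyVertex k n))) = (v = cayleyRoot k n) := fun _ _ => rfl
  have h11 : ∀ i v j u, (IsParent k (n + 1) (some (i, v) : Option (Fin k × CayleyVertex k n))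
    (some (j, u) : Option (Fin k × CayleyVertex k n))) = (i = j ∧ IsParent k n v u) :=
      fun _ _ _ _ => rfl
  have g0 : glueSpins n (s, τ) (none : Option (Fin k × CayleyVertex k n)) = s := rfl
  have g1 : ∀ i v, glueSpins n (s, τ) (some (i, v) : Option (Fin k × CayleyVertex k n)) = τ i v :=
    fun _ _ => rfl
  simp only [h00, h10, h01, h11, g0, g1, false_and, if_false, zero_add]
  rw [Finset.sum_add_distrib]
  congr 1
  · refine Finset.sum_congr rfl fun i _ => ?_
    rw [Finset.sum_eq_single (cayleyRoot k n)]
    · simp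
    · intro v _ hv
      simp [hv]
    · simp
  · refine Finset.sum_congr rfl fun i _ => ?_
    rw [disagreements]
    refine Finset.sum_congr rfl fun u _ => ?_
    rw [Finset.sum_eq_single i]
    · simp
    · intro j _ hj
      simp [hj.symm]
    · simp

open Classical in
/-- The Boltzmann weight of a configuration. -/
def spinWeight (k n : ℕ) (t z : ℂ) (σ : CayleyVertex k n → ℤˣ) : ℂ :=
  t ^ disagreements k n σ * z ^ ∑ v, if σ v = -1 then 1 else 0

open Classical in
/-- The partition function with prescribed spin at the root. -/
def rootedPartition (k n : ℕ) (t z : ℂ) (s : ℤˣ) : ℂ :=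
  ∑ σ : CayleyVertex k n → ℤˣ, if σ (cayleyRoot k n) = s then spinWeight k n t z σ else 0

theorem eval_isingPolynomial (n : ℕ) (t : ℝ) (z : ℂ) :
    (isingPolynomial (cayleyTree k n) t).eval z =
      rootedPartition k n t z 1 + rootedPartition k n t z (-1) := by
  classical
  rw [isingPolynomial, Polynomial.eval_finsetSum, rootedPartition, rootedPartition,
    ← Finset.sum_add_distrib]
  refine Finset.sum_congr rfl fun σ _ => ?_
  rw [Polynomial.eval_mul, Polynomial.eval_C, Polynomial.eval_pow, Polynomial.eval_X,
    card_filter_edgeFinset, Finset.card_filter, spinWeight]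
  rcases Int.units_eq_one_or (σ (cayleyRoot k n)) with h | h <;> simp [h]

theorem spinWeight_glueSpins (n : ℕ) (t z : ℂ) (s : ℤˣ) (τ : Fin k → CayleyVertex k n → ℤˣ) :
    spinWeight k (n + 1) t z (glueSpins n (s, τ)) = (if s = -1 then z else 1) *
      ∏ i, (if s ≠ τ i (cayleyRoot k n) then t else 1) * spinWeight k n t z (τ i) := by
  classical
  have h : (∑ v, if glueSpins n (s, τ) v = -1 then 1 else 0) =
      (if s = -1 then 1 else 0) + ∑ i, ∑ v, if τ i v = -1 then 1 else 0 :=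
    sum_cayleyVertex_succ n _
  have e : ∀ (p : Prop) [Decidable p] (x : ℂ), x ^ (if p then 1 else 0) = if p then x else 1 :=
    fun p _ x => by split_ifs <;> simp
  rw [spinWeight, disagreements_glueSpins, h, Finset.prod_mul_distrib]
  simp only [spinWeight, Finset.sum_add_distrib, pow_add, Finset.prod_mul_distrib,
    ← Finset.prod_pow_eq_pow_sum, e]
  ring

theorem rootedPartition_zero (t z : ℂ) (s : ℤˣ) :
    rootedPartition k 0 t z s = if s = -1 then z else 1 := by
  classical
  have hw : ∀ σ : CayleyVertex k 0 → ℤˣ, spinWeight k 0 t z σ =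
      if σ (cayleyRoot k 0) = -1 then z else 1 := fun σ => by
    have h1 : disagreements k 0 σ = 0 := by
      refine Finset.sum_eq_zero fun u _ => Finset.sum_eq_zero fun v _ => ?_
      exact if_neg fun h => h.1.elim
    have h2 : (∑ v : CayleyVertex k 0, if σ v = -1 then 1 else 0) =
        if σ (cayleyRoot k 0) = -1 then 1 else 0 :=
      Fintype.sum_unique (ι := Unit) fun v => if σ v = -1 then 1 else 0
    rw [spinWeight, h1, h2]
    split_ifs <;> simp
  rw [rootedPartition, Finset.sum_eq_single fun _ => s]
  · simp [hw]
  · intro σ _ hσ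
    refine if_neg fun h => hσ (funext fun v => ?_)
    rw [← h]
    rfl
  · simp

/-- Given the root spin the k branches are independent, and each contributes its two root spins with
a factor t for the opposite one. -/
theorem rootedPartition_succ (n : ℕ) (t z : ℂ) (s : ℤˣ) :
    rootedPartition k (n + 1) t z s = (if s = -1 then z else 1) *
      (rootedPartition k n t z s + t * rootedPartition k n t z (-s)) ^ k := by
  classical
  have hroot : ∀ p : ℤˣ × (Fin k → CayleyVertex k n → ℤˣ),
      glueSpins n p (cayleyRoot k (n + 1)) = p.1 := fun _ => rfl
  have hone : rootedPartition k n t z s + t * rootedPartition k n t z (-s) =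
      ∑ σ, (if s ≠ σ (cayleyRoot k n) then t else 1) * spinWeight k n t z σ := by
    rw [rootedPartition, rootedPartition, Finset.mul_sum, ← Finset.sum_add_distrib]
    refine Finset.sum_congr rfl fun σ _ => ?_
    rcases Int.units_eq_one_or (σ (cayleyRoot k n)) with h | h <;>
      rcases Int.units_eq_one_or s with rfl | rfl <;> simp [h]
  rw [rootedPartition, ← (glueSpins n).sum_comp, Fintype.sum_prod_type, Finset.sum_eq_single s]
  · simp only [hroot, if_true, spinWeight_glueSpins]
    rw [← Finset.mul_sum, sum_prod_pi fun (_ : Fin k) σ =>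
      (if s ≠ σ (cayleyRoot k n) then t else 1) * spinWeight k n t z σ, hone, Finset.prod_const,
      Finset.card_univ, Fintype.card_fin]
  · intro s' _ hs'
    refine Finset.sum_eq_zero fun τ _ => if_neg ?_
    rwa [hroot]
  · exact fun h => (h (Finset.mem_univ _)).elim

theorem card_cayleyVertex_succ (k n : ℕ) :
    Fintype.card (CayleyVertex k (n + 1)) = k * Fintype.card (CayleyVertex k n) + 1 := by
  refine (Fintype.card_option (α := Fin k × CayleyVertex k n)).trans ?_
  rw [Fintype.card_prod, Fintype.card_fin]

theorem natDegree_isingPolynomial_le {V : Type} [Fintype V] (G : SimpleGraph V) (t : ℝ) :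
    (isingPolynomial G t).natDegree ≤ Fintype.card V := by
  classical
  refine Polynomial.natDegree_sum_le_of_forall_le _ _ fun σ _ => ?_
  refine (Polynomial.natDegree_C_mul_X_pow_le _ _).trans ?_
  exact Finset.card_le_univ _

theorem eval_zero_isingPolynomial (n : ℕ) (t : ℝ) :
    (isingPolynomial (cayleyTree k n) t).eval 0 = 1 := by
  have h : ∀ n, rootedPartition k n t 0 1 = 1 ∧ rootedPartition k n t 0 (-1) = 0 := fun n => by
    induction n with
    | zero => simp [rootedPartition_zero]
    | succ n ih => simp [rootedPartition_succ, ih.1, ih.2]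
  rw [eval_isingPolynomial, (h n).1, (h n).2, add_zero]

end Recursion

/-! ### Location of the zeros -/

section Zeros

variable {k : ℕ} (hk : 2 ≤ k) {t : ℝ} (h0 : 0 < t) (h1 : t < 1)

include h0 h1 in
-- By the recursion the quotient w of the two rooted partition functions becomes z((w + t)/(1 +
-- wt))^k, starting from w = z. Zeros of the full partition function are thus the places where w =
-- -1.
theorem rootedPartition_exp (n : ℕ) (φ : ℝ) :
    rootedPartition k n t (Circle.exp φ) 1 ≠ 0 ∧
      rootedPartition k n t (Circle.exp φ) (-1) =
        rootedPartition k n t (Circle.exp φ) 1 * Circle.exp ((fiberLift k t φ)^[n] φ) := by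
  induction n with
  | zero => simp [rootedPartition_zero]
  | succ n ih =>
    obtain ⟨ih1, ih2⟩ := ih
    have hne := one_add_mul_ne_zero h0.le h1 (Circle.exp ((fiberLift k t φ)^[n] φ))
    rw [Function.iterate_succ_apply', ← blaschkeCircle_exp h0 h1, coe_blaschkeCircle h0.le h1,
      blaschke, rootedPartition_succ, rootedPartition_succ, neg_neg, ih2]
    set P := rootedPartition k n t (Circle.exp φ) 1
    set w : ℂ := (Circle.exp ((fiberLift k t φ)^[n] φ) : ℂ)
    have e1 : P + t * (P * w) = P * (1 + w * t) := by ring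
    have e2 : P * w + t * P = P * (w + t) := by ring
    have h11 : (1 : ℤˣ) ≠ -1 := by simp
    rw [e1, e2, if_pos rfl, if_neg h11, one_mul]
    refine ⟨pow_ne_zero _ (mul_ne_zero ih1 hne), ?_⟩
    rw [mul_pow, mul_pow, div_pow]
    field_simp

include hk h0 h1 in
theorem strictMono_fiberLift_iterate_diag (n : ℕ) :
    StrictMono fun φ => (fiberLift k t φ)^[n] φ := by
  intro φ φ' h
  rcases n with _ | n
  · exact h
  · dsimp only
    rw [Function.iterate_succ_apply', Function.iterate_succ_apply']
    have h2 := (strictMono_fiberLift hk h0 h1 φ).monotone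
      (fiberLift_iterate_mono hk h0 h1 h.le h.le n)
    unfold fiberLift at *
    linarith

/-- The winding numbers and the vertex counts obey the same recursion M ↦ kM + 1. -/
theorem fiberLift_iterate_diag_add (n : ℕ) (φ : ℝ) :
    (fiberLift k t (φ + 2 * Real.pi))^[n] (φ + 2 * Real.pi) =
      (fiberLift k t φ)^[n] φ + Fintype.card (CayleyVertex k n) * (2 * Real.pi) := by
  induction n with
  | zero =>
    have : Fintype.card (CayleyVertex k 0) = 1 := Fintype.card_unit
    simp [this]
  | succ n ih =>
    have := angleLift_add_int_mul_two_pi t ((fiberLift k t φ)^[n] φ)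
      (Fintype.card (CayleyVertex k n) : ℤ)
    push_cast at this
    rw [Function.iterate_succ_apply', Function.iterate_succ_apply', ih, fiberLift, this,
      card_cayleyVertex_succ, fiberLift]
    push_cast
    ring

theorem fiberLift_iterate_zero (n : ℕ) : (fiberLift k t 0)^[n] 0 = 0 := by
  have := fiberLift_iterate_neg (k := k) (t := t) 0 0 n
  rw [neg_zero] at this
  linarith

include h0 h1 in
theorem isRoot_isingPolynomial_exp (n : ℕ) {φ : ℝ}
    (h : Circle.exp ((fiberLift k t φ)^[n] φ) = Circle.exp Real.pi) :
    (isingPolynomial (cayleyTree k n) t).IsRoot (Circle.exp φ) := by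
  rw [Polynomial.IsRoot, eval_isingPolynomial, (rootedPartition_exp h0 h1 n φ).2, h,
    Circle.coe_exp Real.pi, Complex.exp_pi_mul_I]
  ring

include hk h0 h1

/-- The Lee–Yang zeros of the Cayley tree are simple and lie on the unit circle. -/
theorem exists_roots_isingPolynomial (n : ℕ) :
    ∃ ζ : Fin (Fintype.card (CayleyVertex k n)) → ℝ,
      (∀ j, ζ j ∈ Ioc 0 (2 * Real.pi) ∧
        (fiberLift k t (ζ j))^[n] (ζ j) = Real.pi + j * (2 * Real.pi)) ∧
      (isingPolynomial (cayleyTree k n) t).roots =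
        Finset.univ.val.map fun j => (Circle.exp (ζ j) : ℂ) := by
  have hpi := Real.pi_pos
  set M := Fintype.card (CayleyVertex k n) with hM
  have hmono := strictMono_fiberLift_iterate_diag hk h0 h1 n
  have hcont : Continuous fun φ => (fiberLift k t φ)^[n] φ :=
    (continuous_fiberLift_iterate k h0 h1 n).comp (continuous_id.prodMk continuous_id)
  have hend : (fiberLift k t (2 * Real.pi))^[n] (2 * Real.pi) = M * (2 * Real.pi) := by
    have := fiberLift_iterate_diag_add (k := k) (t := t) n 0
    rwa [zero_add, fiberLift_iterate_zero, zero_add] at this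
  have hex : ∀ j : Fin M, ∃ φ ∈ Ioc 0 (2 * Real.pi),
      (fiberLift k t φ)^[n] φ = Real.pi + j * (2 * Real.pi) := fun j => by
    have hj : ((j : ℕ) : ℝ) + 1 ≤ M := by exact_mod_cast j.isLt
    have hj0 : (0 : ℝ) ≤ ((j : ℕ) : ℝ) := Nat.cast_nonneg _
    refine intermediate_value_Ioc (by positivity) hcont.continuousOn ⟨?_, ?_⟩
    · rw [fiberLift_iterate_zero]
      positivity
    · rw [hend]
      nlinarith
  choose ζ hζ hζe using hex
  refine ⟨ζ, fun j => ⟨hζ j, hζe j⟩, ?_⟩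
  have hinj : Function.Injective fun j => (Circle.exp (ζ j) : ℂ) := fun i j h => by
    have h2 := Circle.exp_injOn_Ioc (by simp) (hζ i) (hζ j) (Circle.ext h)
    have h3 := hζe i
    rw [h2, hζe j] at h3
    have h4 : ((j : ℕ) : ℝ) = i := by
      have := mul_right_cancel₀ (by positivity : 2 * Real.pi ≠ 0) (add_left_cancel h3)
      exact this
    exact Fin.ext (by exact_mod_cast h4.symm)
  have hne : isingPolynomial (cayleyTree k n) t ≠ 0 := fun h => by
    have := eval_zero_isingPolynomial (k := k) n t
    rw [h, Polynomial.eval_zero] at this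
    exact zero_ne_one this
  symm
  -- The intermediate value theorem has produced as many distinct roots as there are vertices, which
  -- bounds the degree; hence there are no others.
  refine Multiset.eq_of_le_of_card_le ?_ ?_
  · refine (Multiset.le_iff_subset (Finset.univ.nodup.map hinj)).mpr fun z hz => ?_
    obtain ⟨j, -, rfl⟩ := Multiset.mem_map.mp hz
    refine (Polynomial.mem_roots hne).mpr (isRoot_isingPolynomial_exp h0 h1 n ?_)
    exact Circle.exp_eq_exp.mpr ⟨j, by rw [hζe]; push_cast; ring⟩
  · refine (Polynomial.card_roots' _).trans ((natDegree_isingPolynomial_le _ t).trans ?_)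
    simp [hM]

end Zeros

/-! ### The limiting measure of the Lee–Yang zeros -/

section WeakConvergence

theorem tendsto_probabilityMeasure_of_tendsto_Iic {ν' : ℕ → ProbabilityMeasure ℝ}
    {ν : ProbabilityMeasure ℝ}
    (h : ∀ y, Tendsto (fun n => (ν' n : Measure ℝ).real (Iic y)) atTop
      (𝓝 ((ν : Measure ℝ).real (Iic y)))) : Tendsto ν' atTop (𝓝 ν) := by
  refine (isPiSystem_Ioc (id : ℝ → ℝ) id).tendsto_probabilityMeasure_of_tendsto_of_mem ?_ ?_ ?_
  · rintro _ ⟨x, y, -, rfl⟩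
    exact measurableSet_Ioc
  · intro u hu x hx
    obtain ⟨ε, hε, hball⟩ := Metric.isOpen_iff.mp hu x hx
    refine ⟨_, ⟨x - ε / 2, x + ε / 2, by simp only [id]; linarith, rfl⟩,
      Ioc_mem_nhds (by simp only [id]; linarith) (by simp only [id]; linarith), fun y hy => hball ?_⟩
    rw [Metric.mem_ball, Real.dist_eq, abs_lt]
    simp only [id, mem_Ioc] at hy
    constructor <;> linarith [hy.1, hy.2]
  · rintro _ ⟨x, y, hxy, rfl⟩
    have hd : ∀ ρ : ProbabilityMeasure ℝ, ((ρ (Ioc (id x) (id y)) : NNReal) : ℝ) =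
        (ρ : Measure ℝ).real (Iic y) - (ρ : Measure ℝ).real (Iic x) := fun ρ => by
      rw [← measureReal_sdiff (Iic_subset_Iic.mpr (show x ≤ y from hxy.le)) measurableSet_Iic, Iic_sdiff_Iic]
      rfl
    rw [← NNReal.tendsto_coe]
    simp only [hd]
    exact (h y).sub (h x)

/-- The count is ⌊x + 1/2⌋ with x = β/2π. -/
theorem abs_card_filter_sub_le {M : ℕ} {β : ℝ} (h0 : 0 ≤ β) (hM : β ≤ M * (2 * Real.pi)) :
    |((Finset.univ.filter fun j : Fin M => Real.pi + j * (2 * Real.pi) ≤ β).card : ℝ) -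
      β / (2 * Real.pi)| ≤ 1 := by
  have hpi := Real.pi_pos
  set x := β / (2 * Real.pi) with hx
  have hβ : β = x * (2 * Real.pi) := by rw [hx]; field_simp
  have hx0 : 0 ≤ x := by positivity
  have hxM : x ≤ M := by
    rw [hβ] at hM
    exact le_of_mul_le_mul_right hM (by positivity)
  have hle : ⌊x + 1 / 2⌋₊ ≤ M := by
    rw [← Nat.lt_add_one_iff, Nat.floor_lt (by positivity)]
    push_cast
    linarith
  have hc : (Finset.univ.filter fun j : Fin M => Real.pi + j * (2 * Real.pi) ≤ β).card =
      ⌊x + 1 / 2⌋₊ := by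
    rw [← min_eq_right hle, ← Fin.card_filter_val_lt]
    congr 1
    ext j
    simp only [Finset.mem_filter, Finset.mem_univ, true_and]
    rw [← Nat.succ_le_iff, Nat.le_floor_iff (by positivity), hβ]
    push_cast
    constructor
    · intro h
      have : ((j : ℕ) + 1 / 2 : ℝ) * (2 * Real.pi) ≤ x * (2 * Real.pi) := by linarith
      have := le_of_mul_le_mul_right this (by positivity)
      linarith
    · intro h
      have : ((j : ℕ) + 1 / 2 : ℝ) * (2 * Real.pi) ≤ x * (2 * Real.pi) :=
        mul_le_mul_of_nonneg_right (by linarith) (by positivity)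
      linarith
  rw [hc, abs_le]
  have h1 := Nat.floor_le (by positivity : 0 ≤ x + 1 / 2)
  have h2 := Nat.lt_floor_add_one (x + 1 / 2)
  constructor <;> linarith

/-- The normalized counting measure of a finite family. -/
def countingMeasure {M : ℕ} (ζ : Fin M → ℝ) : Measure ℝ :=
  (M : ℝ≥0∞)⁻¹ • ∑ j, Measure.dirac (ζ j)

theorem isProbabilityMeasure_countingMeasure {M : ℕ} (hM : 0 < M) (ζ : Fin M → ℝ) :
    IsProbabilityMeasure (countingMeasure ζ) := by
  constructor
  rw [countingMeasure, Measure.smul_apply, Measure.finsetSum_apply]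
  simp only [measure_univ, Finset.sum_const, Finset.card_univ, Fintype.card_fin, nsmul_eq_mul,
    mul_one, smul_eq_mul]
  exact ENNReal.inv_mul_cancel (by exact_mod_cast hM.ne') (ENNReal.natCast_ne_top M)

theorem countingMeasure_real_Iic {M : ℕ} (ζ : Fin M → ℝ) (y : ℝ) :
    (countingMeasure ζ).real (Iic y) = (Finset.univ.filter fun j => ζ j ≤ y).card / M := by
  rw [countingMeasure, measureReal_def, Measure.smul_apply, Measure.finsetSum_apply]
  have : ∀ j, Measure.dirac (ζ j) (Iic y) = if ζ j ≤ y then 1 else 0 := fun j => by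
    rw [Measure.dirac_apply' _ measurableSet_Iic, indicator_apply]
    rfl
  simp only [this, smul_eq_mul, ENNReal.toReal_mul, ENNReal.toReal_inv, ENNReal.toReal_natCast]
  rw [Finset.sum_boole, ENNReal.toReal_natCast]
  ring

end WeakConvergence

section LimitMeasure

/-- A continuous monotone function as a Stieltjes function. -/
def stieltjesOfContinuous (H : ℝ → ℝ) (hm : Monotone H) (hc : Continuous H) :
    StieltjesFunction ℝ where
  toFun := H
  mono' := hm
  right_continuous' _ := hc.continuousWithinAt

variable {k : ℕ} (hk : 2 ≤ k) {t : ℝ} (h0 : 0 < t) (h1 : t < 1)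

/-- The lift to `ℝ` of (a multiple of) the limiting measure. -/
def diagMeasure : Measure ℝ :=
  (stieltjesOfContinuous _ (monotone_linearization_diag hk h0 h1)
    (continuous_linearization_diag hk h0 h1)).measure

theorem diagMeasure_Ioc (x y : ℝ) : diagMeasure hk h0 h1 (Ioc x y) =
    ENNReal.ofReal (linearization k t y y - linearization k t x x) :=
  StieltjesFunction.measure_Ioc _ _ _

theorem linearization_zero_zero : linearization k t 0 0 = 0 := by
  have := linearization_neg (k := k) (t := t) 0 0
  rw [neg_zero] at this
  linarith

include hk in
theorem linearization_two_pi : linearization k t (2 * Real.pi) (2 * Real.pi) =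
    2 * Real.pi * (k / (k - 1)) := by
  have := linearization_add_add hk (t := t) 0 0
  rwa [zero_add, linearization_zero_zero, zero_add] at this

/-- The limiting measure of the Lee–Yang zeros. -/
def limitMeasure : Measure Circle :=
  ENNReal.ofReal ((k - 1) / (2 * Real.pi * k)) •
    ((diagMeasure hk h0 h1).restrict (Ioc 0 (2 * Real.pi))).map Circle.exp

/-- On (0, 2π] the distribution functions of the zeros are G_n(y)/G_n(2π) up to 1/|V_n|. Dividing
numerator and denominator by k^n gives the limit H(y)/H(2π) with H(φ) = Φ_φ(φ), and weak convergence
on ℝ is pushed forward to the circle. -/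
theorem isLimitingLeeYangMeasure_limitMeasure :
    IsLimitingLeeYangMeasure k t (limitMeasure hk h0 h1) := by
  have hpi := Real.pi_pos
  have hk' : (2 : ℝ) ≤ k := by exact_mod_cast hk
  have hk1 : (0 : ℝ) < k - 1 := by linarith
  have hexp : Measurable Circle.exp := Circle.exp.continuous.measurable
  set c : ℝ := (k - 1) / (2 * Real.pi * k) with hc
  have hc0 : 0 ≤ c := by positivity
  set H : ℝ → ℝ := fun φ => linearization k t φ φ with hH
  have hH0 : H 0 = 0 := linearization_zero_zero
  have hH2 : H (2 * Real.pi) = c⁻¹ := by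
    rw [hc, hH]
    dsimp only
    rw [linearization_two_pi hk]
    field_simp
  have hHm : Monotone H := monotone_linearization_diag hk h0 h1
  set ν : Measure ℝ := ENNReal.ofReal c • (diagMeasure hk h0 h1).restrict (Ioc 0 (2 * Real.pi))
    with hν
  have hνIic : ∀ y, ν (Iic y) = ENNReal.ofReal (c * H (max 0 (min y (2 * Real.pi)))) := fun y => by
    rw [hν, Measure.smul_apply, Measure.restrict_apply measurableSet_Iic, smul_eq_mul]
    have : Iic y ∩ Ioc 0 (2 * Real.pi) = Ioc 0 (max 0 (min y (2 * Real.pi))) := by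
      ext x
      simp only [mem_inter_iff, mem_Iic, mem_Ioc, le_max_iff, le_min_iff]
      constructor
      · rintro ⟨h1, h2, h3⟩
        exact ⟨h2, Or.inr ⟨h1, h3⟩⟩
      · rintro ⟨h1, h2 | ⟨h2, h3⟩⟩
        · linarith
        · exact ⟨h2, h1, h3⟩
    rw [this, diagMeasure_Ioc, ← ENNReal.ofReal_mul hc0, linearization_zero_zero, sub_zero]
  have hνprob : IsProbabilityMeasure ν := by
    constructor
    have h2 : ν univ = ν (Iic (2 * Real.pi)) := by
      simp only [hν, Measure.smul_apply, Measure.restrict_apply MeasurableSet.univ,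
        Measure.restrict_apply measurableSet_Iic, univ_inter,
        inter_eq_self_of_subset_right Ioc_subset_Iic_self]
    have hc1 : c ≠ 0 := by positivity
    rw [h2, hνIic, min_self, max_eq_right (by positivity), hH2, mul_inv_cancel₀ hc1,
      ENNReal.ofReal_one]
  have hmap : limitMeasure hk h0 h1 = ν.map Circle.exp := by
    rw [limitMeasure, hν, Measure.map_smul]
  refine ⟨hmap ▸ Measure.isProbabilityMeasure_map hexp.aemeasurable, fun f => ?_⟩
  choose ζ hζ hroots using exists_roots_isingPolynomial hk h0 h1
  set M : ℕ → ℕ := fun n => Fintype.card (CayleyVertex k n) with hM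
  have hMn : ∀ n, n < M n := fun n => by
    induction n with
    | zero => exact Fintype.card_pos_iff.mpr ⟨cayleyRoot k 0⟩
    | succ n ih =>
      simp only [hM] at ih ⊢
      rw [card_cayleyVertex_succ]
      nlinarith
  have hM0 : ∀ n, (0 : ℝ) < M n := fun n => by exact_mod_cast (Nat.zero_le n).trans_lt (hMn n)
  have hprob : ∀ n, IsProbabilityMeasure (countingMeasure (ζ n)) := fun n =>
    isProbabilityMeasure_countingMeasure ((Nat.zero_le n).trans_lt (hMn n)) _
  set G : ℕ → ℝ → ℝ := fun n φ => (fiberLift k t φ)^[n] φ with hG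
  have hGm : ∀ n, StrictMono (G n) := fun n => strictMono_fiberLift_iterate_diag hk h0 h1 n
  have hG0 : ∀ n, G n 0 = 0 := fun n => fiberLift_iterate_zero n
  have hG2 : ∀ n, G n (2 * Real.pi) = M n * (2 * Real.pi) := fun n => by
    have := fiberLift_iterate_diag_add (k := k) (t := t) n 0
    rwa [zero_add, fiberLift_iterate_zero, zero_add] at this
  have hcount : ∀ n y, |(countingMeasure (ζ n)).real (Iic y) -
      G n (max 0 (min y (2 * Real.pi))) / G n (2 * Real.pi)| ≤ 1 / M n := fun n y => by
    set y' := max 0 (min y (2 * Real.pi)) with hy'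
    have hy0 : 0 ≤ y' := le_max_left _ _
    have hy2 : y' ≤ 2 * Real.pi := max_le (by positivity) (min_le_right _ _)
    have hfil : (Finset.univ.filter fun j => ζ n j ≤ y) =
        Finset.univ.filter fun j : Fin (M n) => Real.pi + j * (2 * Real.pi) ≤ G n y' := by
      ext j
      simp only [Finset.mem_filter, Finset.mem_univ, true_and]
      rw [← (hζ n j).2]
      change _ ↔ G n (ζ n j) ≤ G n y'
      rw [(hGm n).le_iff_le, hy', le_max_iff, le_min_iff]
      have h3 := (hζ n j).1
      constructor
      · exact fun h => Or.inr ⟨h, h3.2⟩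
      · rintro (h | h)
        · exact absurd h3.1 (not_lt.mpr h)
        · exact h.1
    have hb := abs_card_filter_sub_le (M := M n) (β := G n y') (by
      rw [← hG0 n]
      exact (hGm n).monotone hy0) (by
      rw [← hG2 n]
      exact (hGm n).monotone hy2)
    rw [countingMeasure_real_Iic, hfil, hG2]
    have e : G n y' / (M n * (2 * Real.pi)) = G n y' / (2 * Real.pi) / M n := by
      field_simp
    rw [e, ← sub_div, abs_div, abs_of_pos (hM0 n)]
    gcongr
  have hIic : ∀ y, Tendsto (fun n => (countingMeasure (ζ n)).real (Iic y)) atTop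
      (𝓝 (ν.real (Iic y))) := fun y => by
    set y' := max 0 (min y (2 * Real.pi)) with hy'
    have hlim : Tendsto (fun n => G n y' / G n (2 * Real.pi)) atTop (𝓝 (c * H y')) := by
      have h2 := (tendsto_iterate_div_pow hk (t := t) y' y').div
        (tendsto_iterate_div_pow hk (t := t) (2 * Real.pi) (2 * Real.pi)) (by
          change H (2 * Real.pi) ≠ 0
          rw [hH2]
          positivity)
      have e : c * H y' = linearization k t y' y' / linearization k t (2 * Real.pi) (2 * Real.pi) := by
        change c * H y' = H y' / H (2 * Real.pi)
        rw [hH2, div_inv_eq_mul, mul_comm]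
      rw [e]
      refine h2.congr fun n => ?_
      have : (k : ℝ) ^ n ≠ 0 := by positivity
      exact div_div_div_cancel_right₀ this _ _
    have hMinf : Tendsto (fun n => 1 / (M n : ℝ)) atTop (𝓝 0) := by
      refine squeeze_zero (fun n => (one_div_pos.mpr (hM0 n)).le) (fun n => ?_)
        tendsto_one_div_add_atTop_nhds_zero_nat
      have : ((n : ℝ) + 1) ≤ M n := by exact_mod_cast hMn n
      exact one_div_le_one_div_of_le (by positivity) this
    have hdiff := squeeze_zero_norm (fun n => (Real.norm_eq_abs _).le.trans (hcount n y)) hMinf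
    have hsum := hdiff.add hlim
    rw [zero_add] at hsum
    have hHy : 0 ≤ H y' := by
      rw [← hH0]
      exact hHm (le_max_left _ _)
    rw [measureReal_def, hνIic, ENNReal.toReal_ofReal (by positivity)]
    exact hsum.congr fun n => sub_add_cancel _ _
  have hconv := tendsto_probabilityMeasure_of_tendsto_Iic
    (ν' := fun n => ⟨countingMeasure (ζ n), hprob n⟩) (ν := ⟨ν, hνprob⟩) hIic
  have hcont : Continuous fun x : ℝ => ((Circle.exp x : Circle) : ℂ) :=
    isInducing_circle_coe.continuous.comp Circle.exp.continuous
  have hf := ProbabilityMeasure.tendsto_iff_forall_integral_tendsto.mp hconv (f.compContinuous ⟨_, hcont⟩)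
  have hcoe : Measurable fun w : Circle => f (w : ℂ) :=
    (f.continuous.comp isInducing_circle_coe.continuous).measurable
  rw [hmap, integral_map hexp.aemeasurable hcoe.aestronglyMeasurable]
  refine hf.congr fun n => ?_
  have hint : ∀ z : ℂ, Integrable f (Measure.dirac z) := fun z =>
    f.integrable _
  have hly : leeYangMeasure k t n =
      ((M n : ℕ) : ℝ≥0∞)⁻¹ • ∑ j, Measure.dirac ((Circle.exp (ζ n j) : Circle) : ℂ) := by
    rw [leeYangMeasure, hroots, Multiset.map_map]
    rfl
  rw [hly, integral_smul_measure, integral_finsetSum_measure fun j _ => hint _]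
  change ∫ x, f.compContinuous ⟨_, hcont⟩ x ∂(countingMeasure (ζ n)) = _
  rw [countingMeasure, integral_smul_measure, integral_finsetSum_measure fun j _ =>
    (f.compContinuous ⟨_, hcont⟩).integrable _]
  simp only [integral_dirac]
  rfl

end LimitMeasure

/-! ### The support of the limiting measure -/

section Support

variable {k : ℕ} (hk : 2 ≤ k) {t : ℝ} (h0 : 0 < t) (h1 : t < 1)

include hk in
theorem linearization_diag_add_int (φ : ℝ) (m : ℤ) :
    linearization k t (φ + m * (2 * Real.pi)) (φ + m * (2 * Real.pi)) =
      linearization k t φ φ + m * (2 * Real.pi) * (k / (k - 1)) := by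
  have hper : Function.Periodic (fun φ => linearization k t φ φ - φ * (k / (k - 1)))
      (2 * Real.pi) := fun φ => by
    dsimp only
    rw [linearization_add_add hk]
    ring
  have := hper.int_mul m φ
  linarith

instance isLocallyFiniteMeasure_diagMeasure : IsLocallyFiniteMeasure (diagMeasure hk h0 h1) := by
  unfold diagMeasure
  infer_instance

instance vaddInvariantMeasure_diagMeasure :
    VAddInvariantMeasure (AddSubgroup.zmultiples (2 * Real.pi)) ℝ (diagMeasure hk h0 h1) where
  measure_preimage_vadd := by
    rintro ⟨_, m, rfl⟩ s hs
    have hmap : (diagMeasure hk h0 h1).map (fun x => (m : ℝ) * (2 * Real.pi) + x) =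
        diagMeasure hk h0 h1 := by
      refine (Measure.ext_of_Ioc _ _ fun x y _ => ?_).symm
      rw [Measure.map_apply (measurable_const_add _) measurableSet_Ioc, preimage_const_add_Ioc,
        diagMeasure_Ioc, diagMeasure_Ioc]
      have e1 := linearization_diag_add_int hk (t := t) (x - m * (2 * Real.pi)) m
      have e2 := linearization_diag_add_int hk (t := t) (y - m * (2 * Real.pi)) m
      rw [sub_add_cancel] at e1 e2
      rw [e1, e2]
      congr 1
      ring
    have := congr_arg (fun ρ : Measure ℝ => ρ s) hmap
    rw [Measure.map_apply (measurable_const_add _) hs] at this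
    convert this using 3
    funext x
    simp [AddSubgroup.vadd_def, zsmul_eq_mul]

/-- The measure dΦ on the diagonal is invariant under translation by 2π, so any half-open period is
a fundamental domain. The free choice of c avoids cutting the arc under study. -/
theorem limitMeasure_apply {A : Set Circle} (hA : MeasurableSet A) (c : ℝ) :
    limitMeasure hk h0 h1 A = ENNReal.ofReal ((k - 1) / (2 * Real.pi * k)) *
      diagMeasure hk h0 h1 (Circle.exp ⁻¹' A ∩ Ioc c (c + 2 * Real.pi)) := by
  have hpi : 0 < 2 * Real.pi := by positivity
  have hexp : Measurable Circle.exp := Circle.exp.continuous.measurable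
  rw [limitMeasure, Measure.smul_apply, smul_eq_mul, Measure.map_apply hexp hA,
    Measure.restrict_apply (hexp hA)]
  congr 1
  have d0 := isAddFundamentalDomain_Ioc hpi 0 (diagMeasure hk h0 h1)
  rw [zero_add] at d0
  refine d0.measure_set_eq (isAddFundamentalDomain_Ioc hpi c _) (hexp hA) ?_
  rintro ⟨_, m, rfl⟩
  ext x
  simp only [mem_preimage]
  have : Circle.exp ((⟨m • (2 * Real.pi), m, rfl⟩ : AddSubgroup.zmultiples (2 * Real.pi)) +ᵥ x) =
      Circle.exp x := Circle.exp_eq_exp.mpr ⟨m, by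
        simp [AddSubgroup.vadd_def, zsmul_eq_mul, add_comm]⟩
  rw [this]

/-- Where H is flat the open arc is null. Its endpoints are limits of points outside the support, so
they are not interior points either. -/
theorem notMem_interior_support {x y p : ℝ} (hxy : x < y) (hy : y ≤ x + 2 * Real.pi)
    (h : linearization k t x x = linearization k t y y) (hp : p ∈ Icc x y) :
    Circle.exp p ∉ interior (limitMeasure hk h0 h1).support := by
  intro hmem
  have hopen : IsOpen (Circle.exp '' Ioo x y) := isLocalHomeomorph_circleExp.isOpenMap _ isOpen_Ioo
  have hnull : limitMeasure hk h0 h1 (Circle.exp '' Ioo x y) = 0 := by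
    rw [limitMeasure_apply hk h0 h1 hopen.measurableSet x]
    have hsub : Circle.exp ⁻¹' (Circle.exp '' Ioo x y) ∩ Ioc x (x + 2 * Real.pi) ⊆ Ioc x y := by
      rintro z ⟨⟨u, hu, he⟩, hz⟩
      have : u = z := Circle.exp_injOn_Ioc (by simp) ⟨hu.1, by linarith [hu.2]⟩ hz he
      exact this ▸ Ioo_subset_Ioc_self hu
    have h2 : diagMeasure hk h0 h1 (Ioc x y) = 0 := by
      rw [diagMeasure_Ioc, h, sub_self, ENNReal.ofReal_zero]
    rw [measure_mono_null hsub h2, mul_zero]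
  have hnhds : Circle.exp ⁻¹' interior (limitMeasure hk h0 h1).support ∈ 𝓝 p :=
    (isOpen_interior.preimage Circle.exp.continuous).mem_nhds hmem
  have hcl : p ∈ closure (Ioo x y) := by rwa [closure_Ioo hxy.ne]
  obtain ⟨q, hq1, hq2⟩ := mem_closure_iff_nhds.mp hcl _ hnhds
  have hq3 : Circle.exp q ∈ (limitMeasure hk h0 h1).support := interior_subset hq1
  exact Measure.notMem_support_iff_exists.mpr
    ⟨_, hopen.mem_nhds (mem_image_of_mem _ hq2), hnull⟩ hq3

/-- Over the interior of the support of the limiting measure, all fixed points in the fibres are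
repelling. -/
theorem one_lt_fiberDeriv_of_fixed {φ : ℝ}
    (hφ : Circle.exp φ ∈ interior (limitMeasure hk h0 h1).support)
    (htc : t = ((k : ℝ) - 1) / ((k : ℝ) + 1) → Circle.exp φ ≠ 1) (w : Circle)
    (hw : blaschkeCircle k t (Circle.exp φ) w = w) : 1 < fiberDeriv k t w := by
  have hpi := Real.pi_pos
  by_contra! hd
  obtain ⟨θ, rfl, hθ1, hθ2⟩ : ∃ θ, Circle.exp θ = w ∧ -Real.pi < θ ∧ θ ≤ Real.pi :=
    ⟨Complex.arg w, Circle.exp_arg w, Complex.neg_pi_lt_arg _, Complex.arg_le_pi _⟩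
  rw [blaschkeCircle_exp h0 h1] at hw
  obtain ⟨m, hm⟩ := Circle.exp_eq_exp.mp hw
  have hφ' : Circle.exp φ = Circle.exp (θ - k * angleLift t θ) :=
    Circle.exp_eq_exp.mpr ⟨m, by rw [fiberLift] at hm; linarith⟩
  have key : ∀ θ', 0 < θ' → θ' ≤ Real.pi → fiberDeriv k t (Circle.exp θ') ≤ 1 →
      ∃ y, y = θ' - k * angleLift t θ' ∧ 0 < y ∧ y ≤ Real.pi ∧ linearization k t y y = 0 := by
    intro θ' h h' hd'
    obtain ⟨a1, a2, a3⟩ := linearization_diag_eq_zero hk h0 h1 h h' hd'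
    exact ⟨_, rfl, a1, a2, a3 _ ⟨a1.le, le_rfl⟩⟩
  -- Complex conjugation reduces θ < 0 to θ > 0. In both cases e^{iφ} is the far endpoint of a gap
  -- that reaches to 1.
  rcases lt_trichotomy θ 0 with hneg | rfl | hpos
  · obtain ⟨y, hy, hy0, hy1, hH⟩ := key (-θ) (by linarith) (by linarith) (by
      rw [fiberDeriv_exp] at hd ⊢
      rwa [Real.cos_neg])
    rw [angleLift_neg] at hy
    refine notMem_interior_support hk h0 h1 (x := -y) (y := 0) (p := -y) (by linarith)
      (by linarith) ?_ ⟨le_rfl, by linarith⟩ ?_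
    · rw [linearization_neg, hH, linearization_zero_zero, neg_zero]
    · rw [show -y = θ - k * angleLift t θ by rw [hy]; ring, ← hφ']
      exact hφ
  · have ha0 : angleLift t 0 = 0 := by simp [angleLift]
    rw [ha0, mul_zero, sub_zero, Circle.exp_zero] at hφ'
    -- A fixed point at 1 has multiplier k(1 - t)/(1 + t), which equals 1 only at t_c. Otherwise it
    -- is below 1, nearby θ' > 0 give a genuine gap, and the point is its endpoint 0.
    have hne : t ≠ ((k : ℝ) - 1) / ((k : ℝ) + 1) := fun h => htc h hφ'
    have hlt : fiberDeriv k t (Circle.exp 0) < 1 := by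
      refine lt_of_le_of_ne hd fun he => hne ?_
      rw [fiberDeriv_exp, Real.cos_zero] at he
      have hk' : (0 : ℝ) ≤ k := Nat.cast_nonneg k
      have ht : (1 + t) ≠ 0 := by positivity
      rw [show 1 + t ^ 2 + 2 * t * 1 = (1 + t) ^ 2 by ring, ← mul_div_assoc,
        div_eq_one_iff_eq (by positivity)] at he
      have : k * (1 - t) = 1 + t := mul_right_cancel₀ ht (by linear_combination he)
      rw [eq_div_iff (by positivity)]
      linarith
    have hev : ∀ᶠ θ' in 𝓝[>] (0 : ℝ), fiberDeriv k t (Circle.exp θ') < 1 :=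
      nhdsWithin_le_nhds (((continuous_fiberDeriv k h0 h1).comp
        Circle.exp.continuous).continuousAt.eventually_lt continuousAt_const hlt)
    have hIoc : ∀ᶠ θ' in 𝓝[>] (0 : ℝ), θ' ∈ Ioc 0 Real.pi := Ioc_mem_nhdsGT hpi
    obtain ⟨θ', ⟨hθ'1, hθ'2⟩, hθ'3⟩ := (hIoc.and hev).exists
    obtain ⟨y, -, hy0, hy1, hH⟩ := key θ' hθ'1 hθ'2 hθ'3.le
    refine notMem_interior_support hk h0 h1 (x := 0) (y := y) (p := 0) hy0 (by linarith) ?_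
      ⟨le_rfl, hy0.le⟩ ?_
    · rw [hH, linearization_zero_zero]
    · rw [Circle.exp_zero, ← hφ']
      exact hφ
  · obtain ⟨y, hy, hy0, hy1, hH⟩ := key θ hpos hθ2 hd
    refine notMem_interior_support hk h0 h1 (x := 0) (y := y) (p := y) hy0 (by linarith) ?_
      ⟨hy0.le, le_rfl⟩ ?_
    · rw [hH, linearization_zero_zero]
    · rw [hy, ← hφ']
      exact hφ

end Support

/-! ### The diagonal -/

section Diagonal

variable {k : ℕ} (hk : 2 ≤ k) {t : ℝ} (h0 : 0 < t) (h1 : t < 1) {a b : ℝ} {N : ℕ} (hN1 : 1 ≤ N)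
  (hN : ∀ φ ∈ Icc a b, ∀ w, 2 ≤ cocycle k t N (φ, w))

theorem diagMeasure_Icc (x y : ℝ) : diagMeasure hk h0 h1 (Icc x y) =
    ENNReal.ofReal (linearization k t y y - linearization k t x x) := by
  rw [diagMeasure, StieltjesFunction.measure_Icc]
  have hc : Continuous (stieltjesOfContinuous _ (monotone_linearization_diag hk h0 h1)
    (continuous_linearization_diag hk h0 h1)) := continuous_linearization_diag hk h0 h1
  rw [hc.continuousAt.continuousWithinAt.leftLim_eq]
  rfl

theorem limitMeasure_restrict_image (hab2 : b < a + 2 * Real.pi) :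
    (limitMeasure hk h0 h1).restrict (Circle.exp '' Icc a b) =
      ENNReal.ofReal ((k - 1) / (2 * Real.pi * k)) •
        ((diagMeasure hk h0 h1).restrict (Icc a b)).map Circle.exp := by
  have hexp : Measurable Circle.exp := Circle.exp.continuous.measurable
  have hm : MeasurableSet (Circle.exp '' Icc a b) :=
    (isCompact_Icc.image Circle.exp.continuous).isClosed.measurableSet
  ext A hA
  rw [Measure.restrict_apply hA, limitMeasure_apply hk h0 h1 (hA.inter hm) (b - 2 * Real.pi),
    Measure.smul_apply, smul_eq_mul, Measure.map_apply hexp hA,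
    Measure.restrict_apply (hexp hA), sub_add_cancel]
  congr 2
  ext x
  simp only [mem_inter_iff, mem_preimage]
  constructor
  · rintro ⟨⟨h2, u, hu, he⟩, hx⟩
    have : u = x := Circle.exp_injOn_Ioc (by simp) ⟨by linarith [hu.1], hu.2⟩ hx he
    exact ⟨h2, this ▸ hu⟩
  · rintro ⟨h2, hx⟩
    exact ⟨⟨h2, mem_image_of_mem _ hx⟩, by linarith [hx.1], hx.2⟩

/-- The pushforward of Lebesgue measure under the inverse of `H` is the Stieltjes measure. -/
theorem map_volume_restrict_eq {γ : ℝ → ℝ} (hγ : Measurable γ) (hab : a < b)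
    (hγH : ∀ u ∈ Icc a b, γ (linearization k t u u) = u) :
    (volume.restrict ((fun φ => linearization k t φ φ) '' Icc a b)).map γ =
      (diagMeasure hk h0 h1).restrict (Icc a b) := by
  set H : ℝ → ℝ := fun φ => linearization k t φ φ with hH
  have hmono : Monotone H := monotone_linearization_diag hk h0 h1
  have hcont : Continuous H := continuous_linearization_diag hk h0 h1
  have himg : ∀ y ∈ Icc a b, H '' Icc a y = Icc (H a) (H y) := fun y hy =>
    Subset.antisymm
      (image_subset_iff.mpr fun x hx => ⟨hmono hx.1, hmono hx.2⟩)
      (intermediate_value_Icc hy.1 hcont.continuousOn)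
  have hms : MeasurableSet (H '' Icc a b) := by
    rw [himg b ⟨hab.le, le_rfl⟩]
    exact measurableSet_Icc
  have hfin : IsFiniteMeasure (volume.restrict (H '' Icc a b)) := by
    rw [himg b ⟨hab.le, le_rfl⟩]
    infer_instance
  have hfin2 : IsFiniteMeasure ((volume.restrict (H '' Icc a b)).map γ) := inferInstance
  refine Measure.ext_of_Iic _ _ fun y => ?_
  rw [Measure.map_apply hγ measurableSet_Iic, Measure.restrict_apply (hγ measurableSet_Iic),
    Measure.restrict_apply measurableSet_Iic]
  have hpre : γ ⁻¹' Iic y ∩ H '' Icc a b = H '' (Iic y ∩ Icc a b) := by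
    ext c
    simp only [mem_inter_iff, mem_preimage, mem_image]
    constructor
    · rintro ⟨h2, u, hu, rfl⟩
      exact ⟨u, ⟨by rwa [hγH u hu] at h2, hu⟩, rfl⟩
    · rintro ⟨u, ⟨h2, hu⟩, rfl⟩
      exact ⟨by rwa [hγH u hu], u, hu, rfl⟩
  rw [hpre]
  rcases lt_or_ge y a with hy | hy
  · have : Iic y ∩ Icc a b = ∅ := by
      ext x
      simp only [mem_inter_iff, mem_Iic, mem_Icc, mem_empty_iff_false, iff_false]
      rintro ⟨h1, h2, -⟩
      linarith
    simp [this]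
  · have : Iic y ∩ Icc a b = Icc a (min y b) := by
      ext x
      simp only [mem_inter_iff, mem_Iic, mem_Icc, le_min_iff]
      tauto
    rw [this, himg _ ⟨le_min hy hab.le, min_le_right _ _⟩, Real.volume_Icc, diagMeasure_Icc]

include hN1 hN in
-- The diagonal is parametrized by H(φ) = Φ_φ(φ), so its transverse measure is dH/2π, whereas μ is
-- (k - 1)/(2πk) dH.
theorem map_transverseMeasure_diagonal (hab : a < b) (hab2 : b < a + 2 * Real.pi) :
    (transverseMeasure (straighten k t) (diagonal a b)).map Prod.snd =
      ENNReal.ofReal ((k : ℝ) / ((k : ℝ) - 1)) •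
        (limitMeasure hk h0 h1).restrict (Circle.exp '' Icc a b) := by
  have hpi := Real.pi_pos
  have hk' : (2 : ℝ) ≤ k := by exact_mod_cast hk
  have hk1 : (0 : ℝ) < k - 1 := by linarith
  have hinj := injOn_linearization_diag hk h0 h1 hN1 hN hab
  obtain ⟨γ, hγ, hγH⟩ := exists_isAdapted (χ := straighten k t) measurableSet_Icc
    (κ := fun u => ((u, Circle.exp u) : ℝ × Circle)) (I := Icc a b)
    (Continuous.continuousOn (by fun_prop)) (fun x _ y _ h => congr_arg Prod.fst h)
    (continuous_linearization_diag hk h0 h1).continuousOn hinj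
    (fun u _ => straighten_exp k t u u)
  have hdiag : (fun u => ((u, Circle.exp u) : ℝ × Circle)) '' Icc a b = diagonal a b := rfl
  rw [hdiag] at hγ
  have hγm := hγ.2.1
  rw [hγ.transverseMeasure_eq, limitMeasure_restrict_image hk h0 h1 hab2, Measure.map_smul,
    Measure.map_map measurable_snd hγm, smul_smul, ← ENNReal.ofReal_mul (by positivity)]
  have hc : (k : ℝ) / (k - 1) * ((k - 1) / (2 * Real.pi * k)) = 1 / (2 * Real.pi) := by
    field_simp
  rw [hc, ← map_volume_restrict_eq hk h0 h1 (measurable_fst.comp hγm) hab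
    (fun u hu => by simp only [Function.comp]; rw [hγH u hu]),
    Measure.map_map Circle.exp.continuous.measurable (measurable_fst.comp hγm)]
  congr 1
  refine Measure.map_congr ((ae_restrict_iff' hγ.1).mpr (ae_of_all _ ?_))
  rintro _ ⟨u, hu, rfl⟩
  simp only [Function.comp]
  rw [hγH u hu]

end Diagonal


end LeeYangCayley

end

/-! ### Assembly of the proposition -/

theorem proposition5p1 (k : ℕ) (hk : 2 ≤ k) (t : ℝ) (ht0 : 0 < t) (ht1 : t < 1) :
    ∃ μ : Measure Circle, LeeYangCayley.IsLimitingLeeYangMeasure k t μ ∧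
      ∀ a b : ℝ, a < b → b < a + 2 * Real.pi →
        Circle.exp '' Icc a b ⊆ interior μ.support →
        (t = ((k : ℝ) - 1) / ((k : ℝ) + 1) → (1 : Circle) ∉ Circle.exp '' Icc a b) →
        ∃ F : Set (Set (ℝ × Circle)),
          LeeYangCayley.IsCentralFoliation k t a b F ∧
          (∀ F', LeeYangCayley.IsCentralFoliation k t a b F' → F' = F) ∧
          ∃ η : Set (ℝ × Circle) → Measure (ℝ × Circle),
            LeeYangCayley.IsTransverseInvariantMeasure a b F η ∧
            (∀ φ ∈ Icc a b,
              LeeYangCayley.IsTransversal a b F (LeeYangCayley.verticalFiber φ) ∧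
              LeeYangCayley.IsMME (LeeYangCayley.blaschkeCircle k t (Circle.exp φ))
                ((η (LeeYangCayley.verticalFiber φ)).map Prod.snd)) ∧
            LeeYangCayley.IsTransversal a b F (LeeYangCayley.diagonal a b) ∧
            (η (LeeYangCayley.diagonal a b)).map Prod.snd =
              ENNReal.ofReal ((k : ℝ) / ((k : ℝ) - 1)) • μ.restrict (Circle.exp '' Icc a b) := by
  refine ⟨LeeYangCayley.limitMeasure hk ht0 ht1,
    LeeYangCayley.isLimitingLeeYangMeasure_limitMeasure hk ht0 ht1, fun a b hab hab2 hsupp htc => ?_⟩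
  obtain ⟨N, hN1, hN⟩ := LeeYangCayley.exists_uniform_expansion hk ht0 ht1 (isCompact_Icc (a := a)
    (b := b)) fun φ hφ w hw => LeeYangCayley.one_lt_fiberDeriv_of_fixed hk ht0 ht1
      (hsupp (mem_image_of_mem _ hφ)) (fun h he => htc h (he ▸ mem_image_of_mem _ hφ)) w hw
  refine ⟨range fun c => LeeYangCayley.graphCurve a b (LeeYangCayley.leafFun k t c),
    LeeYangCayley.isCentralFoliation_range hk ht0 ht1 hN1 hN hab,
    fun F' hF' => LeeYangCayley.eq_range_of_isCentralFoliation hk ht0 ht1 hN1 hN hab hF',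
    LeeYangCayley.transverseMeasure (LeeYangCayley.straighten k t),
    LeeYangCayley.isTransverseInvariantMeasure_transverseMeasure hk ht0 ht1 hN1 hN hab,
    fun φ hφ => ⟨LeeYangCayley.isTransversal_verticalFiber hφ,
      LeeYangCayley.isMME_transverseMeasure hk ht0 ht1 hN hφ⟩,
    LeeYangCayley.isTransversal_diagonal hk ht0 ht1 hN1 hN hab,
    LeeYangCayley.map_transverseMeasure_diagonal hk ht0 ht1 hN1 hN hab hab2⟩
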